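/- Let $\Bbbk$ be an algebraically closed field of characteristic zero, let $n\ge 2$, and let $Q$ be an acyclic orientation of an $n$-cycle: its vertex set is $\mathbb{Z}_n=\mathbb{Z}/n\mathbb{Z}$, for each $i\in\mathbb{Z}_n$ there is exactly one arrow between $i$ and $i+1$ (so two arrows in total if $n=2$), and $Q$ has no oriented cycles. Write $\operatorname{rep}_\Bbbk(Q)$ for the category of finite-dimensional representations $M=(M_i,M_a)$ of $Q$, with $M_a\colon M_{s(a)}\to M_{t(a)}$ for each arrow $a$, where $s(a)$ and $t(a)$ are the source and the target of $a$. A representation $M$ is *rigid* if $\operatorname{Ext}^1(M,M)=0$. Let $\tau$ be the Auslander–Reiten translation: for a projective presentation $0\to P_1\to P_0\to M\to 0$, $\tau(M)$ is the kernel of the induced map $D\operatorname{Hom}_Q(P_1,\Bbbk Q)\to D\operatorname{Hom}_Q(P_0,\Bbbk Q)$, where $D=\operatorname{Hom}_\Bbbk(-,\Bbbk)$. Call $M$ *preprojective* if $\tau^m(M)$ is projective for some $m\ge 0$, *postinjective* if $M\cong\tau^m(I)$ for some injective $I$ and some $m\ge 0$, and *regular* if it is neither preprojective nor postinjective. For $k,\ell\in\mathbb{Z}_n$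 let $[k,\ell]=\{k,k+1,\dots,\ell\}$ be the cyclic interval. If $[k,\ell]\subsetneq\mathbb{Z}_n$, let $M_{[k,\ell]}$ be the representation with $M_i=\Bbbk$ for $i\in[k,\ell]$ and $M_i=0$ otherwise, in which every arrow between two vertices of $[k,\ell]$ acts by the identity and all other arrows act by zero. **Proposition.** 1. If $[k,\ell]\subsetneq\mathbb{Z}_n$ is a proper subset that contains the same number of sinks and sources of $Q$, then $M_{[k,\ell]}$ is an indecomposable rigid regular representation of $Q$. 2. Every indecomposable rigid regular representation in $\operatorname{rep}_\Bbbk(Q)$ is isomorphic to $M_{[k,\ell]}$ for some $k,\ell\in\mathbb{Z}_n$ such that $[k,\ell]\subsetneq\mathbb{Z}_n$ is a proper subset that contains the same number of sinks and sources of $Q$. -/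

import Mathlib

universe u

/-- A `𝕜`-representation of a quiver `V`: a vector space at each vertex, a linear map
`M_{s(a)} → M_{t(a)}` for each arrow `a`. -/
structure QuiverRep (𝕜 : Type u) [Field 𝕜] (V : Type) [Quiver.{0} V] where
  space : V → Type u
  [addCommGroup : ∀ x, AddCommGroup (space x)]
  [module : ∀ x, Module 𝕜 (space x)]
  map : ∀ {x y : V}, (x ⟶ y) → space x →ₗ[𝕜] space y

attribute [instance] QuiverRep.addCommGroup QuiverRep.module

namespace QuiverRep

section General

variable {𝕜 : Type u} [Field 𝕜] {V : Type} [Quiver.{0} V]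

/-- Membership in `rep_𝕜(Q)`, the category of finite-dimensional representations
(of a quiver with finitely many vertices). -/
def IsFinDim (M : QuiverRep 𝕜 V) : Prop :=
  ∀ x, FiniteDimensional 𝕜 (M.space x)

/-- The vector space `Hom_Q(M, N)` of morphisms of representations. -/
def Hom (M N : QuiverRep 𝕜 V) :
    Submodule 𝕜 (∀ x, M.space x →ₗ[𝕜] N.space x) where
  carrier := {f | ∀ (x y : V) (a : x ⟶ y), f y ∘ₗ M.map a = N.map a ∘ₗ f x}
  add_mem' {f g} hf hg x y a := by
    simp only [Pi.add_apply, LinearMap.add_comp, LinearMap.comp_add, hf x y a, hg x y a]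
  zero_mem' x y a := by simp
  smul_mem' c f hf x y a := by
    simp only [Pi.smul_apply, LinearMap.smul_comp, LinearMap.comp_smul, hf x y a]

/-- Postcomposition with `g : N → L`, as a linear map `Hom_Q(M, N) → Hom_Q(M, L)`. -/
def postcomp (M : QuiverRep 𝕜 V) {N L : QuiverRep 𝕜 V} (g : N.Hom L) :
    M.Hom N →ₗ[𝕜] M.Hom L where
  toFun f := ⟨fun x => g.1 x ∘ₗ f.1 x, fun x y a => by
    rw [LinearMap.comp_assoc, f.2 x y a, ← LinearMap.comp_assoc, g.2 x y a,
      LinearMap.comp_assoc]⟩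
  map_add' f₁ f₂ := by
    ext x v
    simp
  map_smul' c f := by
    ext x v
    simp

/-- Precomposition with `f : M → N`, as a linear map `Hom_Q(N, L) → Hom_Q(M, L)`. -/
def precomp {M N : QuiverRep 𝕜 V} (L : QuiverRep 𝕜 V) (f : M.Hom N) :
    N.Hom L →ₗ[𝕜] M.Hom L where
  toFun g := M.postcomp g f
  map_add' g₁ g₂ := by
    ext x v
    simp [postcomp]
  map_smul' c g := by
    ext x v
    simp [postcomp]

/-- The two representations are isomorphic. -/
def IsIso (M N : QuiverRep 𝕜 V) : Prop :=
  ∃ f : M.Hom N, ∀ x, Function.Bijective (f.1 x)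

def IsZero (M : QuiverRep 𝕜 V) : Prop :=
  ∀ x, Subsingleton (M.space x)

/-- The direct sum `M ⊕ N`. -/
abbrev directSum (M N : QuiverRep 𝕜 V) : QuiverRep 𝕜 V where
  space x := M.space x × N.space x
  map a := (M.map a).prodMap (N.map a)

def IsIndecomposable (M : QuiverRep 𝕜 V) : Prop :=
  ¬ M.IsZero ∧ ∀ A B : QuiverRep 𝕜 V, M.IsIso (A.directSum B) → A.IsZero ∨ B.IsZero

/-- `0 → M → E → N → 0` is exact. -/
def IsShortExact {M E N : QuiverRep 𝕜 V} (i : M.Hom E) (p : E.Hom N) : Prop :=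
  ∀ x, Function.Injective (i.1 x) ∧ Function.Exact (i.1 x) (p.1 x) ∧
    Function.Surjective (p.1 x)

/-- `Ext¹(N, M) = 0`, where `Ext¹(N, M)` is the group of equivalence classes of extensions
`0 → M → E → N → 0`: every such extension splits. -/
def ExtOneVanishes (N M : QuiverRep 𝕜 V) : Prop :=
  ∀ (E : QuiverRep 𝕜 V) (i : M.Hom E) (p : E.Hom N), IsShortExact i p →
    ∃ s : N.Hom E, ∀ x, p.1 x ∘ₗ s.1 x = LinearMap.id

/-- `M` is rigid: `Ext¹(M, M) = 0`. -/
def IsRigid (M : QuiverRep 𝕜 V) : Prop :=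
  ExtOneVanishes M M

/-- `P` is a projective object of the category of finite-dimensional representations. -/
def IsProjective (P : QuiverRep 𝕜 V) : Prop :=
  P.IsFinDim ∧ ∀ (E N : QuiverRep 𝕜 V), E.IsFinDim → N.IsFinDim →
    ∀ p : E.Hom N, (∀ x, Function.Surjective (p.1 x)) →
      ∀ f : P.Hom N, ∃ g : P.Hom E, P.postcomp p g = f

/-- `I` is an injective object of the category of finite-dimensional representations. -/
def IsInjective (I : QuiverRep 𝕜 V) : Prop :=
  I.IsFinDim ∧ ∀ (N E : QuiverRep 𝕜 V), N.IsFinDim → E.IsFinDim →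
    ∀ i : N.Hom E, (∀ x, Function.Injective (i.1 x)) →
      ∀ f : N.Hom I, ∃ g : E.Hom I, precomp I i g = f

/-- The summand `P_i` of the path algebra `𝕜Q = ⨁ᵢ P_i` spanned by the paths that start at `i`:
its space at `x` has the paths from `i` to `x` as a basis, and an arrow `x → y` extends paths. -/
noncomputable abbrev pathRep (𝕜 : Type u) [Field 𝕜] {V : Type} [Quiver.{0} V] (i : V) :
    QuiverRep 𝕜 V where
  space x := Quiver.Path i x →₀ 𝕜
  map a := Finsupp.lmapDomain 𝕜 𝕜 fun p => p.cons a

/-- The morphism `P_j → P_i` that prepends the arrow `a : i → j` to each path. -/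
noncomputable def pathRepHom (𝕜 : Type u) [Field 𝕜] {V : Type} [Quiver.{0} V] {i j : V}
    (a : i ⟶ j) : (pathRep 𝕜 j).Hom (pathRep 𝕜 i) :=
  ⟨fun _ => Finsupp.lmapDomain 𝕜 𝕜 fun p => a.toPath.comp p, fun x y b => by
    refine Finsupp.lhom_ext' fun p => LinearMap.ext_ring ?_
    simp⟩

/-- The representation `D Hom_Q(P, 𝕜Q)`. Its space at `i` is the dual of the summand
`Hom_Q(P, P_i)` of `Hom_Q(P, 𝕜Q) = ⨁ᵢ Hom_Q(P, P_i)`, and an arrow `a : i → j` acts by the dual of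
the map `Hom_Q(P, P_j) → Hom_Q(P, P_i)` given by multiplication with `a`. -/
noncomputable abbrev nakayama (P : QuiverRep 𝕜 V) : QuiverRep 𝕜 V where
  space i := Module.Dual 𝕜 (P.Hom (pathRep 𝕜 i))
  map a := (P.postcomp (pathRepHom 𝕜 a)).dualMap

/-- The map `D Hom_Q(P, 𝕜Q) → D Hom_Q(P', 𝕜Q)` induced by `f : P → P'`, at the vertex `i`. -/
noncomputable def nakayamaMap {P P' : QuiverRep 𝕜 V} (f : P.Hom P') (i : V) :
    P.nakayama.space i →ₗ[𝕜] P'.nakayama.space i :=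
  (precomp (pathRep 𝕜 i) f).dualMap

/-- `N ≅ τ(M)`, where `τ` is the Auslander-Reiten translation: for a projective presentation
`0 → P₁ → P₀ → M → 0`, `τ(M)` is the kernel of `D Hom_Q(P₁, 𝕜Q) → D Hom_Q(P₀, 𝕜Q)`. -/
def IsARTranslate (M N : QuiverRep 𝕜 V) : Prop :=
  ∃ (P₁ P₀ : QuiverRep 𝕜 V) (i : P₁.Hom P₀) (p : P₀.Hom M) (j : N.Hom P₁.nakayama),
    P₁.IsProjective ∧ P₀.IsProjective ∧ IsShortExact i p ∧
      ∀ x, Function.Injective (j.1 x) ∧ Function.Exact (j.1 x) (nakayamaMap i x)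

/-- `N ≅ τᵐ(M)`. -/
def IsIterARTranslate : ℕ → QuiverRep 𝕜 V → QuiverRep 𝕜 V → Prop
  | 0, M, N => M.IsIso N
  | m + 1, M, N => ∃ L : QuiverRep 𝕜 V, M.IsARTranslate L ∧ IsIterARTranslate m L N

/-- `τᵐ(M)` is projective for some `m ≥ 0`. -/
def IsPreprojective (M : QuiverRep 𝕜 V) : Prop :=
  ∃ (m : ℕ) (P : QuiverRep 𝕜 V), IsIterARTranslate m M P ∧ P.IsProjective

/-- `M ≅ τᵐ(I)` for some injective `I` and some `m ≥ 0`. -/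
def IsPostinjective (M : QuiverRep 𝕜 V) : Prop :=
  ∃ (m : ℕ) (I : QuiverRep 𝕜 V), I.IsInjective ∧ IsIterARTranslate m I M

def IsRegular (M : QuiverRep 𝕜 V) : Prop :=
  ¬ M.IsPreprojective ∧ ¬ M.IsPostinjective

end General

end QuiverRep

/-- The quiver has no oriented cycles (in particular no loops). -/
def IsAcyclicQuiver (V : Type) [Quiver.{0} V] : Prop :=
  ∀ (x : V) (p : Quiver.Path x x), p.length = 0

/-- `x` is a sink: no arrow starts at `x`. -/
def IsQuiverSink {V : Type} [Quiver.{0} V] (x : V) : Prop :=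
  ∀ y : V, IsEmpty (x ⟶ y)

/-- `x` is a source: no arrow ends at `x`. -/
def IsQuiverSource {V : Type} [Quiver.{0} V] (x : V) : Prop :=
  ∀ y : V, IsEmpty (y ⟶ x)

/-- The arrows of an orientation `o` of the `n`-cycle on the vertices `ℤ/n`: for each `i` there is
one arrow between `i` and `i + 1`, pointing from `i` to `i + 1` exactly when `o i = true`. -/
inductive CycleArrow {n : ℕ} (o : ZMod n → Bool) : ZMod n → ZMod n → Type
  | clockwise (i : ZMod n) (h : o i = true) : CycleArrow o i (i + 1)
  | counterclockwise (i : ZMod n) (h : o i = false) : CycleArrow o (i + 1) i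

/-- The vertex set `ℤ/n` of the orientation `o` of the `n`-cycle. -/
def CycleQuiver {n : ℕ} (_o : ZMod n → Bool) : Type := ZMod n

instance CycleQuiver.instQuiver {n : ℕ} (o : ZMod n → Bool) : Quiver.{0} (CycleQuiver o) where
  Hom x y := CycleArrow o x y

/-- The cyclic interval `[k, ℓ] = {k, k + 1, …, ℓ}` in `ℤ/n`, for `n ≥ 1`. -/
def cyclicInterval {n : ℕ} (k ℓ : ZMod n) : Set (ZMod n) :=
  {x | (x - k).val ≤ (ℓ - k).val}

open Classical in
/-- The representation that is `𝕜` at the vertices in `S` and `0` at the other vertices (the space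
of functions to `𝕜` on a type that has one element if `x ∈ S` and none otherwise), each arrow
between vertices in `S` acting by the identity of `𝕜`. -/
noncomputable abbrev thinRep (𝕜 : Type u) [Field 𝕜] {V : Type} [Quiver.{0} V] (S : Set V) :
    QuiverRep 𝕜 V where
  space x := PLift (x ∈ S) → 𝕜
  map {x _} _ :=
    { toFun := fun v _ => if hx : x ∈ S then v ⟨hx⟩ else 0
      map_add' := fun v w => by
        funext _
        by_cases hx : x ∈ S <;> simp [hx]
      map_smul' := fun c v => by
        funext _
        by_cases hx : x ∈ S <;> simp [hx] }

/-- The representation `M_{[k,ℓ]}` of the orientation `o` of the `n`-cycle, for `[k,ℓ] ≠ ℤ/n`. -/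
noncomputable abbrev intervalRep (𝕜 : Type u) [Field 𝕜] {n : ℕ} (o : ZMod n → Bool)
    (k ℓ : ZMod n) : QuiverRep 𝕜 (CycleQuiver o) :=
  thinRep 𝕜 (V := CycleQuiver o) (cyclicInterval k ℓ)

/-- `[k,ℓ]` is a proper subset of `ℤ/n` with as many sinks as sources of the orientation `o`. -/
def IsBalancedProperInterval {n : ℕ} (o : ZMod n → Bool) (k ℓ : ZMod n) : Prop :=
  cyclicInterval k ℓ ≠ Set.univ ∧
    Set.ncard {x : ZMod n | x ∈ cyclicInterval k ℓ ∧ IsQuiverSink (V := CycleQuiver o) x} =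
      Set.ncard {x : ZMod n | x ∈ cyclicInterval k ℓ ∧ IsQuiverSource (V := CycleQuiver o) x}

/-! Write δ = (1, …, 1), ⟨·,·⟩ for the Euler form and q for its quadratic form. On the cycle 2q(d) =
∑ (d_i - d_{i+1})² (`two_mul_eulerForm_self`), so q is positive semidefinite with radical spanned by
δ, and the defect ∂(d) = ⟨δ, d⟩ equals -⟨d, δ⟩.

A rigid indecomposable has only scalar endomorphisms (`IsIndecomposable.exists_eq_smul_id`), so dim
Hom - dim Ext¹ gives q(dim M) = 1. Then ∑ (d_i - d_{i+1})² = 2, which forces dim M to be a constant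
plus the indicator of a proper interval (`exists_eq_add_indicatorVec`). Interval representations
have the same two properties, and the defect of an interval is its number of sources minus its
number of sinks (`defect_indicatorVec`). So balanced means defect zero.

For such representations regular also means defect zero. Nonzero projectives have negative defect,
nonzero injectives positive defect, and τ never lowers the defect; hence defect zero implies
regular. Conversely, the Auslander-Reiten formula (`IsARTranslate.homDim_eq`) shows that on
nonprojective indecomposables τ acts on dimension vectors by the Coxeter map Φ, where ⟨y, Φx⟩ = -⟨x,
y⟩. If the τ-orbit never meets a projective, all Φᵐx are nonnegative with the same q, so their
differences along edges are bounded and two of them differ by kδ with k ≥ 0. The sum a of the orbit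
between these two satisfies Φa = a + kδ, whence 2q(a) = k∂(a), which excludes negative defect. The
inverse translate excludes positive defect in the same way.

Finally, let M have defect zero and let X be the interval representation attached to dim M. Both
Euler pairings of M and X are 1, so there are nonzero morphisms X → M → X. Rigidity makes the arrows
of M inside the interval bijective, so X → M is injective; since End(M) consists of scalars, it is
an isomorphism. -/

open Quiver (Path)

namespace QuiverRep

/-- The arrows of a quiver, bundled with their source and target. -/
abbrev Arrows (V : Type) [Quiver.{0} V] : Type := Σ x y : V, (x ⟶ y)

/-! ### Morphisms, Ext¹ as the cokernel of `diff`, subobjects and quotients. -/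

section Basic

variable {𝕜 : Type u} [Field 𝕜] {V : Type} [Quiver.{0} V]

theorem hom_map {M N : QuiverRep 𝕜 V} (f : M.Hom N) {x y : V} (a : x ⟶ y)
    (v : M.space x) : f.1 y (M.map a v) = N.map a (f.1 x v) :=
  LinearMap.congr_fun (f.2 x y a) v

theorem Hom.ext' {M N : QuiverRep 𝕜 V} {f g : M.Hom N} (h : ∀ x v, f.1 x v = g.1 x v) : f = g :=
  Subtype.ext (funext fun x => LinearMap.ext (h x))

/-- Construct a morphism from pointwise compatibility. -/
def Hom.mk' {M N : QuiverRep 𝕜 V} (f : ∀ x, M.space x →ₗ[𝕜] N.space x)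
    (h : ∀ (x y : V) (a : x ⟶ y) (v : M.space x), f y (M.map a v) = N.map a (f x v)) : M.Hom N :=
  ⟨f, fun x y a => LinearMap.ext (h x y a)⟩

/-- The composite `g ∘ f`. -/
def comp {M N L : QuiverRep 𝕜 V} (g : N.Hom L) (f : M.Hom N) : M.Hom L := M.postcomp g f

@[simp] theorem comp_apply {M N L : QuiverRep 𝕜 V} (g : N.Hom L) (f : M.Hom N) (x : V)
    (v : M.space x) : (comp g f).1 x v = g.1 x (f.1 x v) := rfl

/-- The identity morphism. -/
def idHom (M : QuiverRep 𝕜 V) : M.Hom M := ⟨fun _ => LinearMap.id, fun _ _ _ => rfl⟩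

theorem IsIso.refl (M : QuiverRep 𝕜 V) : M.IsIso M := ⟨M.idHom, fun _ => Function.bijective_id⟩

/-- The inverse of a bijective morphism. -/
noncomputable def invHom {M N : QuiverRep 𝕜 V} (f : M.Hom N)
    (hf : ∀ x, Function.Bijective (f.1 x)) : N.Hom M :=
  Hom.mk' (fun x => (LinearEquiv.ofBijective (f.1 x) (hf x)).symm) fun x y a v => by
    apply (hf y).1
    rw [hom_map]
    have h1 := LinearEquiv.apply_symm_apply (LinearEquiv.ofBijective (f.1 x) (hf x)) v
    have h2 := LinearEquiv.apply_symm_apply (LinearEquiv.ofBijective (f.1 y) (hf y)) (N.map a v)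
    rw [LinearEquiv.ofBijective_apply] at h1 h2
    exact h2.trans (congrArg (N.map a) h1.symm)

theorem apply_invHom {M N : QuiverRep 𝕜 V} (f : M.Hom N)
    (hf : ∀ x, Function.Bijective (f.1 x)) (x : V) (v : N.space x) :
    f.1 x ((invHom f hf).1 x v) = v :=
  LinearEquiv.apply_symm_apply (LinearEquiv.ofBijective (f.1 x) (hf x)) v

theorem invHom_apply {M N : QuiverRep 𝕜 V} (f : M.Hom N)
    (hf : ∀ x, Function.Bijective (f.1 x)) (x : V) (v : M.space x) :
    (invHom f hf).1 x (f.1 x v) = v :=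
  LinearEquiv.symm_apply_apply (LinearEquiv.ofBijective (f.1 x) (hf x)) v

theorem IsIso.symm {M N : QuiverRep 𝕜 V} (h : M.IsIso N) : N.IsIso M := by
  obtain ⟨f, hf⟩ := h
  refine ⟨invHom f hf, fun x => ⟨fun v w hvw => ?_, fun v => ⟨f.1 x v, invHom_apply f hf x v⟩⟩⟩
  rw [← apply_invHom f hf x v, hvw, apply_invHom]

/-- The map `∏ₓ Hom(Mₓ, Nₓ) → ∏ₐ Hom(M_{s(a)}, N_{t(a)})` with kernel `Hom_Q(M, N)` and
cokernel `Ext¹(M, N)`. -/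
def diff (M N : QuiverRep 𝕜 V) : (∀ x, M.space x →ₗ[𝕜] N.space x) →ₗ[𝕜]
    (∀ α : Arrows V, M.space α.1 →ₗ[𝕜] N.space α.2.1) where
  toFun f α := f α.2.1 ∘ₗ M.map α.2.2 - N.map α.2.2 ∘ₗ f α.1
  map_add' f g := by
    ext α v
    simp only [Pi.add_apply, LinearMap.sub_apply, LinearMap.add_apply, LinearMap.comp_apply,
      map_add]
    abel
  map_smul' c f := by
    ext α v
    simp [smul_sub]

theorem ker_diff (M N : QuiverRep 𝕜 V) : LinearMap.ker (diff M N) = M.Hom N := by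
  ext f
  constructor
  · intro h x y a
    exact sub_eq_zero.mp (congrFun (LinearMap.mem_ker.mp h) ⟨x, y, a⟩)
  · intro h
    exact LinearMap.mem_ker.mpr (funext fun α => sub_eq_zero.mpr (h α.1 α.2.1 α.2.2))

/-- `Ext¹(M, N) = 0`, as surjectivity of `diff M N`. -/
def ExtVanish (M N : QuiverRep 𝕜 V) : Prop := Function.Surjective (diff M N)

theorem ExtVanish.exists_sub {M N : QuiverRep 𝕜 V} (h : M.ExtVanish N)
    (g : ∀ x y : V, (x ⟶ y) → (M.space x →ₗ[𝕜] N.space y)) :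
    ∃ f : ∀ x, M.space x →ₗ[𝕜] N.space x, ∀ (x y : V) (a : x ⟶ y) (v : M.space x),
      f y (M.map a v) - N.map a (f x v) = g x y a v := by
  obtain ⟨f, hf⟩ := h fun α => g α.1 α.2.1 α.2.2
  exact ⟨f, fun x y a v => LinearMap.congr_fun (congrFun hf ⟨x, y, a⟩) v⟩

theorem extVanish_of_exists_sub {M N : QuiverRep 𝕜 V}
    (h : ∀ g : ∀ x y : V, (x ⟶ y) → (M.space x →ₗ[𝕜] N.space y),
      ∃ f : ∀ x, M.space x →ₗ[𝕜] N.space x, ∀ (x y : V) (a : x ⟶ y) (v : M.space x),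
        f y (M.map a v) - N.map a (f x v) = g x y a v) : M.ExtVanish N := by
  intro g
  obtain ⟨f, hf⟩ := h fun x y a => g ⟨x, y, a⟩
  exact ⟨f, funext fun α => LinearMap.ext fun v => hf _ _ α.2.2 v⟩

/-- The extension of `N` by `M` given by a cocycle. -/
abbrev twist (M N : QuiverRep 𝕜 V) (g : ∀ x y : V, (x ⟶ y) → (N.space x →ₗ[𝕜] M.space y)) :
    QuiverRep 𝕜 V where
  space x := M.space x × N.space x
  map {x y} a := ((M.map a).coprod (g x y a)).prod (N.map a ∘ₗ LinearMap.snd 𝕜 _ _)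

/-- The inclusion into the extension. -/
def twistInl (M N : QuiverRep 𝕜 V) (g : ∀ x y : V, (x ⟶ y) → (N.space x →ₗ[𝕜] M.space y)) :
    M.Hom (twist M N g) :=
  Hom.mk' (fun _ => LinearMap.inl 𝕜 _ _) fun x y a v => by simp

/-- The projection from the extension. -/
def twistSnd (M N : QuiverRep 𝕜 V) (g : ∀ x y : V, (x ⟶ y) → (N.space x →ₗ[𝕜] M.space y)) :
    (twist M N g).Hom N :=
  Hom.mk' (fun _ => LinearMap.snd 𝕜 _ _) fun x y a v => by simp

theorem twist_exact (M N : QuiverRep 𝕜 V)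
    (g : ∀ x y : V, (x ⟶ y) → (N.space x →ₗ[𝕜] M.space y)) :
    IsShortExact (twistInl M N g) (twistSnd M N g) := fun _ =>
  ⟨LinearMap.inl_injective, Function.Exact.inl_snd, LinearMap.snd_surjective⟩

/-- A section is the graph of a family `f`; commuting with the arrows of the twist says exactly that
`g` is the coboundary of `f`. -/
theorem exists_sub_of_twist_section {M N : QuiverRep 𝕜 V}
    {g : ∀ x y : V, (x ⟶ y) → (N.space x →ₗ[𝕜] M.space y)} (s : N.Hom (twist M N g))
    (hs : ∀ x v, (s.1 x v).2 = v) :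
    ∃ f : ∀ x, N.space x →ₗ[𝕜] M.space x, ∀ (x y : V) (a : x ⟶ y) (v : N.space x),
      f y (N.map a v) - M.map a (f x v) = g x y a v := by
  refine ⟨fun x => LinearMap.fst 𝕜 _ _ ∘ₗ s.1 x, fun x y a v => ?_⟩
  have h := congrArg Prod.fst (hom_map s a v)
  simp only [LinearMap.prod_apply, LinearMap.coprod_apply, Function.prod_apply, hs] at h
  simp [h]

/-- A short exact sequence ending with `N` splits if `Ext¹(N, M) = 0`. -/
theorem ExtVanish.exists_lift_of_exact {L M E N : QuiverRep 𝕜 V} (h : L.ExtVanish M)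
    {i : M.Hom E} {p : E.Hom N} (hip : IsShortExact i p) (f : L.Hom N) :
    ∃ g : L.Hom E, ∀ x v, p.1 x (g.1 x v) = f.1 x v := by
  have hsec : ∀ x, ∃ σ : L.space x →ₗ[𝕜] E.space x, ∀ v, p.1 x (σ v) = f.1 x v := fun x => by
    obtain ⟨s, hs⟩ := LinearMap.exists_rightInverse_of_surjective (p.1 x)
      (LinearMap.range_eq_top.mpr (hip x).2.2)
    exact ⟨s ∘ₗ f.1 x, fun v => LinearMap.congr_fun hs (f.1 x v)⟩
  choose σ hσ using hsec
  have hret : ∀ x, ∃ ρ : E.space x →ₗ[𝕜] M.space x, ∀ v, ρ (i.1 x v) = v := fun x => by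
    obtain ⟨r, hr⟩ := LinearMap.exists_leftInverse_of_injective (i.1 x)
      (LinearMap.ker_eq_bot.mpr (hip x).1)
    exact ⟨r, fun v => LinearMap.congr_fun hr v⟩
  choose ρ hρ using hret
  -- The vertexwise lift `σ` fails to commute with arrows by elements of the image of `i`. Pulled
  -- back to `M` by `ρ`, this failure is the coboundary of `k`, and `σ - i k` is a morphism.
  obtain ⟨k, hk⟩ := h.exists_sub fun x y a =>
    ρ y ∘ₗ (σ y ∘ₗ L.map a - E.map a ∘ₗ σ x)
  have key : ∀ (x y : V) (a : x ⟶ y) (v : L.space x),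
      i.1 y (k y (L.map a v)) - E.map a (i.1 x (k x v)) = σ y (L.map a v) - E.map a (σ x v) := by
    intro x y a v
    rw [← hom_map i, ← map_sub, hk]
    have hker : p.1 y (σ y (L.map a v) - E.map a (σ x v)) = 0 := by
      rw [map_sub, hσ, hom_map p, hσ, hom_map f, sub_self]
    obtain ⟨w, hw⟩ := ((hip y).2.1 _).mp hker
    simp only [LinearMap.comp_apply, LinearMap.sub_apply]
    rw [← hw, hρ]
  refine ⟨Hom.mk' (fun x => σ x - i.1 x ∘ₗ k x) fun x y a v => ?_, fun x v => ?_⟩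
  · have := key x y a v
    simp only [LinearMap.comp_apply, LinearMap.sub_apply, map_sub]
    rw [sub_eq_sub_iff_sub_eq_sub]
    exact this.symm
  · change p.1 x (σ x v - i.1 x (k x v)) = f.1 x v
    rw [map_sub, hσ, (hip x).2.1.apply_apply_eq_zero, sub_zero]

/-- Morphisms to `L` extend along a monomorphism with cokernel `N` if `Ext¹(N, L) = 0`. -/
theorem ExtVanish.exists_extend_of_exact {L M E N : QuiverRep 𝕜 V} (h : N.ExtVanish L)
    {i : M.Hom E} {p : E.Hom N} (hip : IsShortExact i p) (f : M.Hom L) :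
    ∃ g : E.Hom L, ∀ x v, g.1 x (i.1 x v) = f.1 x v := by
  have hsec : ∀ x, ∃ σ : N.space x →ₗ[𝕜] E.space x, ∀ v, p.1 x (σ v) = v := fun x => by
    obtain ⟨s, hs⟩ := LinearMap.exists_rightInverse_of_surjective (p.1 x)
      (LinearMap.range_eq_top.mpr (hip x).2.2)
    exact ⟨s, fun v => LinearMap.congr_fun hs v⟩
  choose σ hσ using hsec
  have hret : ∀ x, ∃ ρ : E.space x →ₗ[𝕜] L.space x, ∀ v, ρ (i.1 x v) = f.1 x v := fun x => by
    obtain ⟨r, hr⟩ := LinearMap.exists_leftInverse_of_injective (i.1 x)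
      (LinearMap.ker_eq_bot.mpr (hip x).1)
    exact ⟨f.1 x ∘ₗ r, fun v => congrArg (f.1 x) (LinearMap.congr_fun hr v)⟩
  choose ρ hρ using hret
  -- Dually, the failure of `ρ` to commute with arrows vanishes on `M` because `f` is a morphism. It
  -- therefore descends to `N`, and `ρ - k p` is a morphism.
  obtain ⟨k, hk⟩ := h.exists_sub fun x y a =>
    (ρ y ∘ₗ E.map a - L.map a ∘ₗ ρ x) ∘ₗ σ x
  have key : ∀ (x y : V) (a : x ⟶ y) (v : E.space x),
      k y (p.1 y (E.map a v)) - L.map a (k x (p.1 x v)) = ρ y (E.map a v) - L.map a (ρ x v) := by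
    intro x y a v
    rw [hom_map p, hk]
    have hker : p.1 x (σ x (p.1 x v) - v) = 0 := by rw [map_sub, hσ, sub_self]
    obtain ⟨w, hw⟩ := ((hip x).2.1 _).mp hker
    simp only [LinearMap.comp_apply, LinearMap.sub_apply]
    rw [show σ x (p.1 x v) = i.1 x w + v by rw [hw]; abel]
    simp only [map_add]
    rw [← hom_map i, hρ, hρ, hom_map f]
    abel
  refine ⟨Hom.mk' (fun x => ρ x - k x ∘ₗ p.1 x) fun x y a v => ?_, fun x v => ?_⟩
  · have := key x y a v
    simp only [LinearMap.comp_apply, LinearMap.sub_apply, map_sub]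
    rw [sub_eq_sub_iff_sub_eq_sub]
    exact this.symm
  · change ρ x (i.1 x v) - k x (p.1 x (i.1 x v)) = f.1 x v
    rw [hρ, (hip x).2.1.apply_apply_eq_zero, map_zero, sub_zero]

theorem extOneVanishes_iff {M N : QuiverRep 𝕜 V} : ExtOneVanishes N M ↔ N.ExtVanish M := by
  constructor
  · intro h
    refine extVanish_of_exists_sub fun g => ?_
    obtain ⟨s, hs⟩ := h _ _ _ (twist_exact M N g)
    exact exists_sub_of_twist_section s fun x v => LinearMap.congr_fun (hs x) v
  · intro h E i p hip
    obtain ⟨g, hg⟩ := h.exists_lift_of_exact hip N.idHom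
    exact ⟨g, fun x => LinearMap.ext (hg x)⟩

/-- The subrepresentation on a compatible family of subspaces. -/
abbrev sub (M : QuiverRep 𝕜 V) (p : ∀ x, Submodule 𝕜 (M.space x))
    (hp : ∀ (x y : V) (a : x ⟶ y), ∀ v ∈ p x, M.map a v ∈ p y) : QuiverRep 𝕜 V where
  space x := p x
  map {x y} a := (M.map a).restrict (hp x y a)

/-- The inclusion of a subrepresentation. -/
def subIncl (M : QuiverRep 𝕜 V) (p : ∀ x, Submodule 𝕜 (M.space x))
    (hp : ∀ (x y : V) (a : x ⟶ y), ∀ v ∈ p x, M.map a v ∈ p y) : (M.sub p hp).Hom M :=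
  Hom.mk' (fun x => (p x).subtype) fun _ _ _ _ => rfl

/-- The quotient by a compatible family of subspaces. -/
abbrev quot (M : QuiverRep 𝕜 V) (p : ∀ x, Submodule 𝕜 (M.space x))
    (hp : ∀ (x y : V) (a : x ⟶ y), ∀ v ∈ p x, M.map a v ∈ p y) : QuiverRep 𝕜 V where
  space x := M.space x ⧸ p x
  map {x y} a := (p x).mapQ (p y) (M.map a) (hp x y a)

/-- The projection to a quotient. -/
def quotProj (M : QuiverRep 𝕜 V) (p : ∀ x, Submodule 𝕜 (M.space x))
    (hp : ∀ (x y : V) (a : x ⟶ y), ∀ v ∈ p x, M.map a v ∈ p y) : M.Hom (M.quot p hp) :=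
  Hom.mk' (fun x => (p x).mkQ) fun _ _ _ _ => rfl

theorem ker_compat {M N : QuiverRep 𝕜 V} (f : M.Hom N) (x y : V) (a : x ⟶ y) :
    ∀ v ∈ LinearMap.ker (f.1 x), M.map a v ∈ LinearMap.ker (f.1 y) := fun v hv => by
  rw [LinearMap.mem_ker] at hv ⊢
  rw [hom_map f, hv, map_zero]

theorem range_compat {M N : QuiverRep 𝕜 V} (f : M.Hom N) (x y : V) (a : x ⟶ y) :
    ∀ v ∈ LinearMap.range (f.1 x), N.map a v ∈ LinearMap.range (f.1 y) := by
  rintro _ ⟨v, rfl⟩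
  exact ⟨M.map a v, hom_map f a v⟩

/-- The kernel of a morphism. -/
abbrev kernel {M N : QuiverRep 𝕜 V} (f : M.Hom N) : QuiverRep 𝕜 V :=
  M.sub (fun x => LinearMap.ker (f.1 x)) (ker_compat f)

/-- The inclusion of the kernel. -/
abbrev kernelIncl {M N : QuiverRep 𝕜 V} (f : M.Hom N) : (kernel f).Hom M := M.subIncl _ _

/-- The image of a morphism. -/
abbrev image {M N : QuiverRep 𝕜 V} (f : M.Hom N) : QuiverRep 𝕜 V :=
  N.sub (fun x => LinearMap.range (f.1 x)) (range_compat f)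

/-- The inclusion of the image. -/
abbrev imageIncl {M N : QuiverRep 𝕜 V} (f : M.Hom N) : (image f).Hom N := N.subIncl _ _

/-- The cokernel of a morphism. -/
abbrev cokernel {M N : QuiverRep 𝕜 V} (f : M.Hom N) : QuiverRep 𝕜 V :=
  N.quot (fun x => LinearMap.range (f.1 x)) (range_compat f)

/-- The projection to the cokernel. -/
abbrev cokernelProj {M N : QuiverRep 𝕜 V} (f : M.Hom N) : N.Hom (cokernel f) := N.quotProj _ _

/-- The projection to the image. -/
def toImage {M N : QuiverRep 𝕜 V} (f : M.Hom N) : M.Hom (image f) :=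
  Hom.mk' (fun x => (f.1 x).rangeRestrict) fun _ _ a v => Subtype.ext (hom_map f a v)

theorem toImage_surjective {M N : QuiverRep 𝕜 V} (f : M.Hom N) (x : V) :
    Function.Surjective ((toImage f).1 x) := (f.1 x).surjective_rangeRestrict

theorem kernel_exact {M N : QuiverRep 𝕜 V} (f : M.Hom N)
    (hf : ∀ x, Function.Surjective (f.1 x)) : IsShortExact (kernelIncl f) f := fun x =>
  ⟨Subtype.val_injective, LinearMap.exact_iff.mpr (by simp [subIncl, Hom.mk']), hf x⟩

theorem cokernel_exact {M N : QuiverRep 𝕜 V} (f : M.Hom N)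
    (hf : ∀ x, Function.Injective (f.1 x)) : IsShortExact f (cokernelProj f) := fun x =>
  ⟨hf x, LinearMap.exact_iff.mpr (by simp [quotProj, Hom.mk']), Submodule.mkQ_surjective _⟩

/-- `Ext¹(-, Y)` is right exact: it vanishes on subobjects if it vanishes. -/
theorem ExtVanish.of_injective {M N Y : QuiverRep 𝕜 V} (h : N.ExtVanish Y) (i : M.Hom N)
    (hi : ∀ x, Function.Injective (i.1 x)) : M.ExtVanish Y := by
  refine extVanish_of_exists_sub fun g => ?_
  have hret : ∀ x, ∃ ρ : N.space x →ₗ[𝕜] M.space x, ∀ v, ρ (i.1 x v) = v := fun x => by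
    obtain ⟨r, hr⟩ := LinearMap.exists_leftInverse_of_injective (i.1 x)
      (LinearMap.ker_eq_bot.mpr (hi x))
    exact ⟨r, fun v => LinearMap.congr_fun hr v⟩
  choose ρ hρ using hret
  -- Every family indexed by the arrows is a cocycle, so `ρ` need not commute with arrows. This is
  -- where the category being hereditary enters.
  obtain ⟨f, hf⟩ := h.exists_sub fun x y a => g x y a ∘ₗ ρ x
  refine ⟨fun x => f x ∘ₗ i.1 x, fun x y a v => ?_⟩
  simpa [hom_map i, hρ] using hf x y a (i.1 x v)

/-- `Ext¹(X, -)` is right exact: it vanishes on quotients if it vanishes. -/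
theorem ExtVanish.of_surjective {X M N : QuiverRep 𝕜 V} (h : X.ExtVanish M) (p : M.Hom N)
    (hp : ∀ x, Function.Surjective (p.1 x)) : X.ExtVanish N := by
  refine extVanish_of_exists_sub fun g => ?_
  have hsec : ∀ x, ∃ σ : N.space x →ₗ[𝕜] M.space x, ∀ v, p.1 x (σ v) = v := fun x => by
    obtain ⟨s, hs⟩ := LinearMap.exists_rightInverse_of_surjective (p.1 x)
      (LinearMap.range_eq_top.mpr (hp x))
    exact ⟨s, fun v => LinearMap.congr_fun hs v⟩
  choose σ hσ using hsec
  obtain ⟨f, hf⟩ := h.exists_sub fun x y a => σ y ∘ₗ g x y a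
  refine ⟨fun x => p.1 x ∘ₗ f x, fun x y a v => ?_⟩
  have := congrArg (p.1 y) (hf x y a v)
  simpa [hom_map p, hσ] using this

/-- The obstruction to lifting along an epimorphism `p` lies in Ext¹(P, ker p). -/
theorem isProjective_of_extVanish {P : QuiverRep 𝕜 V} (hP : P.IsFinDim)
    (h : ∀ Y : QuiverRep 𝕜 V, Y.IsFinDim → P.ExtVanish Y) : P.IsProjective := by
  refine ⟨hP, fun E N hE hN p hp f => ?_⟩
  obtain ⟨g, hg⟩ := (h (kernel p) fun x => haveI := hE x; inferInstance).exists_lift_of_exact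
    (kernel_exact p hp) f
  exact ⟨g, Hom.ext' hg⟩

theorem IsProjective.extVanish {P Y : QuiverRep 𝕜 V} (hP : P.IsProjective) (hY : Y.IsFinDim) :
    P.ExtVanish Y := by
  refine extVanish_of_exists_sub fun g => ?_
  obtain ⟨s, hs⟩ := hP.2 (twist Y P g) P
    (fun x => haveI := hY x; haveI := hP.1 x; inferInstance) hP.1 (twistSnd Y P g)
    (fun x => (twist_exact Y P g x).2.2) P.idHom
  exact exists_sub_of_twist_section s fun x v =>
    LinearMap.congr_fun (congrFun (congrArg Subtype.val hs) x) v

theorem isInjective_of_extVanish {I : QuiverRep 𝕜 V} (hI : I.IsFinDim)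
    (h : ∀ X : QuiverRep 𝕜 V, X.IsFinDim → X.ExtVanish I) : I.IsInjective := by
  refine ⟨hI, fun N E hN hE i hi f => ?_⟩
  obtain ⟨g, hg⟩ := (h (cokernel i) fun x => haveI := hE x; inferInstance).exists_extend_of_exact
    (cokernel_exact i hi) f
  exact ⟨g, Hom.ext' hg⟩

theorem IsInjective.extVanish {I X : QuiverRep 𝕜 V} (hI : I.IsInjective) (hX : X.IsFinDim) :
    X.ExtVanish I := by
  refine extVanish_of_exists_sub fun g => ?_
  obtain ⟨r, hr⟩ := hI.2 I (twist I X g) hI.1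
    (fun x => haveI := hX x; haveI := hI.1 x; inferInstance) (twistInl I X g)
    (fun x => (twist_exact I X g x).1) I.idHom
  have hr' : ∀ x v, r.1 x (v, 0) = v := fun x v =>
    LinearMap.congr_fun (congrFun (congrArg Subtype.val hr) x) v
  -- On the second summand the retraction solves the coboundary equation for -g, hence the sign.
  refine ⟨fun x => -(r.1 x ∘ₗ LinearMap.inr 𝕜 _ _), fun x y a v => ?_⟩
  have h := hom_map r a (0, v)
  simp only [LinearMap.prod_apply, LinearMap.coprod_apply, Function.prod_apply, map_zero,
    zero_add, LinearMap.comp_apply, LinearMap.snd_apply] at h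
  rw [show (g x y a v, X.map a v) = (g x y a v, 0) + (0, X.map a v) by simp, map_add, hr'] at h
  simp only [LinearMap.neg_apply, LinearMap.comp_apply, LinearMap.inr_apply, map_neg, ← h]
  abel

end Basic

end QuiverRep

namespace QuiverRep

/-! ### Indecomposables: Fitting's lemma, and scalar endomorphisms in the rigid case. -/

section Indecomposable

variable {𝕜 : Type u} [Field 𝕜] {V : Type} [Quiver.{0} V]

theorem IsFinDim.sub {M : QuiverRep 𝕜 V} (hM : M.IsFinDim) (p : ∀ x, Submodule 𝕜 (M.space x))
    (hp : ∀ (x y : V) (a : x ⟶ y), ∀ v ∈ p x, M.map a v ∈ p y) : (M.sub p hp).IsFinDim :=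
  fun x => haveI := hM x; inferInstance

theorem IsFinDim.of_injective {M N : QuiverRep 𝕜 V} (hN : N.IsFinDim) (i : M.Hom N)
    (hi : ∀ x, Function.Injective (i.1 x)) : M.IsFinDim :=
  fun x => haveI := hN x; FiniteDimensional.of_injective (i.1 x) (hi x)

theorem IsFinDim.of_surjective {M N : QuiverRep 𝕜 V} (hM : M.IsFinDim) (p : M.Hom N)
    (hp : ∀ x, Function.Surjective (p.1 x)) : N.IsFinDim :=
  fun x => haveI := hM x; Module.Finite.of_surjective (p.1 x) (hp x)

theorem exists_ne_zero_of_not_isZero {M : QuiverRep 𝕜 V} (hM : ¬ M.IsZero) :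
    ∃ (x : V) (v : M.space x), v ≠ 0 := by
  by_contra! h
  exact hM fun x => ⟨fun v w => by rw [h x v, h x w]⟩

/-- A nonzero representation with only scalar endomorphisms is indecomposable. -/
theorem isIndecomposable_of_scalar {M : QuiverRep 𝕜 V} (hM : ¬ M.IsZero)
    (h : ∀ f : M.Hom M, ∃ c : 𝕜, f = c • M.idHom) : M.IsIndecomposable := by
  refine ⟨hM, fun A B ⟨f, hf⟩ => ?_⟩
  by_contra! hAB
  obtain ⟨x, v, hv⟩ := exists_ne_zero_of_not_isZero hAB.1
  obtain ⟨y, w, hw⟩ := exists_ne_zero_of_not_isZero hAB.2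
  -- Transported to `M`, the projection onto `A` is a scalar, which would have to be 1 on `A` and 0
  -- on `B`.
  let π : (A.directSum B).Hom (A.directSum B) :=
    Hom.mk' (fun x => LinearMap.inl 𝕜 _ _ ∘ₗ LinearMap.fst 𝕜 (A.space x) (B.space x))
      fun x y a v => by simp
  obtain ⟨c, hc⟩ := h (comp (invHom f hf) (comp π f))
  have key : ∀ (z : V) (u : A.space z × B.space z), π.1 z u = c • u := by
    intro z u
    obtain ⟨m, rfl⟩ := (hf z).2 u
    have := congrArg (fun g : M.Hom M => f.1 z (g.1 z m)) hc
    change f.1 z ((invHom f hf).1 z (π.1 z (f.1 z m))) = f.1 z (c • m) at this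
    rwa [apply_invHom, map_smul] at this
  have h1 : v = c • v := congrArg Prod.fst (key x (v, 0))
  have h2 : (0 : B.space y) = c • w := congrArg Prod.snd (key y (0, w))
  have hc0 : c = 0 := (smul_eq_zero.mp h2.symm).resolve_right hw
  rw [hc0, zero_smul] at h1
  exact hv h1

/-- Complementary subrepresentations of an indecomposable representation are trivial. -/
theorem IsIndecomposable.eq_bot_or_eq_bot {M : QuiverRep 𝕜 V} (hM : M.IsIndecomposable)
    {p q : ∀ x, Submodule 𝕜 (M.space x)}
    (hp : ∀ (x y : V) (a : x ⟶ y), ∀ v ∈ p x, M.map a v ∈ p y)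
    (hq : ∀ (x y : V) (a : x ⟶ y), ∀ v ∈ q x, M.map a v ∈ q y)
    (h : ∀ x, IsCompl (p x) (q x)) : (∀ x, p x = ⊥) ∨ (∀ x, q x = ⊥) := by
  have hiso : ((M.sub p hp).directSum (M.sub q hq)).IsIso M := by
    refine ⟨Hom.mk' (fun x => ((p x).prodEquivOfIsCompl (q x) (h x)).toLinearMap)
      fun x y a v => ?_, fun x => ((p x).prodEquivOfIsCompl (q x) (h x)).bijective⟩
    simp
  refine (hM.2 _ _ hiso.symm).imp (fun h x => ?_) (fun h x => ?_)
  · exact (Submodule.subsingleton_iff_eq_bot).mp (h x)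
  · exact (Submodule.subsingleton_iff_eq_bot).mp (h x)

theorem isCompl_range_ker {E F : Type*} [AddCommGroup E] [Module 𝕜 E] [AddCommGroup F]
    [Module 𝕜 F] {i : E →ₗ[𝕜] F} {r : F →ₗ[𝕜] E} (h : ∀ v, r (i v) = v) :
    IsCompl (LinearMap.range i) (LinearMap.ker r) :=
  LinearMap.isCompl_of_proj (f := i.rangeRestrict ∘ₗ r) (by
    rintro ⟨_, v, rfl⟩
    exact Subtype.ext (congrArg i (h v))) |> fun hc => by
      have : LinearMap.ker (i.rangeRestrict ∘ₗ r) = LinearMap.ker r := by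
        ext v
        simp only [LinearMap.mem_ker, LinearMap.comp_apply]
        constructor
        · intro hv
          have hv' : i (r v) = 0 := congrArg Subtype.val hv
          rw [← h (r v), hv', map_zero]
        · intro hv
          rw [hv, map_zero]
      rwa [this] at hc

/-- A nonzero retract of an indecomposable representation is everything. -/
theorem IsIndecomposable.bijective_of_retract {M N : QuiverRep 𝕜 V} (hM : M.IsIndecomposable)
    (hN : ¬ N.IsZero) {i : N.Hom M} {r : M.Hom N} (h : ∀ x v, r.1 x (i.1 x v) = v) (x : V) :
    Function.Bijective (i.1 x) ∧ Function.Bijective (r.1 x) := by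
  rcases hM.eq_bot_or_eq_bot (range_compat i) (ker_compat r)
    (fun x => isCompl_range_ker (h x)) with h0 | h0
  · obtain ⟨y, v, hv⟩ := exists_ne_zero_of_not_isZero hN
    have : i.1 y v = 0 := by
      rw [← Submodule.mem_bot 𝕜, ← h0 y]
      exact ⟨v, rfl⟩
    exact absurd (by rw [← h y v, this, map_zero]) hv
  · have hr : Function.Injective (r.1 x) := LinearMap.ker_eq_bot.mp (h0 x)
    refine ⟨⟨fun v w hvw => by rw [← h x v, hvw, h], fun v => ⟨r.1 x v, hr (h x _)⟩⟩, hr,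
      fun v => ⟨_, h x v⟩⟩

/-- Powers of an endomorphism. -/
def powHom {M : QuiverRep 𝕜 V} (f : M.Hom M) : ℕ → M.Hom M
  | 0 => M.idHom
  | n + 1 => comp f (powHom f n)

theorem powHom_val {M : QuiverRep 𝕜 V} (f : M.Hom M) (n : ℕ) (x : V) :
    (powHom f n).1 x = (show Module.End 𝕜 (M.space x) from f.1 x) ^ n := by
  induction n with
  | zero => rfl
  | succ n ih =>
    rw [pow_succ', ← ih]
    rfl

variable [Finite V]

/-- Fitting's lemma. -/
theorem IsIndecomposable.bijective_or_nilpotent {M : QuiverRep 𝕜 V} (hM : M.IsIndecomposable)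
    (hfd : M.IsFinDim) (f : M.Hom M) :
    (∀ x, Function.Bijective (f.1 x)) ∨
      ∀ x, IsNilpotent (show Module.End 𝕜 (M.space x) from f.1 x) := by
  have (x : V) : FiniteDimensional 𝕜 (M.space x) := hfd x
  have hev : ∀ᶠ n : ℕ in Filter.atTop, ∀ x,
      IsCompl (LinearMap.ker ((show Module.End 𝕜 (M.space x) from f.1 x) ^ n))
        (LinearMap.range ((show Module.End 𝕜 (M.space x) from f.1 x) ^ n)) :=
    Filter.eventually_all.mpr fun x => LinearMap.eventually_isCompl_ker_pow_range_pow _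
  -- One exponent serves the finitely many vertices; n ≥ 1 lets injectivity of the n-th power pass
  -- to `f`.
  obtain ⟨n, hn, hn1⟩ := (hev.and (Filter.eventually_ge_atTop 1)).exists
  simp only [← powHom_val] at hn
  rcases hM.eq_bot_or_eq_bot (ker_compat (powHom f n)) (range_compat (powHom f n)) hn with h | h
  · left
    intro x
    have hinj : Function.Injective (f.1 x) := by
      have h1 : Function.Injective ((powHom f n).1 x) := LinearMap.ker_eq_bot.mp (h x)
      obtain ⟨m, rfl⟩ := Nat.exists_eq_add_of_le' hn1
      rw [powHom_val, pow_succ] at h1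
      exact Function.Injective.of_comp (f := _) h1
    exact ⟨hinj, LinearMap.injective_iff_surjective.mp hinj⟩
  · right
    intro x
    refine ⟨n, ?_⟩
    rw [← powHom_val]
    exact LinearMap.range_eq_bot.mp (h x)

/-- Nonzero endomorphisms of a rigid indecomposable representation are invertible. -/
theorem IsIndecomposable.bijective_of_ne_zero [CharZero 𝕜] {M : QuiverRep 𝕜 V}
    (hM : M.IsIndecomposable) (hfd : M.IsFinDim) (hrig : M.ExtVanish M) {f : M.Hom M}
    (hf : f ≠ 0) (x : V) : Function.Bijective (f.1 x) := by
  have (x : V) : FiniteDimensional 𝕜 (M.space x) := hfd x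
  by_contra hx
  have hsec : ∀ x, ∃ σ : LinearMap.range (f.1 x) →ₗ[𝕜] M.space x,
      ∀ v, (toImage f).1 x (σ v) = v := fun x => by
    obtain ⟨s, hs⟩ := LinearMap.exists_rightInverse_of_surjective ((toImage f).1 x)
      (LinearMap.range_eq_top.mpr (toImage_surjective f x))
    exact ⟨s, fun v => LinearMap.congr_fun hs v⟩
  choose σ hσ using hsec
  have hret : ∀ x, ∃ ρ : M.space x →ₗ[𝕜] LinearMap.range (f.1 x), 
      ∀ v : LinearMap.range (f.1 x), ρ (v : M.space x) = v :=
    fun x => by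
      obtain ⟨r, hr⟩ := LinearMap.exists_leftInverse_of_injective (LinearMap.range (f.1 x)).subtype
        (LinearMap.range (f.1 x)).ker_subtype
      exact ⟨r, fun v => LinearMap.congr_fun hr v⟩
  choose ρ hρ using hret
  -- The obstruction to splitting M → im f, extended from im f to M by `ρ`, is a coboundary by
  -- rigidity. Hence `σ - h` is a morphism on im f. The obstruction dies in im f, so `h` followed by
  -- M → im f is a morphism as well.
  obtain ⟨h, hh⟩ := hrig.exists_sub fun x y a =>
    (σ y ∘ₗ (image f).map a - M.map a ∘ₗ σ x) ∘ₗ ρ x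
  have hker : ∀ (x y : V) (a : x ⟶ y) (v : M.space x),
      (toImage f).1 y (h y (M.map a v) - M.map a (h x v)) = 0 := by
    intro x y a v
    rw [hh]
    simp only [LinearMap.comp_apply, LinearMap.sub_apply]
    rw [map_sub, hσ, hom_map (toImage f), hσ, sub_self]
  let s : (image f).Hom M := Hom.mk' (fun x => σ x - h x ∘ₗ (LinearMap.range (f.1 x)).subtype)
    fun x y a v => by
      have := hh x y a (v : M.space x)
      simp only [LinearMap.comp_apply, LinearMap.sub_apply] at this
      rw [hρ x v] at this
      simp only [LinearMap.comp_apply, LinearMap.sub_apply, map_sub]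
      rw [sub_eq_sub_iff_sub_eq_sub]
      exact this.symm
  let r : M.Hom (image f) := Hom.mk' (fun x => (toImage f).1 x ∘ₗ h x) fun x y a v => by
    have := hker x y a v
    rw [map_sub, sub_eq_zero, hom_map (toImage f)] at this
    exact this
  -- The identity of im f is a sum of two endomorphisms that factor through M. In the opposite order
  -- they give endomorphisms of M, which are nilpotent by Fitting because an isomorphism would make
  -- `f` bijective at `x`.
  have hid : ∀ x (v : LinearMap.range (f.1 x)),
      (toImage f).1 x (s.1 x v) + r.1 x (v : M.space x) = v := by
    intro x v
    change (toImage f).1 x (σ x v - h x (v : M.space x)) + (toImage f).1 x (h x v) = v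
    rw [map_sub, hσ, sub_add_cancel]
  have hnil1 := (hM.bijective_or_nilpotent hfd (comp s (toImage f))).resolve_left fun hb => by
    have h1 : Function.Injective (f.1 x) := fun v w hvw =>
      (hb x).1 (congrArg (s.1 x) (Subtype.ext hvw : (toImage f).1 x v = (toImage f).1 x w))
    exact hx ⟨h1, LinearMap.injective_iff_surjective.mp h1⟩
  have hnil2 := (hM.bijective_or_nilpotent hfd (comp (imageIncl f) r)).resolve_left fun hb => by
    have h1 : Function.Surjective (f.1 x) := fun v => by
      obtain ⟨w, hw⟩ := (hb x).2 v
      obtain ⟨z, hz⟩ := (r.1 x w).2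
      exact ⟨z, hz.trans hw⟩
    exact hx ⟨LinearMap.injective_iff_surjective.mpr h1, h1⟩
  refine hf (Hom.ext' fun y v => ?_)
  -- Since tr(AB) = tr(BA), the trace of the identity of im f is a sum of traces of nilpotent maps.
  -- In characteristic zero this kills the dimension of im f.
  have ht : ((Module.finrank 𝕜 (LinearMap.range (f.1 y)) : ℕ) : 𝕜) = 0 := by
    rw [← LinearMap.trace_id 𝕜 (LinearMap.range (f.1 y)),
      show (LinearMap.id : LinearMap.range (f.1 y) →ₗ[𝕜] _) =
        (toImage f).1 y ∘ₗ s.1 y + r.1 y ∘ₗ (imageIncl f).1 y from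
        LinearMap.ext fun v => (hid y v).symm, map_add, LinearMap.trace_comp_comm',
      LinearMap.trace_comp_comm' ((imageIncl f).1 y)]
    have e1 := (LinearMap.isNilpotent_trace_of_isNilpotent (hnil1 y)).eq_zero
    have e2 := (LinearMap.isNilpotent_trace_of_isNilpotent (hnil2 y)).eq_zero
    exact (congrArg₂ (· + ·) e1 e2).trans (add_zero 0)
  have h0 : LinearMap.range (f.1 y) = ⊥ :=
    Submodule.finrank_eq_zero.mp (Nat.cast_eq_zero.mp ht)
  have : f.1 y v ∈ LinearMap.range (f.1 y) := ⟨v, rfl⟩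
  rw [h0] at this
  exact this

/-- A rigid indecomposable representation has only scalar endomorphisms. -/
theorem IsIndecomposable.exists_eq_smul_id [IsAlgClosed 𝕜] [CharZero 𝕜] {M : QuiverRep 𝕜 V}
    (hM : M.IsIndecomposable) (hfd : M.IsFinDim) (hrig : M.ExtVanish M) (f : M.Hom M) :
    ∃ c : 𝕜, f = c • M.idHom := by
  have (x : V) : FiniteDimensional 𝕜 (M.space x) := hfd x
  obtain ⟨x, v, hv⟩ := exists_ne_zero_of_not_isZero hM.1
  have : Nontrivial (M.space x) := ⟨v, 0, hv⟩
  -- An eigenvalue at a single vertex suffices: `f - c` is not injective there, hence zero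
  -- everywhere.
  obtain ⟨c, hc⟩ := Module.End.exists_eigenvalue (show Module.End 𝕜 (M.space x) from f.1 x)
  obtain ⟨w, hw⟩ := hc.exists_hasEigenvector
  refine ⟨c, ?_⟩
  by_contra hne
  have hb := hM.bijective_of_ne_zero hfd hrig (f := f - c • M.idHom) (sub_ne_zero.mpr hne) x
  refine hw.2 (hb.1 ?_)
  rw [map_zero]
  exact sub_eq_zero.mpr hw.apply_eq_smul

end Indecomposable

/-! ### The Euler form and dimensions of Hom and Ext¹. -/

section Euler

variable {𝕜 : Type u} [Field 𝕜] {V : Type} [Quiver.{0} V]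

/-- `dim Hom_Q(M, N)`. -/
noncomputable def homDim (M N : QuiverRep 𝕜 V) : ℕ := Module.finrank 𝕜 (M.Hom N)

/-- The dimension vector. -/
noncomputable def dimVec (M : QuiverRep 𝕜 V) (x : V) : ℤ := Module.finrank 𝕜 (M.space x)

theorem dimVec_nonneg (M : QuiverRep 𝕜 V) (x : V) : 0 ≤ M.dimVec x := Int.natCast_nonneg _

theorem dimVec_eq_zero_iff {M : QuiverRep 𝕜 V} (hM : M.IsFinDim) (x : V) :
    M.dimVec x = 0 ↔ Subsingleton (M.space x) := by
  have := hM x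
  rw [dimVec, Nat.cast_eq_zero]
  exact Module.finrank_zero_iff

theorem IsIso.dimVec_eq {M N : QuiverRep 𝕜 V} (h : M.IsIso N) : M.dimVec = N.dimVec := by
  obtain ⟨f, hf⟩ := h
  exact funext fun x => congrArg _ (LinearEquiv.ofBijective (f.1 x) (hf x)).finrank_eq

theorem IsShortExact.dimVec_eq {M E N : QuiverRep 𝕜 V} {i : M.Hom E} {p : E.Hom N}
    (h : IsShortExact i p) (hE : E.IsFinDim) (x : V) :
    E.dimVec x = M.dimVec x + N.dimVec x := by
  have := hE x
  have h1 := (p.1 x).finrank_range_add_finrank_ker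
  rw [LinearMap.exact_iff.mp (h x).2.1, LinearMap.range_eq_top.mpr (h x).2.2, finrank_top,
    LinearMap.finrank_range_of_inj (h x).1] at h1
  rw [dimVec, dimVec, dimVec, ← h1]
  push_cast
  ring

theorem not_isZero_of_homDim_ne_zero {M N : QuiverRep 𝕜 V} (h : homDim M N ≠ 0) :
    ∃ f : M.Hom N, f ≠ 0 := by
  by_contra! h'
  have : Subsingleton (M.Hom N) := ⟨fun f g => by rw [h' f, h' g]⟩
  exact h Module.finrank_zero_of_subsingleton

theorem finiteDimensional_hom [Finite V] {M N : QuiverRep 𝕜 V} (hM : M.IsFinDim)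
    (hN : N.IsFinDim) : FiniteDimensional 𝕜 (M.Hom N) := by
  have (x : V) : FiniteDimensional 𝕜 (M.space x) := hM x
  have (x : V) : FiniteDimensional 𝕜 (N.space x) := hN x
  infer_instance

theorem homDim_pos [Finite V] {M N : QuiverRep 𝕜 V} (hM : M.IsFinDim)
    (hN : N.IsFinDim) {f : M.Hom N} (hf : f ≠ 0) : 0 < homDim M N := by
  have := finiteDimensional_hom hM hN
  have : Nontrivial (M.Hom N) := ⟨f, 0, hf⟩
  exact Module.finrank_pos

theorem idHom_ne_zero {M : QuiverRep 𝕜 V} (hM : ¬ M.IsZero) : M.idHom ≠ 0 := by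
  intro h
  obtain ⟨x, v, hv⟩ := exists_ne_zero_of_not_isZero hM
  exact hv (LinearMap.congr_fun (congrFun (congrArg Subtype.val h) x) v)

theorem homDim_self_eq_one_iff [Finite V] {M : QuiverRep 𝕜 V} (hM : ¬ M.IsZero) :
    homDim M M = 1 ↔ ∀ f : M.Hom M, ∃ c : 𝕜, f = c • M.idHom := by
  rw [homDim, finrank_eq_one_iff_of_nonzero' M.idHom (idHom_ne_zero hM)]
  exact forall_congr' fun f => exists_congr fun c => eq_comm

variable [Fintype V] [Fintype (Arrows V)]

/-- The Euler form of the quiver. -/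
def eulerForm (d e : V → ℤ) : ℤ := ∑ x, d x * e x - ∑ α : Arrows V, d α.1 * e α.2.1

theorem eulerForm_add_left (d d' e : V → ℤ) :
    eulerForm (d + d') e = eulerForm d e + eulerForm d' e := by
  simp only [eulerForm, Pi.add_apply, add_mul, Finset.sum_add_distrib]
  ring

theorem eulerForm_add_right (d e e' : V → ℤ) :
    eulerForm d (e + e') = eulerForm d e + eulerForm d e' := by
  simp only [eulerForm, Pi.add_apply, mul_add, Finset.sum_add_distrib]
  ring

theorem eulerForm_smul_left (c : ℤ) (d e : V → ℤ) :
    eulerForm (c • d) e = c * eulerForm d e := by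
  simp only [eulerForm, Pi.smul_apply, smul_eq_mul, mul_assoc, ← Finset.mul_sum, mul_sub]

theorem eulerForm_smul_right (c : ℤ) (d e : V → ℤ) :
    eulerForm d (c • e) = c * eulerForm d e := by
  simp only [eulerForm, Pi.smul_apply, smul_eq_mul, mul_left_comm _ c, ← Finset.mul_sum, mul_sub]

theorem eulerForm_sub_left (d d' e : V → ℤ) :
    eulerForm (d - d') e = eulerForm d e - eulerForm d' e := by
  rw [sub_eq_add_neg, ← neg_one_smul ℤ d', eulerForm_add_left, eulerForm_smul_left]
  ring

theorem eulerForm_sub_right (d e e' : V → ℤ) :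
    eulerForm d (e - e') = eulerForm d e - eulerForm d e' := by
  rw [sub_eq_add_neg, ← neg_one_smul ℤ e', eulerForm_add_right, eulerForm_smul_right]
  ring

/-- `dim Hom - dim Ext¹` is the Euler form. -/
theorem homDim_eq_eulerForm_add {M N : QuiverRep 𝕜 V} (hM : M.IsFinDim) (hN : N.IsFinDim) :
    (homDim M N : ℤ) = eulerForm M.dimVec N.dimVec +
      Module.finrank 𝕜 ((∀ α : Arrows V, M.space α.1 →ₗ[𝕜] N.space α.2.1) ⧸
        LinearMap.range (diff M N)) := by
  have (x : V) : FiniteDimensional 𝕜 (M.space x) := hM x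
  have (x : V) : FiniteDimensional 𝕜 (N.space x) := hN x
  have h1 := (diff M N).finrank_range_add_finrank_ker
  have h2 := (LinearMap.range (diff M N)).finrank_quotient_add_finrank
  rw [ker_diff, Module.finrank_pi_fintype] at h1
  rw [Module.finrank_pi_fintype] at h2
  simp only [Module.finrank_linearMap] at h1 h2
  have h1' := congrArg (Nat.cast (R := ℤ)) h1
  have h2' := congrArg (Nat.cast (R := ℤ)) h2
  push_cast at h1' h2'
  simp only [homDim, eulerForm, dimVec]
  linarith

theorem eulerForm_le_homDim {M N : QuiverRep 𝕜 V} (hM : M.IsFinDim) (hN : N.IsFinDim) :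
    eulerForm M.dimVec N.dimVec ≤ homDim M N := by
  rw [homDim_eq_eulerForm_add hM hN]
  omega

theorem extVanish_iff {M N : QuiverRep 𝕜 V} (hM : M.IsFinDim) (hN : N.IsFinDim) :
    M.ExtVanish N ↔ (homDim M N : ℤ) = eulerForm M.dimVec N.dimVec := by
  have (x : V) : FiniteDimensional 𝕜 (M.space x) := hM x
  have (x : V) : FiniteDimensional 𝕜 (N.space x) := hN x
  rw [homDim_eq_eulerForm_add hM hN, add_eq_left, Nat.cast_eq_zero, Module.finrank_zero_iff,
    Submodule.Quotient.subsingleton_iff, LinearMap.range_eq_top]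
  rfl

end Euler

end QuiverRep

/-! ### Well-founded orders and finiteness of paths in acyclic quivers. -/

section AcyclicQuiver

variable {V : Type} [Quiver.{0} V]

/-- Being joined by a path of positive length is transitive, and irreflexive by acyclicity. Minimal
elements are the sinks here, the sources in `wellFounded_source`. -/
theorem IsAcyclicQuiver.wellFounded_target [Finite V] (hQ : IsAcyclicQuiver V) :
    WellFounded fun y x : V => Nonempty (x ⟶ y) := by
  let r : V → V → Prop := fun y x => ∃ p : Path x y, 0 < p.length
  have : IsTrans V r := ⟨fun a b c ⟨p, hp⟩ ⟨q, hq⟩ => ⟨q.comp p, by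
    rw [Quiver.Path.length_comp]; omega⟩⟩
  have : Std.Irrefl r := ⟨fun a ⟨p, hp⟩ => by rw [hQ a p] at hp; exact lt_irrefl _ hp⟩
  exact Subrelation.wf (fun {y x} ⟨a⟩ => ⟨a.toPath, Nat.one_pos⟩)
    (Finite.wellFounded_of_trans_of_irrefl r)

theorem IsAcyclicQuiver.wellFounded_source [Finite V] (hQ : IsAcyclicQuiver V) :
    WellFounded fun x y : V => Nonempty (x ⟶ y) := by
  let r : V → V → Prop := fun x y => ∃ p : Path x y, 0 < p.length
  have : IsTrans V r := ⟨fun a b c ⟨p, hp⟩ ⟨q, hq⟩ => ⟨p.comp q, by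
    rw [Quiver.Path.length_comp]; omega⟩⟩
  have : Std.Irrefl r := ⟨fun a ⟨p, hp⟩ => by rw [hQ a p] at hp; exact lt_irrefl _ hp⟩
  exact Subrelation.wf (fun {x y} ⟨a⟩ => ⟨a.toPath, Nat.one_pos⟩)
    (Finite.wellFounded_of_trans_of_irrefl r)

instance finite_path [Finite V] [∀ x y : V, Finite (x ⟶ y)] [hQ : Fact (IsAcyclicQuiver V)]
    (x y : V) : Finite (Path x y) := by
  induction y using hQ.out.wellFounded_source.induction with
  | h y ih =>
    classical
    have (z : V) : Finite (Path x z × (z ⟶ y)) := by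
      by_cases hz : Nonempty (z ⟶ y)
      · have := ih z hz
        infer_instance
      · have := not_nonempty_iff.mp hz
        infer_instance
    refine Finite.of_injective (β := Option (Σ z, Path x z × (z ⟶ y)))
      (fun p => match p with
        | .nil => none
        | .cons q a => some ⟨_, q, a⟩) ?_
    intro p q h
    cases p <;> cases q <;> simp only [Option.some.injEq, Sigma.mk.injEq, reduceCtorEq] at h ⊢
    obtain ⟨rfl, h⟩ := h
    obtain ⟨rfl, rfl⟩ := Prod.mk.inj (eq_of_heq h)
    rfl

/-- Paths are built by appending at the end, so uniqueness of the first arrow needs an induction.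
The middle vertex is bundled because it may a priori differ. -/
theorem toPath_comp_inj {x y y' z : V} {a : x ⟶ y} {a' : x ⟶ y'} {p : Path y z} {p' : Path y' z}
    (h : a.toPath.comp p = a'.toPath.comp p') :
    (⟨y, a, p⟩ : Σ y, (x ⟶ y) × Path y z) = ⟨y', a', p'⟩ := by
  induction p with
  | nil =>
    cases p' with
    | nil =>
      obtain rfl := eq_of_heq (Quiver.Path.hom_heq_of_cons_eq_cons h)
      rfl
    | cons p' b =>
      have := congrArg Path.length h
      simp at this
  | cons p b ih =>
    cases p' with
    | nil =>
      have := congrArg Path.length h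
      simp at this
    | cons p' b' =>
      rw [Quiver.Path.comp_cons, Quiver.Path.comp_cons] at h
      obtain rfl := Quiver.Path.obj_eq_of_cons_eq_cons h
      obtain rfl := eq_of_heq (Quiver.Path.hom_heq_of_cons_eq_cons h)
      have := ih (eq_of_heq (Quiver.Path.heq_of_cons_eq_cons h))
      simp only [Sigma.mk.injEq] at this
      obtain ⟨rfl, h'⟩ := this
      obtain ⟨rfl, rfl⟩ := Prod.mk.inj (eq_of_heq h')
      rfl

end AcyclicQuiver

namespace QuiverRep

/-! ### The projectives P_i ⊗ W, the Yoneda isomorphism and finite products. -/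

section Paths

variable {𝕜 : Type u} [Field 𝕜] {V : Type} [Quiver.{0} V]

/-- The action of a path on a representation. -/
def mapPath (M : QuiverRep 𝕜 V) {x : V} : ∀ {y : V}, Path x y → (M.space x →ₗ[𝕜] M.space y)
  | _, .nil => LinearMap.id
  | _, .cons p a => M.map a ∘ₗ mapPath M p

@[simp] theorem mapPath_nil (M : QuiverRep 𝕜 V) (x : V) :
    M.mapPath (.nil : Path x x) = LinearMap.id := rfl

@[simp] theorem mapPath_cons (M : QuiverRep 𝕜 V) {x y z : V} (p : Path x y) (a : y ⟶ z) :
    M.mapPath (p.cons a) = M.map a ∘ₗ M.mapPath p := rfl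

theorem mapPath_comp (M : QuiverRep 𝕜 V) {x y z : V} (p : Path x y) (q : Path y z) :
    M.mapPath (p.comp q) = M.mapPath q ∘ₗ M.mapPath p := by
  induction q with
  | nil => rfl
  | cons q a ih => rw [Quiver.Path.comp_cons, mapPath_cons, mapPath_cons, ih, LinearMap.comp_assoc]

theorem mapPath_toPath_comp (M : QuiverRep 𝕜 V) {x y z : V} (a : x ⟶ y) (q : Path y z) :
    M.mapPath (a.toPath.comp q) = M.mapPath q ∘ₗ M.map a := mapPath_comp M a.toPath q

/-- The representation `P_i ⊗ W`. -/
noncomputable abbrev copower (i : V) (W : Type u) [AddCommGroup W] [Module 𝕜 W] :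
    QuiverRep 𝕜 V where
  space x := Path i x →₀ W
  map a := Finsupp.lmapDomain W 𝕜 fun p => p.cons a

section Copower

variable {i : V} {W : Type u} [AddCommGroup W] [Module 𝕜 W]

theorem copower_map_single {x y : V} (a : x ⟶ y) (p : Path i x) (w : W) :
    (copower (𝕜 := 𝕜) i W).map a (Finsupp.single p w) = Finsupp.single (p.cons a) w :=
  Finsupp.mapDomain_single

/-- The morphism `P_i ⊗ W → M` given by a linear map `W → M_i`. -/
noncomputable def copowerLift (M : QuiverRep 𝕜 V) (f : W →ₗ[𝕜] M.space i) :
    (copower (𝕜 := 𝕜) i W).Hom M :=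
  ⟨fun _ => Finsupp.lsum 𝕜 fun p => M.mapPath p ∘ₗ f, fun x y a => by
    refine Finsupp.lhom_ext fun p w => ?_
    rw [LinearMap.comp_apply, copower_map_single]
    simp⟩

@[simp] theorem copowerLift_single (M : QuiverRep 𝕜 V) (f : W →ₗ[𝕜] M.space i) {x : V}
    (p : Path i x) (w : W) :
    (copowerLift M f).1 x (Finsupp.single p w) = M.mapPath p (f w) := by
  simp [copowerLift]

theorem copower_hom_single {M : QuiverRep 𝕜 V} (f : (copower (𝕜 := 𝕜) i W).Hom M) {x : V}
    (p : Path i x) (w : W) :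
    f.1 x (Finsupp.single p w) = M.mapPath p (f.1 i (Finsupp.single .nil w)) := by
  induction p with
  | nil => rfl
  | cons p a ih =>
    rw [mapPath_cons, LinearMap.comp_apply, ← ih, ← hom_map f, copower_map_single]

theorem copower_hom_ext {M : QuiverRep 𝕜 V} {f g : (copower (𝕜 := 𝕜) i W).Hom M}
    (h : ∀ w, f.1 i (Finsupp.single .nil w) = g.1 i (Finsupp.single .nil w)) : f = g := by
  refine Subtype.ext (funext fun x => Finsupp.lhom_ext fun p w => ?_)
  rw [copower_hom_single f, copower_hom_single g, h]

/-- A solution of `f(p·a) - a f(p) = g_a(p)`, by recursion on the path. -/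
noncomputable def copowerSolve (Y : QuiverRep 𝕜 V)
    (g : ∀ x y : V, (x ⟶ y) → ((Path i x →₀ W) →ₗ[𝕜] Y.space y)) :
    ∀ {x : V}, Path i x → (W →ₗ[𝕜] Y.space x)
  | _, .nil => 0
  | _, .cons p a => Y.map a ∘ₗ copowerSolve Y g p + g _ _ a ∘ₗ Finsupp.lsingle p

/-- Each nontrivial path is uniquely a shorter path followed by an arrow, so the coboundary equation
is a recursion on paths with free initial value. -/
theorem extVanish_copower (Y : QuiverRep 𝕜 V) : (copower (𝕜 := 𝕜) i W).ExtVanish Y := by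
  refine extVanish_of_exists_sub fun g => ⟨fun x => Finsupp.lsum 𝕜 fun p => copowerSolve Y g p,
    fun x y a v => ?_⟩
  induction v using Finsupp.induction_linear with
  | zero => simp
  | add v w hv hw =>
    simp only [map_add] at hv hw ⊢
    rw [← hv, ← hw]
    abel
  | single p w =>
    rw [copower_map_single]
    simp [copowerSolve]

theorem isFinDim_copower [∀ x y : V, Finite (Path x y)] [FiniteDimensional 𝕜 W] :
    (copower (𝕜 := 𝕜) i W).IsFinDim := fun _ => inferInstance

end Copower

theorem extVanish_pathRep (i : V) (Y : QuiverRep 𝕜 V) : (pathRep 𝕜 i).ExtVanish Y :=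
  extVanish_copower Y

theorem isFinDim_pathRep [∀ x y : V, Finite (Path x y)] (i : V) : (pathRep 𝕜 i).IsFinDim :=
  fun _ => inferInstance

/-- The morphism `P_i → M` given by an element of `M_i`. -/
noncomputable def yoneda (M : QuiverRep 𝕜 V) {i : V} (v : M.space i) : (pathRep 𝕜 i).Hom M :=
  copowerLift M (LinearMap.toSpanSingleton 𝕜 _ v)

theorem yoneda_single (M : QuiverRep 𝕜 V) {i x : V} (v : M.space i) (p : Path i x) (c : 𝕜) :
    (M.yoneda v).1 x (Finsupp.single p c) = c • M.mapPath p v := by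
  rw [yoneda, copowerLift_single, LinearMap.toSpanSingleton_apply, map_smul]

theorem pathRep_hom_ext {M : QuiverRep 𝕜 V} {i : V} {f g : (pathRep 𝕜 i).Hom M}
    (h : f.1 i (Finsupp.single .nil 1) = g.1 i (Finsupp.single .nil 1)) : f = g := by
  refine copower_hom_ext (W := 𝕜) fun c => ?_
  rw [← mul_one c, ← smul_eq_mul, ← Finsupp.smul_single]
  exact (map_smul (f.1 i) c _).trans ((congrArg (c • ·) h).trans (map_smul (g.1 i) c _).symm)

/-- `Hom_Q(P_i, M) = M_i`. -/
noncomputable def yonedaEquiv (M : QuiverRep 𝕜 V) (i : V) :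
    (pathRep 𝕜 i).Hom M ≃ₗ[𝕜] M.space i where
  toFun f := f.1 i (Finsupp.single .nil 1)
  map_add' _ _ := rfl
  map_smul' _ _ := rfl
  invFun v := M.yoneda v
  left_inv f := pathRep_hom_ext (by rw [yoneda_single]; simp)
  right_inv v := (yoneda_single M v _ _).trans (one_smul 𝕜 v)

theorem yoneda_add (M : QuiverRep 𝕜 V) {i : V} (v w : M.space i) :
    M.yoneda (v + w) = M.yoneda v + M.yoneda w := map_add (M.yonedaEquiv i).symm v w

theorem yoneda_smul (M : QuiverRep 𝕜 V) {i : V} (c : 𝕜) (v : M.space i) :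
    M.yoneda (c • v) = c • M.yoneda v := map_smul (M.yonedaEquiv i).symm c v

theorem homDim_pathRep (M : QuiverRep 𝕜 V) (i : V) : (homDim (pathRep 𝕜 i) M : ℤ) = M.dimVec i :=
  congrArg _ (M.yonedaEquiv i).finrank_eq

theorem pathRepHom_single {i j x : V} (a : i ⟶ j) (p : Path j x) (c : 𝕜) :
    (pathRepHom 𝕜 a).1 x (Finsupp.single p c) = Finsupp.single (a.toPath.comp p) c :=
  Finsupp.mapDomain_single

theorem yoneda_map (M : QuiverRep 𝕜 V) {i j : V} (a : i ⟶ j) (v : M.space i) :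
    M.yoneda (M.map a v) = comp (M.yoneda v) (pathRepHom 𝕜 a) := by
  refine pathRep_hom_ext ?_
  rw [comp_apply, pathRepHom_single, yoneda_single, yoneda_single]
  rfl

/-- Left multiplication by the arrows starting at `x` is jointly injective on paths. -/
theorem eq_zero_of_sum_pathRepHom_eq_zero {x z : V} [Fintype (Σ y, (x ⟶ y))]
    (u : ∀ b : Σ y, (x ⟶ y), Path b.1 z →₀ 𝕜)
    (h : ∑ b, (pathRepHom 𝕜 b.2).1 z (u b) = 0) (b : Σ y, (x ⟶ y)) : u b = 0 := by
  classical
  ext p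
  have h1 := DFunLike.congr_fun h (b.2.toPath.comp p)
  rw [Finsupp.finsetSum_apply, Finset.sum_eq_single b] at h1
  · rw [← Finsupp.mapDomain_apply (f := fun p => b.2.toPath.comp p)
      (Quiver.Path.comp_injective_right _) (u b) p]
    exact h1
  · intro c _ hc
    refine Finsupp.mapDomain_of_notMem_range _ _ ?_
    rintro ⟨q, hq⟩
    have := toPath_comp_inj hq
    obtain ⟨y, a⟩ := b
    obtain ⟨y', a'⟩ := c
    simp only [Sigma.mk.injEq] at this
    obtain ⟨rfl, h'⟩ := this
    exact hc (by rw [(Prod.mk.inj (eq_of_heq h')).1])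
  · intro hb
    exact absurd (Finset.mem_univ b) hb

/-- The product of a family of representations. -/
abbrev pi {ι : Type} (F : ι → QuiverRep 𝕜 V) : QuiverRep 𝕜 V where
  space x := ∀ k, (F k).space x
  map a := LinearMap.pi fun k => (F k).map a ∘ₗ LinearMap.proj k

section Pi

variable {ι : Type} (F : ι → QuiverRep 𝕜 V)

/-- The projections of a product. -/
def piProj (k : ι) : (pi F).Hom (F k) := Hom.mk' (fun _ => LinearMap.proj k) fun _ _ _ _ => rfl

variable {F} in
theorem isFinDim_pi [Finite ι] (h : ∀ k, (F k).IsFinDim) : (pi F).IsFinDim := fun x => by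
  have (k : ι) : FiniteDimensional 𝕜 ((F k).space x) := h k x
  infer_instance

variable {F} in
/-- The morphism from a finite product given by morphisms from the factors. -/
def piDesc [Fintype ι] {M : QuiverRep 𝕜 V} (f : ∀ k, (F k).Hom M) : (pi F).Hom M :=
  ∑ k, comp (f k) (piProj F k)

variable {F} in
theorem piDesc_apply [Fintype ι] {M : QuiverRep 𝕜 V} (f : ∀ k, (F k).Hom M) {x : V}
    (v : (pi F).space x) : (piDesc f).1 x v = ∑ k, (f k).1 x (v k) := by
  rw [piDesc, AddSubmonoidClass.coe_finsetSum, Finset.sum_apply, LinearMap.sum_apply]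
  rfl

variable [DecidableEq ι]

/-- The inclusions of the factors of a product. -/
def piSingle (k : ι) : (F k).Hom (pi F) :=
  Hom.mk' (fun x => LinearMap.single 𝕜 (fun k => (F k).space x) k) fun x y a v => by
    ext l
    by_cases h : l = k
    · subst h
      simp
    · simp [h]

variable {F} [Fintype ι]

theorem sum_piSingle {x : V} (v : (pi F).space x) :
    ∑ k, (piSingle F k).1 x (v k) = v := Finset.univ_sum_single v

theorem piDesc_single {M : QuiverRep 𝕜 V} (f : ∀ k, (F k).Hom M) (k : ι) {x : V}
    (v : (F k).space x) : (piDesc f).1 x ((piSingle F k).1 x v) = (f k).1 x v := by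
  rw [piDesc_apply, Finset.sum_eq_single k]
  · exact congrArg _ (Pi.single_eq_same (M := fun k => (F k).space x) k v)
  · intro l _ hl
    exact (congrArg _ (Pi.single_eq_of_ne (M := fun k => (F k).space x) hl v)).trans (map_zero _)
  · intro h
    exact absurd (Finset.mem_univ k) h

theorem pi_hom_ext {M : QuiverRep 𝕜 V} {f g : (pi F).Hom M}
    (h : ∀ k, comp f (piSingle F k) = comp g (piSingle F k)) : f = g := by
  refine Hom.ext' fun x v => ?_
  rw [← sum_piSingle v, map_sum, map_sum]
  refine Finset.sum_congr rfl fun k _ => ?_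
  rw [← comp_apply, h, comp_apply]

theorem extVanish_pi {Y : QuiverRep 𝕜 V} (h : ∀ k, (F k).ExtVanish Y) : (pi F).ExtVanish Y := by
  refine extVanish_of_exists_sub fun g => ?_
  choose f hf using fun k => (h k).exists_sub fun x y a => g x y a ∘ₗ (piSingle F k).1 x
  refine ⟨fun x => ∑ k, f k x ∘ₗ LinearMap.proj k, fun x y a v => ?_⟩
  simp only [LinearMap.sum_apply, map_sum, ← Finset.sum_sub_distrib, LinearMap.comp_apply]
  conv_rhs => rw [← sum_piSingle v, map_sum]
  exact Finset.sum_congr rfl fun k _ => hf k x y a (v k)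

end Pi

end Paths

end QuiverRep

namespace QuiverRep

/-! ### Factorizations and covers by sums of P_i. -/

section Factor

variable {𝕜 : Type u} [Field 𝕜] {V : Type} [Quiver.{0} V]

/-- A morphism with image in a subobject factors through it. -/
theorem exists_factor_of_range {X T B : QuiverRep 𝕜 V} (j : T.Hom B)
    (hj : ∀ x, Function.Injective (j.1 x)) (g : X.Hom B)
    (h : ∀ x v, g.1 x v ∈ LinearMap.range (j.1 x)) :
    ∃ f : X.Hom T, comp j f = g := by
  let f (x : V) : X.space x →ₗ[𝕜] T.space x :=
    (LinearEquiv.ofInjective (j.1 x) (hj x)).symm.toLinearMap ∘ₗ (g.1 x).codRestrict _ (h x)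
  have hf : ∀ x v, j.1 x (f x v) = g.1 x v := fun x v =>
    congrArg Subtype.val ((LinearEquiv.ofInjective (j.1 x) (hj x)).apply_symm_apply
      ((g.1 x).codRestrict _ (h x) v))
  refine ⟨Hom.mk' f fun x y a v => hj y ?_, Hom.ext' hf⟩
  rw [hf, hom_map, hom_map, hf]

/-- A morphism that vanishes on the kernel of a quotient map factors through it. -/
theorem exists_factor_of_ker {E N Y : QuiverRep 𝕜 V} (p : E.Hom N)
    (hp : ∀ x, Function.Surjective (p.1 x)) (g : E.Hom Y)
    (h : ∀ x v, p.1 x v = 0 → g.1 x v = 0) :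
    ∃ f : N.Hom Y, comp f p = g := by
  have hsec : ∀ x, ∃ σ : N.space x →ₗ[𝕜] E.space x, ∀ v, p.1 x (σ v) = v := fun x => by
    obtain ⟨s, hs⟩ := LinearMap.exists_rightInverse_of_surjective (p.1 x)
      (LinearMap.range_eq_top.mpr (hp x))
    exact ⟨s, fun v => LinearMap.congr_fun hs v⟩
  choose σ hσ using hsec
  have key : ∀ x v, g.1 x (σ x (p.1 x v)) = g.1 x v := fun x v => by
    rw [← sub_eq_zero, ← map_sub]
    exact h x _ (by rw [map_sub, hσ, sub_self])
  refine ⟨Hom.mk' (fun x => g.1 x ∘ₗ σ x) fun x y a v => ?_, Hom.ext' key⟩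
  obtain ⟨w, rfl⟩ := hp x v
  change g.1 y (σ y (N.map a (p.1 x w))) = Y.map a (g.1 x (σ x (p.1 x w)))
  rw [← hom_map, key, key, hom_map]

/-- Every finite-dimensional representation is a quotient of a finite direct sum of
representations `P_i`. -/
theorem exists_cover [Fintype V] {M : QuiverRep 𝕜 V} (hM : M.IsFinDim) :
    ∃ (ι : Type) (_ : Fintype ι) (v : ι → V) (m : ∀ k, M.space (v k)), ∀ x,
      Function.Surjective ((piDesc fun k => M.yoneda (m k)).1 x) := by
  classical
  have (x : V) : FiniteDimensional 𝕜 (M.space x) := hM x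
  refine ⟨Σ i, Fin (Module.finrank 𝕜 (M.space i)), inferInstance, fun k => k.1,
    fun k => Module.finBasis 𝕜 (M.space k.1) k.2, fun x => ?_⟩
  rw [← LinearMap.range_eq_top, eq_top_iff, ← (Module.finBasis 𝕜 (M.space x)).span_eq,
    Submodule.span_le]
  rintro _ ⟨k, rfl⟩
  refine ⟨(piSingle _ ⟨x, k⟩).1 x (Finsupp.single .nil 1), ?_⟩
  rw [piDesc_single, yoneda_single, one_smul]
  rfl

end Factor

/-! ### The Nakayama functor: injectivity of νP and the map D Hom(P, X) → Hom(X, νP). -/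

section Nakayama

variable {𝕜 : Type u} [Field 𝕜] {V : Type} [Quiver.{0} V]

/-- `Ext¹(-, Y) = 0` if each `Y_x → ∏_{a : x → y} Y_y` is surjective. -/
theorem extVanish_of_surjective_out [Finite V] (hQ : IsAcyclicQuiver V) {Y : QuiverRep 𝕜 V}
    (hY : ∀ x, Function.Surjective fun (v : Y.space x) (b : Σ y, (x ⟶ y)) => Y.map b.2 v)
    (X : QuiverRep 𝕜 V) : X.ExtVanish Y := by
  refine extVanish_of_exists_sub fun g => ?_
  have hsec : ∀ x, ∃ σ : (∀ b : Σ y, (x ⟶ y), Y.space b.1) →ₗ[𝕜] Y.space x,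
      ∀ w b, Y.map b.2 (σ w) = w b := fun x => by
    obtain ⟨s, hs⟩ := LinearMap.exists_rightInverse_of_surjective
      (LinearMap.pi fun b : Σ y, (x ⟶ y) => Y.map b.2) (LinearMap.range_eq_top.mpr (hY x))
    exact ⟨s, fun w b => congrFun (LinearMap.congr_fun hs w) b⟩
  choose σ hσ using hsec
  -- Recursion from the sinks: given the solution at the targets, joint surjectivity solves the
  -- equations of all arrows leaving `x` at once.
  let F (x : V) (ih : ∀ y, Nonempty (x ⟶ y) → (X.space y →ₗ[𝕜] Y.space y)) :
      X.space x →ₗ[𝕜] Y.space x :=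
    σ x ∘ₗ LinearMap.pi fun b => ih b.1 ⟨b.2⟩ ∘ₗ X.map b.2 - g x b.1 b.2
  refine ⟨hQ.wellFounded_target.fix F, fun x y a v => ?_⟩
  rw [hQ.wellFounded_target.fix_eq F x]
  change _ - Y.map (⟨y, a⟩ : Σ y, (x ⟶ y)).2 (σ x _) = _
  rw [hσ]
  simp

/-- The map `⨁_{a : x → y} Hom(P, P_y) → Hom(P, P_x)` given by the arrows starting at `x`. -/
noncomputable def outMap (P : QuiverRep 𝕜 V) (x : V) [Fintype (Σ y, (x ⟶ y))] :
    (∀ b : Σ y, (x ⟶ y), P.Hom (pathRep 𝕜 b.1)) →ₗ[𝕜] P.Hom (pathRep 𝕜 x) :=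
  ∑ b : Σ y, (x ⟶ y), P.postcomp (pathRepHom 𝕜 b.2) ∘ₗ LinearMap.proj b

/-- Paths with different first arrows are different, so ⨁ P_y → P_x is injective. The dual statement
makes νP injective, and the dimension inequality controls the defect under τ. -/
theorem outMap_injective (P : QuiverRep 𝕜 V) (x : V) [Fintype (Σ y, (x ⟶ y))] :
    Function.Injective (outMap P x) := by
  rw [← LinearMap.ker_eq_bot, LinearMap.ker_eq_bot']
  intro u hu
  refine funext fun b => Hom.ext' fun z v => ?_
  refine eq_zero_of_sum_pathRepHom_eq_zero (fun b => (u b).1 z v) ?_ b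
  have h := LinearMap.congr_fun (congrFun (congrArg Subtype.val hu) z) v
  rw [outMap, LinearMap.sum_apply, AddSubmonoidClass.coe_finsetSum, Finset.sum_apply,
    LinearMap.sum_apply] at h
  exact h

/-- `νP` is injective. -/
theorem extVanish_nakayama [Finite V] [∀ x y : V, Finite (x ⟶ y)] (hQ : IsAcyclicQuiver V)
    (P X : QuiverRep 𝕜 V) : X.ExtVanish P.nakayama := by
  classical
  refine extVanish_of_surjective_out hQ (fun x θ => ?_) X
  have := Fintype.ofFinite (Σ y, (x ⟶ y))
  have hA := outMap_injective P x
  -- The arrows leaving `x` act on νP jointly by the dual of `outMap`, hence surjectively.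
  obtain ⟨ψ, hψ⟩ := LinearMap.dualMap_surjective_of_injective hA
    (∑ b, θ b ∘ₗ LinearMap.proj b : Module.Dual 𝕜 (∀ b : Σ y, (x ⟶ y), P.Hom (pathRep 𝕜 b.1)))
  refine ⟨ψ, funext fun b => LinearMap.ext fun φ => ?_⟩
  have h := LinearMap.congr_fun hψ (Pi.single b φ)
  rw [LinearMap.dualMap_apply, outMap, LinearMap.sum_apply, LinearMap.sum_apply,
    Finset.sum_eq_single b, Finset.sum_eq_single b] at h
  · simpa using h
  · intro c _ hc
    simp [Pi.single_eq_of_ne hc]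
  · simp
  · intro c _ hc
    simp [Pi.single_eq_of_ne hc]
  · simp

theorem isFinDim_nakayama [Finite V] [∀ x y : V, Finite (Path x y)] {P : QuiverRep 𝕜 V}
    (hP : P.IsFinDim) : P.nakayama.IsFinDim := fun i => by
  have := finiteDimensional_hom hP (isFinDim_pathRep (𝕜 := 𝕜) i)
  exact Subspace.instModuleDualFiniteDimensional

theorem dimVec_nakayama (P : QuiverRep 𝕜 V) (i : V) :
    P.nakayama.dimVec i = homDim P (pathRep 𝕜 i) :=
  congrArg _ Subspace.dual_finrank_eq

/-- The natural map `D Hom_Q(P, X) → Hom_Q(X, νP)`, an isomorphism for projective `P`. -/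
noncomputable def dualHomMap (P X : QuiverRep 𝕜 V) :
    Module.Dual 𝕜 (P.Hom X) →ₗ[𝕜] X.Hom P.nakayama where
  toFun θ := Hom.mk' (fun i =>
      { toFun := fun v => θ ∘ₗ P.postcomp (X.yoneda v)
        map_add' := fun v w => by
          rw [yoneda_add]
          refine LinearMap.ext fun φ => ?_
          exact (congrArg θ (map_add (precomp X φ) _ _)).trans
            (map_add θ _ _)
        map_smul' := fun c v => by
          rw [yoneda_smul]
          refine LinearMap.ext fun φ => ?_
          exact (congrArg θ (map_smul (precomp X φ) c _)).trans
            (map_smul θ c _) })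
    fun x y a v => by
      refine LinearMap.ext fun φ => congrArg θ ?_
      rw [yoneda_map]
      rfl
  map_add' _ _ := rfl
  map_smul' _ _ := rfl

theorem dualHomMap_apply (P X : QuiverRep 𝕜 V) (θ : Module.Dual 𝕜 (P.Hom X)) {i : V}
    (v : X.space i) (φ : P.Hom (pathRep 𝕜 i)) :
    ((dualHomMap P X θ).1 i v : Module.Dual 𝕜 (P.Hom (pathRep 𝕜 i))) φ =
      θ (comp (X.yoneda v) φ) := rfl

/-- A functional in the kernel vanishes on all morphisms through some P_i. A morphism P → X lifts
along a cover of X, hence is a sum of such morphisms. -/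
theorem IsProjective.dualHomMap_injective [Fintype V] [∀ x y : V, Finite (Path x y)]
    {P X : QuiverRep 𝕜 V} (hP : P.IsProjective) (hX : X.IsFinDim) :
    Function.Injective (dualHomMap P X) := by
  rw [← LinearMap.ker_eq_bot, LinearMap.ker_eq_bot']
  intro θ hθ
  have h0 : ∀ (i : V) (v : X.space i) (φ : P.Hom (pathRep 𝕜 i)), θ (comp (X.yoneda v) φ) = 0 := by
    intro i v φ
    rw [← dualHomMap_apply, hθ]
    rfl
  refine LinearMap.ext fun f => ?_
  obtain ⟨ι, hι, w, m, hm⟩ := exists_cover hX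
  obtain ⟨g, rfl⟩ := hP.2 (pi fun k => pathRep 𝕜 (w k)) X
    (isFinDim_pi fun k => isFinDim_pathRep (w k)) hX _ hm f
  have : P.postcomp (piDesc fun k => X.yoneda (m k)) g =
      ∑ k, comp (X.yoneda (m k)) (comp (piProj _ k) g) := by
    refine Hom.ext' fun x v => ?_
    rw [AddSubmonoidClass.coe_finsetSum, Finset.sum_apply, LinearMap.sum_apply]
    exact piDesc_apply _ _
  rw [this, map_sum, Finset.sum_eq_zero fun k _ => h0 _ _ _]
  rfl

variable (𝕜) in
/-- The semisimple representation with a given dimension vector. -/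
abbrev semisimpleRep (n : V → ℕ) : QuiverRep 𝕜 V where
  space x := Fin (n x) → 𝕜
  map _ := 0

theorem dimVec_semisimpleRep (n : V → ℕ) (x : V) : (semisimpleRep 𝕜 n).dimVec x = n x := by
  simp [dimVec]

theorem IsARTranslate.isFinDim_left {N T : QuiverRep 𝕜 V} (h : N.IsARTranslate T) :
    N.IsFinDim := by
  obtain ⟨P₁, P₀, i, p, j, hP₁, hP₀, hip, hj⟩ := h
  exact hP₀.1.of_surjective p fun x => (hip x).2.2

theorem IsARTranslate.isFinDim_right [Finite V] [∀ x y : V, Finite (Path x y)]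
    {N T : QuiverRep 𝕜 V} (h : N.IsARTranslate T) :
    T.IsFinDim := by
  obtain ⟨P₁, P₀, i, p, j, hP₁, hP₀, hip, hj⟩ := h
  exact (isFinDim_nakayama hP₁.1).of_injective j fun x => (hj x).1

end Nakayama

/-! ### Serre duality and the Auslander-Reiten formula. -/

section ARFormula

variable {𝕜 : Type u} [Field 𝕜] {V : Type} [Quiver.{0} V] [Fintype V] [Fintype (Arrows V)]

/-- The Euler form determines its left argument. -/
theorem eq_zero_of_eulerForm_eq_zero (hQ : IsAcyclicQuiver V) {w : V → ℤ}
    (h : ∀ y, eulerForm w y = 0) : w = 0 := by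
  classical
  funext k
  induction k using hQ.wellFounded_source.induction with
  | h k ih =>
    have h1 := h (Pi.single k 1)
    rw [eulerForm, Finset.sum_eq_single k (by
        intro l _ hl
        rw [Pi.single_eq_of_ne hl, mul_zero]) (by simp),
      Finset.sum_eq_zero] at h1
    · simpa using h1
    · rintro ⟨x, y, a⟩ _
      by_cases hy : y = k
      · subst hy
        rw [ih x ⟨a⟩]
        simp
      · simp [hy]

theorem eulerForm_sum_left {ι : Type*} (s : Finset ι) (f : ι → V → ℤ) (e : V → ℤ) :
    eulerForm (∑ k ∈ s, f k) e = ∑ k ∈ s, eulerForm (f k) e :=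
  map_sum (AddMonoidHom.mk' (fun d => eulerForm d e) fun d d' => eulerForm_add_left d d' e) f s

theorem eulerForm_sum_right {ι : Type*} (s : Finset ι) (f : ι → V → ℤ) (d : V → ℤ) :
    eulerForm d (∑ k ∈ s, f k) = ∑ k ∈ s, eulerForm d (f k) :=
  map_sum (AddMonoidHom.mk' (fun e => eulerForm d e) fun e e' => eulerForm_add_right d e e') f s

theorem IsProjective.homDim_eq {P X : QuiverRep 𝕜 V} (hP : P.IsProjective) (hX : X.IsFinDim) :
    (homDim P X : ℤ) = eulerForm P.dimVec X.dimVec :=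
  (extVanish_iff hP.1 hX).mp (hP.extVanish hX)

variable [∀ x y : V, Finite (x ⟶ y)] [hQ : Fact (IsAcyclicQuiver V)]

-- Hom(P_x, M) = M_x and Ext¹(P_x, M) = 0 give this for dimension vectors. Semisimple
-- representations realize every nonnegative vector, and differences give the rest.
variable (𝕜) in
theorem eulerForm_pathRep (x : V) (y : V → ℤ) :
    eulerForm (pathRep 𝕜 x).dimVec y = y x := by
  have key : ∀ n : V → ℕ, eulerForm (pathRep 𝕜 x).dimVec (fun z => (n z : ℤ)) = n x := by
    intro n
    have h1 := (extVanish_iff (isFinDim_pathRep x) (N := semisimpleRep 𝕜 n)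
      fun z => inferInstance).mp (extVanish_pathRep x _)
    rw [homDim_pathRep, dimVec_semisimpleRep] at h1
    rw [h1]
    exact congrArg _ (funext fun z => (dimVec_semisimpleRep n z).symm)
  have hy : y = (fun z => ((y z).toNat : ℤ)) - fun z => ((-y z).toNat : ℤ) :=
    funext fun z => (Int.toNat_sub_toNat_neg (y z)).symm
  rw [hy, eulerForm_sub_right, key, key, Pi.sub_apply]

-- The numerical form of the standard projective resolution. Both sides pair equally with every `y`
-- on the right, which suffices because the Euler form is nondegenerate.
variable (𝕜) in
theorem sum_smul_dimVec_pathRep (d : V → ℤ) :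
    ∑ x, d x • (pathRep 𝕜 x).dimVec - ∑ α : Arrows V, d α.1 • (pathRep 𝕜 α.2.1).dimVec = d := by
  rw [← sub_eq_zero]
  refine eq_zero_of_eulerForm_eq_zero hQ.out fun y => ?_
  rw [eulerForm_sub_left, eulerForm_sub_left, eulerForm_sum_left, eulerForm_sum_left, sub_eq_zero]
  simp only [eulerForm_smul_left, eulerForm_pathRep]
  rfl

-- Serre duality on dimension vectors: for e = dim P with P projective, the inner vector is dim νP.
-- Expanding `d` in the vectors dim P_x reduces the identity to the definition of the Euler form.
variable (𝕜) in
theorem eulerForm_eulerForm_pathRep (d e : V → ℤ) :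
    eulerForm d (fun x => eulerForm e (pathRep 𝕜 x).dimVec) = eulerForm e d := by
  conv_rhs => rw [← sum_smul_dimVec_pathRep 𝕜 d]
  rw [eulerForm_sub_right, eulerForm_sum_right, eulerForm_sum_right]
  simp only [eulerForm_smul_right]
  rfl

/-- An injection between spaces of equal dimension: Ext¹(X, νP) and Ext¹(P, X) vanish, so both
dimensions are Euler pairings, equal by `eulerForm_eulerForm_pathRep`. -/
theorem IsProjective.dualHomMap_bijective {P X : QuiverRep 𝕜 V} (hP : P.IsProjective)
    (hX : X.IsFinDim) : Function.Bijective (dualHomMap P X) := by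
  have hinj := hP.dualHomMap_injective hX
  refine ⟨hinj, ?_⟩
  have h1 := finiteDimensional_hom hP.1 hX
  have h2 := finiteDimensional_hom hX (isFinDim_nakayama hP.1)
  refine (LinearMap.injective_iff_surjective_of_finrank_eq_finrank ?_).mp hinj
  rw [Subspace.dual_finrank_eq]
  have h3 := (extVanish_iff hX (isFinDim_nakayama hP.1)).mp (extVanish_nakayama hQ.out P X)
  rw [show P.nakayama.dimVec = fun x => eulerForm P.dimVec (pathRep 𝕜 x).dimVec from
    funext fun x => (dimVec_nakayama P x).trans (hP.homDim_eq (isFinDim_pathRep x)),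
    eulerForm_eulerForm_pathRep, ← hP.homDim_eq hX] at h3
  exact (Nat.cast_injective h3).symm

/-- The Auslander-Reiten formula: `dim Hom(X, τN) = dim Ext¹(N, X)`. -/
theorem IsARTranslate.homDim_eq {N T X : QuiverRep 𝕜 V} (h : N.IsARTranslate T)
    (hX : X.IsFinDim) :
    (homDim X T : ℤ) = homDim N X - eulerForm N.dimVec X.dimVec := by
  obtain ⟨P₁, P₀, i, p, j, hP₁, hP₀, hip, hj⟩ := h
  have f1 := finiteDimensional_hom hP₁.1 hX
  have f0 := finiteDimensional_hom hP₀.1 hX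
  have b1 := hP₁.dualHomMap_bijective hX
  have b0 := hP₀.dualHomMap_bijective hX
  have hnat : ∀ (θ : Module.Dual 𝕜 (P₁.Hom X)) (x : V) (v : X.space x),
      (dualHomMap P₀ X ((precomp X i).dualMap θ)).1 x v =
        nakayamaMap i x ((dualHomMap P₁ X θ).1 x v) := fun _ _ _ => rfl
  -- A morphism X → T is a morphism X → νP₁ killed by νP₁ → νP₀. By Serre duality it is a functional
  -- on Hom(P₁, X) vanishing on the image of Hom(P₀, X), that is, an element of D Ext¹(N, X).
  have hrange : LinearMap.range (X.postcomp j) =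
      (LinearMap.ker (precomp X i).dualMap).map (dualHomMap P₁ X) := by
    ext g
    constructor
    · rintro ⟨f, rfl⟩
      obtain ⟨θ, hθ⟩ := b1.2 (X.postcomp j f)
      refine ⟨θ, b0.1 ?_, hθ⟩
      rw [map_zero]
      refine Hom.ext' fun x v => ?_
      rw [hnat, hθ]
      exact (hj x).2.apply_apply_eq_zero _
    · rintro ⟨θ, hθ, rfl⟩
      refine exists_factor_of_range j (fun x => (hj x).1) _ fun x v => ((hj x).2 _).mp ?_
      rw [← hnat, LinearMap.mem_ker.mp hθ, map_zero]
      rfl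
  have hinj : Function.Injective (X.postcomp j) := fun f g hfg => Hom.ext' fun x v =>
    (hj x).1 (LinearMap.congr_fun (congrFun (congrArg Subtype.val hfg) x) v)
  have e1 : homDim X T = Module.finrank 𝕜 (LinearMap.ker (precomp X i).dualMap) := by
    rw [homDim, ← LinearMap.finrank_range_of_inj hinj, hrange,
      ← LinearEquiv.finrank_map_eq (LinearEquiv.ofBijective _ b1)]
    rfl
  have e2 := Subspace.finrank_add_finrank_dualAnnihilator_eq (LinearMap.range (precomp X i))
  rw [← LinearMap.ker_dualMap_eq_dualAnnihilator_range, ← e1] at e2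
  have e3 := (precomp X i).finrank_range_add_finrank_ker
  have hker : LinearMap.ker (precomp X i) = LinearMap.range (precomp X p) := by
    ext g
    constructor
    · intro hg
      refine exists_factor_of_ker p (fun x => (hip x).2.2) g fun x v hv => ?_
      obtain ⟨w, rfl⟩ := ((hip x).2.1 v).mp hv
      exact LinearMap.congr_fun (congrFun (congrArg Subtype.val hg) x) w
    · rintro ⟨f, rfl⟩
      refine Hom.ext' fun x v => ?_
      exact (congrArg (f.1 x) ((hip x).2.1.apply_apply_eq_zero v)).trans (map_zero _)
  have hpinj : Function.Injective (precomp X p) := fun f g hfg => Hom.ext' fun x v => by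
    obtain ⟨w, rfl⟩ := (hip x).2.2 v
    exact LinearMap.congr_fun (congrFun (congrArg Subtype.val hfg) x) w
  rw [hker, LinearMap.finrank_range_of_inj hpinj] at e3
  have e4 : P₀.dimVec = P₁.dimVec + N.dimVec := funext (hip.dimVec_eq hP₀.1)
  have e5 := hP₁.homDim_eq hX
  have e6 := hP₀.homDim_eq hX
  rw [e4, eulerForm_add_left] at e6
  simp only [homDim] at *
  have e2' := congrArg (Nat.cast (R := ℤ)) e2
  have e3' := congrArg (Nat.cast (R := ℤ)) e3
  push_cast at e2' e3'
  linarith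

theorem IsARTranslate.dimVec_eq {N T : QuiverRep 𝕜 V} (h : N.IsARTranslate T) (x : V) :
    T.dimVec x = homDim N (pathRep 𝕜 x) - eulerForm N.dimVec (pathRep 𝕜 x).dimVec := by
  rw [← homDim_pathRep, h.homDim_eq (isFinDim_pathRep x)]

end ARFormula

end QuiverRep

namespace QuiverRep

/-! ### Existence of τ, and indecomposables that are not projective or not injective. -/

section Translate

variable {𝕜 : Type u} [Field 𝕜] {V : Type} [Quiver.{0} V]

theorem isProjective_pi_copower {ι : Type} [Finite ι] [∀ x y : V, Finite (Path x y)]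
    (v : ι → V) (W : ι → Type u) [∀ k, AddCommGroup (W k)] [∀ k, Module 𝕜 (W k)]
    [∀ k, FiniteDimensional 𝕜 (W k)] :
    (pi fun k => copower (𝕜 := 𝕜) (v k) (W k)).IsProjective := by
  classical
  have := Fintype.ofFinite ι
  exact isProjective_of_extVanish (isFinDim_pi fun k => isFinDim_copower) fun Y _ =>
    extVanish_pi fun k => extVanish_copower Y

theorem nakayamaMap_map {P P' : QuiverRep 𝕜 V} (f : P.Hom P') {x y : V} (a : x ⟶ y)
    (θ : P.nakayama.space x) :
    nakayamaMap f y (P.nakayama.map a θ) = P'.nakayama.map a (nakayamaMap f x θ) := rfl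

/-- The map `νP → νP'` induced by `P → P'`. -/
noncomputable def nakayamaHom {P P' : QuiverRep 𝕜 V} (f : P.Hom P') :
    P.nakayama.Hom P'.nakayama :=
  Hom.mk' (fun x => nakayamaMap f x) fun _ _ a θ => nakayamaMap_map f a θ

/-- The kernel of a projective cover map is again projective, since vanishing of Ext¹(-, Y) passes
to subobjects. So every cover yields a presentation of length one. -/
theorem exists_isARTranslate [Fintype V] [∀ x y : V, Finite (Path x y)] {M : QuiverRep 𝕜 V}
    (hM : M.IsFinDim) : ∃ T, M.IsARTranslate T := by
  obtain ⟨ι, hι, v, m, hm⟩ := exists_cover hM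
  have hP : (pi fun k => pathRep 𝕜 (v k)).IsProjective :=
    isProjective_pi_copower v fun _ => 𝕜
  refine ⟨kernel (nakayamaHom (kernelIncl (piDesc fun k => M.yoneda (m k)))), _, _, _, _,
    kernelIncl _, ?_, hP, kernel_exact _ hm, fun x => ⟨Subtype.val_injective, ?_⟩⟩
  · exact isProjective_of_extVanish (hP.1.sub _ _) fun Y hY =>
      (hP.extVanish hY).of_injective (kernelIncl _) fun x => Subtype.val_injective
  · exact LinearMap.exact_iff.mpr (Submodule.range_subtype _).symm

/-- An indecomposable representation that is not projective has no nonzero morphism to a `P_x`. -/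
theorem IsIndecomposable.homDim_pathRep_eq_zero [∀ x y : V, Finite (Path x y)]
    {M : QuiverRep 𝕜 V} (hM : M.IsIndecomposable) (hfd : M.IsFinDim) (hP : ¬ M.IsProjective)
    (x : V) : homDim M (pathRep 𝕜 x) = 0 := by
  by_contra h
  obtain ⟨f, hf⟩ := not_isZero_of_homDim_ne_zero h
  -- As a subobject of a projective, the image is projective. It splits off from `M`, so `M` would
  -- be isomorphic to it.
  have hext : ∀ Y : QuiverRep 𝕜 V, (image f).ExtVanish Y := fun Y =>
    (extVanish_pathRep x Y).of_injective (imageIncl f) fun _ => Subtype.val_injective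
  obtain ⟨s, hs⟩ := (hext _).exists_lift_of_exact (kernel_exact _ (toImage_surjective f))
    (image f).idHom
  have hne : ¬ (image f).IsZero := by
    intro h0
    refine hf (Hom.ext' fun y v => ?_)
    have := h0 y
    exact congrArg Subtype.val (Subsingleton.elim ((toImage f).1 y v) 0)
  exact hP (isProjective_of_extVanish hfd fun Y _ => (hext Y).of_injective (toImage f)
    fun y => (hM.bijective_of_retract hne hs y).2.1)

/-- An indecomposable representation that is not injective receives no nonzero morphism
from a `νP`. -/
theorem IsIndecomposable.eq_zero_of_nakayama [Finite V] [∀ x y : V, Finite (x ⟶ y)]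
    (hQ : IsAcyclicQuiver V) {M : QuiverRep 𝕜 V} (hM : M.IsIndecomposable) (hfd : M.IsFinDim)
    (hI : ¬ M.IsInjective) {P : QuiverRep 𝕜 V} (f : P.nakayama.Hom M) : f = 0 := by
  by_contra hf
  have hext : ∀ X : QuiverRep 𝕜 V, X.ExtVanish (image f) := fun X =>
    (extVanish_nakayama hQ P X).of_surjective (toImage f) (toImage_surjective f)
  obtain ⟨r, hr⟩ := (hext _).exists_extend_of_exact
    (cokernel_exact (imageIncl f) fun _ => Subtype.val_injective) (image f).idHom
  have hne : ¬ (image f).IsZero := by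
    intro h0
    refine hf (Hom.ext' fun y v => ?_)
    have := h0 y
    exact congrArg Subtype.val (Subsingleton.elim ((toImage f).1 y v) 0)
  exact hI (isInjective_of_extVanish hfd fun X _ => (hext X).of_surjective (imageIncl f)
    fun y => (hM.bijective_of_retract hne hr y).1.2)

end Translate

/-! ### The Coxeter transformation and invariants preserved by τ. -/

section Coxeter

variable {𝕜 : Type u} [Field 𝕜] {V : Type} [Quiver.{0} V] [Fintype V] [Fintype (Arrows V)]
  [∀ x y : V, Finite (x ⟶ y)] [Fact (IsAcyclicQuiver V)]

/-- `τ` acts on dimension vectors by the Coxeter transformation. -/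
theorem IsARTranslate.eulerForm_right {N T : QuiverRep 𝕜 V} (h : N.IsARTranslate T)
    (hN : ∀ x, homDim N (pathRep 𝕜 x) = 0) (y : V → ℤ) :
    eulerForm y T.dimVec = -eulerForm N.dimVec y := by
  have hT : T.dimVec = (-1 : ℤ) • fun x => eulerForm N.dimVec (pathRep 𝕜 x).dimVec := by
    funext x
    rw [h.dimVec_eq, hN]
    simp
  rw [hT, eulerForm_smul_right, eulerForm_eulerForm_pathRep]
  ring

/-- Apply the Auslander-Reiten formula with X = T and with X = N; the Euler terms cancel because ⟨N,
T⟩ = -⟨N, N⟩. -/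
theorem IsARTranslate.homDim_self {N T : QuiverRep 𝕜 V} (h : N.IsARTranslate T)
    (hN : ∀ x, homDim N (pathRep 𝕜 x) = 0) : homDim T T = homDim N N := by
  have h1 := h.homDim_eq h.isFinDim_right
  have h2 := h.homDim_eq h.isFinDim_left
  have h3 := h.eulerForm_right hN N.dimVec
  omega

theorem IsARTranslate.eulerForm_self {N T : QuiverRep 𝕜 V} (h : N.IsARTranslate T)
    (hN : ∀ x, homDim N (pathRep 𝕜 x) = 0) :
    eulerForm T.dimVec T.dimVec = eulerForm N.dimVec N.dimVec := by
  rw [h.eulerForm_right hN, h.eulerForm_right hN, neg_neg]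

end Coxeter

/-! ### Elementary morphisms ⨁ P_{v k} ⊗ W k → P_i and functionals on them. -/

section InverseTranslate

variable {𝕜 : Type u} [Field 𝕜] {V : Type} [Quiver.{0} V]

/-- The morphism to a product given by morphisms to the factors. -/
def piLift {ι : Type} {F : ι → QuiverRep 𝕜 V} {X : QuiverRep 𝕜 V} (f : ∀ k, X.Hom (F k)) :
    X.Hom (pi F) :=
  Hom.mk' (fun x => LinearMap.pi fun k => (f k).1 x) fun _ _ a v =>
    funext fun k => hom_map (f k) a v

section Elementary

theorem mapPath_pathRep_single {i x y : V} (p : Path i x) (q : Path x y) (c : 𝕜) :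
    (pathRep 𝕜 i).mapPath q (Finsupp.single p c) = Finsupp.single (p.comp q) c := by
  induction q with
  | nil => rfl
  | cons q a ih =>
    rw [mapPath_cons, LinearMap.comp_apply, ih]
    exact copower_map_single (W := 𝕜) a _ c

variable {k i : V} {W : Type u} [AddCommGroup W] [Module 𝕜 W]

/-- The morphism `P_k ⊗ W → P_i` given by a functional on `W` and a path from `i` to `k`. -/
noncomputable def copowerToPathRep (p : Path i k) :
    Module.Dual 𝕜 W →ₗ[𝕜] (copower (𝕜 := 𝕜) k W).Hom (pathRep 𝕜 i) where
  toFun l := copowerLift (pathRep 𝕜 i) (Finsupp.lsingle p ∘ₗ l)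
  map_add' l l' := by
    refine copower_hom_ext fun w => ?_
    rw [copowerLift_single]
    change _ = (copowerLift (pathRep 𝕜 i) (Finsupp.lsingle p ∘ₗ l)).1 k (Finsupp.single .nil w) +
      (copowerLift (pathRep 𝕜 i) (Finsupp.lsingle p ∘ₗ l')).1 k (Finsupp.single .nil w)
    rw [copowerLift_single, copowerLift_single]
    simp
  map_smul' c l := by
    refine copower_hom_ext fun w => ?_
    rw [copowerLift_single]
    change _ =
      c • (copowerLift (pathRep 𝕜 i) (Finsupp.lsingle p ∘ₗ l)).1 k (Finsupp.single .nil w)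
    rw [copowerLift_single]
    simp

theorem copowerToPathRep_single (p : Path i k) (l : Module.Dual 𝕜 W) {x : V} (q : Path k x)
    (w : W) : (copowerToPathRep p l).1 x (Finsupp.single q w) = Finsupp.single (p.comp q) (l w) :=
  (copowerLift_single _ _ _ _).trans (mapPath_pathRep_single p q (l w))

theorem copowerToPathRep_nil_apply (l : Module.Dual 𝕜 W) {x : V} (u : Path k x →₀ W)
    (q : Path k x) :
    ((copowerToPathRep .nil l).1 x u : Path k x →₀ 𝕜) q = l (u q) := by
  induction u using Finsupp.induction_linear with
  | zero => simp
  | add u v hu hv =>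
    rw [map_add, Finsupp.add_apply, hu, hv, Finsupp.add_apply, map_add]
  | single p w =>
    rw [copowerToPathRep_single, Quiver.Path.nil_comp]
    classical
    by_cases h : p = q
    · subst h
      simp
    · simp [h]

theorem pathRepHom_comp_copowerToPathRep {h : V} (a : h ⟶ i) (p : Path i k)
    (l : Module.Dual 𝕜 W) :
    comp (pathRepHom 𝕜 a) (copowerToPathRep p l) = copowerToPathRep (a.toPath.comp p) l := by
  refine copower_hom_ext fun w => ?_
  rw [comp_apply, copowerToPathRep_single, copowerToPathRep_single, pathRepHom_single]
  rfl

/-- The morphism `P_j ⊗ W → P_i ⊗ W` given by an arrow `i → j`. -/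
noncomputable def copowerPrepend (W : Type u) [AddCommGroup W] [Module 𝕜 W] {i j : V}
    (a : i ⟶ j) : (copower (𝕜 := 𝕜) j W).Hom (copower i W) :=
  copowerLift (copower i W) (Finsupp.lsingle a.toPath)

/-- The morphism `P_i ⊗ W → P_i ⊗ W'` given by a linear map. -/
noncomputable def copowerMap (i : V) {W' : Type u} [AddCommGroup W'] [Module 𝕜 W']
    (f : W →ₗ[𝕜] W') : (copower (𝕜 := 𝕜) i W).Hom (copower i W') :=
  copowerLift (copower i W') (Finsupp.lsingle .nil ∘ₗ f)

theorem copowerToPathRep_comp_prepend {j : V} (a : k ⟶ j) (p : Path i k)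
    (l : Module.Dual 𝕜 W) :
    comp (copowerToPathRep p l) (copowerPrepend W a) = copowerToPathRep (p.cons a) l := by
  refine copower_hom_ext fun w => ?_
  rw [comp_apply, copowerPrepend, copowerLift_single, mapPath_nil, LinearMap.id_apply,
    Finsupp.lsingle_apply, copowerToPathRep_single, copowerToPathRep_single]
  rfl

theorem copowerToPathRep_comp_map {W' : Type u} [AddCommGroup W'] [Module 𝕜 W']
    (f : W →ₗ[𝕜] W') (p : Path i k) (l : Module.Dual 𝕜 W') :
    comp (copowerToPathRep p l) (copowerMap k f) = copowerToPathRep p (l ∘ₗ f) := by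
  refine copower_hom_ext fun w => ?_
  rw [comp_apply, copowerMap, copowerLift_single, mapPath_nil, LinearMap.id_apply,
    LinearMap.comp_apply, Finsupp.lsingle_apply, copowerToPathRep_single, copowerToPathRep_single]
  rfl

end Elementary

section PiElementary

variable {ι : Type} {v : ι → V} {W : ι → Type u} [∀ k, AddCommGroup (W k)]
  [∀ k, Module 𝕜 (W k)] {i : V}

/-- The morphism `⨁ₖ P_{v k} ⊗ W k → P_i` given by a path from `i` to a `v k` and a functional
on `W k`. -/
noncomputable def elemHom (q : Σ k, Path i (v k)) :
    Module.Dual 𝕜 (W q.1) →ₗ[𝕜] (pi fun k => copower (𝕜 := 𝕜) (v k) (W k)).Hom (pathRep 𝕜 i) :=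
  precomp _ (piProj _ q.1) ∘ₗ copowerToPathRep q.2

theorem elemHom_apply (q : Σ k, Path i (v k)) (l : Module.Dual 𝕜 (W q.1)) {x : V}
    (u : (pi fun k => copower (𝕜 := 𝕜) (v k) (W k)).space x) :
    (elemHom q l).1 x u = (copowerToPathRep q.2 l).1 x (u q.1) := rfl

theorem pathRepHom_comp_elemHom {h : V} (a : h ⟶ i) (q : Σ k, Path i (v k))
    (l : Module.Dual 𝕜 (W q.1)) :
    comp (pathRepHom 𝕜 a) (elemHom q l) =
      elemHom (W := W) ⟨q.1, a.toPath.comp q.2⟩ l :=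
  Hom.ext' fun x u => LinearMap.congr_fun (congrFun (congrArg Subtype.val
    (pathRepHom_comp_copowerToPathRep a q.2 l)) x) (u q.1)

variable [DecidableEq ι]

/-- The coefficients of a morphism `⨁ₖ P_{v k} ⊗ W k → P_i`. -/
noncomputable def elemCoeff (q : Σ k, Path i (v k)) :
    (pi fun k => copower (𝕜 := 𝕜) (v k) (W k)).Hom (pathRep 𝕜 i) →ₗ[𝕜]
      Module.Dual 𝕜 (W q.1) where
  toFun f := Finsupp.lapply q.2 ∘ₗ f.1 (v q.1) ∘ₗ
    (piSingle (fun k => copower (𝕜 := 𝕜) (v k) (W k)) q.1).1 (v q.1) ∘ₗ Finsupp.lsingle .nil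
  map_add' _ _ := rfl
  map_smul' _ _ := rfl

theorem elemCoeff_apply (q : Σ k, Path i (v k))
    (f : (pi fun k => copower (𝕜 := 𝕜) (v k) (W k)).Hom (pathRep 𝕜 i)) (w : W q.1) :
    elemCoeff q f w = (f.1 (v q.1) ((piSingle (fun k => copower (𝕜 := 𝕜) (v k) (W k)) q.1).1
      (v q.1) (Finsupp.single .nil w)) : Path i (v q.1) →₀ 𝕜) q.2 := rfl

theorem piSingle_same {F : ι → QuiverRep 𝕜 V} (k : ι) {x : V} (u : (F k).space x) :
    (piSingle F k).1 x u k = u := Pi.single_eq_same (M := fun k => (F k).space x) k u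

theorem piSingle_of_ne {F : ι → QuiverRep 𝕜 V} {k l : ι} (h : l ≠ k) {x : V}
    (u : (F k).space x) : (piSingle F k).1 x u l = 0 :=
  Pi.single_eq_of_ne (M := fun k => (F k).space x) h u

theorem elemCoeff_elemHom_self (q : Σ k, Path i (v k)) (l : Module.Dual 𝕜 (W q.1)) :
    elemCoeff q (elemHom q l) = l := by
  refine LinearMap.ext fun w => ?_
  rw [elemCoeff_apply, elemHom_apply, piSingle_same, copowerToPathRep_single,
    Quiver.Path.comp_nil, Finsupp.single_eq_same]

theorem elemCoeff_elemHom_of_ne {q q' : Σ k, Path i (v k)} (h : q' ≠ q)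
    (l : Module.Dual 𝕜 (W q.1)) : elemCoeff q' (elemHom q l) = 0 := by
  refine LinearMap.ext fun w => ?_
  rw [elemCoeff_apply, elemHom_apply]
  obtain ⟨k, p⟩ := q
  obtain ⟨k', p'⟩ := q'
  by_cases hk : k = k'
  · subst hk
    have hp : p' ≠ p := fun hp => h (by rw [hp])
    rw [piSingle_same, copowerToPathRep_single, Quiver.Path.comp_nil, Finsupp.single_eq_of_ne hp]
    rfl
  · rw [piSingle_of_ne hk, map_zero]
    rfl

variable [Fintype ι] [∀ x y : V, Finite (Path x y)]

/-- Functionals on `Hom(⨁ₖ P_{v k} ⊗ W k, P_i)` are determined by the elementary morphisms. -/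
theorem dual_hom_ext
    {θ θ' : Module.Dual 𝕜 ((pi fun k => copower (𝕜 := 𝕜) (v k) (W k)).Hom (pathRep 𝕜 i))}
    (h : ∀ (q : Σ k, Path i (v k)) (l : Module.Dual 𝕜 (W q.1)),
      θ (elemHom q l) = θ' (elemHom q l)) : θ = θ' := by
  have (k : ι) := Fintype.ofFinite (Path i (v k))
  refine LinearMap.ext fun f => ?_
  have hf : f = ∑ k, ∑ p : Path i (v k),
      elemHom (W := W) ⟨k, p⟩ (elemCoeff (W := W) ⟨k, p⟩ f) := by
    refine pi_hom_ext fun k => copower_hom_ext fun w => ?_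
    rw [comp_apply, comp_apply]
    have key (l : ι) (p : Path i (v l))
        (u : (pi fun k => copower (𝕜 := 𝕜) (v k) (W k)).space (v k)) :
        (elemHom (W := W) ⟨l, p⟩ (elemCoeff (W := W) ⟨l, p⟩ f)).1 (v k) u =
          (copowerToPathRep p (elemCoeff (W := W) ⟨l, p⟩ f)).1 (v k) (u l) := rfl
    simp only [AddSubmonoidClass.coe_finsetSum, Finset.sum_apply, LinearMap.sum_apply,
      key]
    rw [Finset.sum_eq_single k]
    · refine ((Finset.sum_congr rfl fun p _ => ?_).trans (Finsupp.univ_sum_single _)).symm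
      exact (congrArg _ (piSingle_same k _)).trans (copowerToPathRep_single _ _ _ _)
    · intro l _ hl
      exact Finset.sum_eq_zero fun p _ => (congrArg _ (piSingle_of_ne hl _)).trans (map_zero _)
    · simp
  rw [hf]
  simp only [map_sum, h]

end PiElementary

end InverseTranslate

end QuiverRep

namespace QuiverRep

/-! ### The copresentation of M by injectives νP, which defines the inverse translate. -/

section InverseTranslate

variable {𝕜 : Type u} [Field 𝕜] {V : Type} [Quiver.{0} V]

/-- The representation `⨁ₖ P_k ⊗ M_k`. -/
noncomputable abbrev vertexSum (M : QuiverRep 𝕜 V) : QuiverRep 𝕜 V :=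
  pi fun k : V => copower (𝕜 := 𝕜) k (M.space k)

/-- The representation `⨁ₐ P_{s(a)} ⊗ M_{t(a)}`. -/
noncomputable abbrev arrowSum (M : QuiverRep 𝕜 V) : QuiverRep 𝕜 V :=
  pi fun α : Arrows V => copower (𝕜 := 𝕜) α.1 (M.space α.2.1)

/-- The morphism `⨁ₖ P_k ⊗ M_k → ⨁ₐ P_{s(a)} ⊗ M_{t(a)}` with cokernel `τ⁻M`. -/
noncomputable def vertexToArrow (M : QuiverRep 𝕜 V) : M.vertexSum.Hom M.arrowSum :=
  piLift fun α => comp (copowerPrepend _ α.2.2) (piProj _ α.2.1) -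
    comp (copowerMap α.1 (M.map α.2.2)) (piProj _ α.1)

theorem elemHom_comp_vertexToArrow (M : QuiverRep 𝕜 V) {i : V} (α : Arrows V) (p : Path i α.1)
    (l : Module.Dual 𝕜 (M.space α.2.1)) :
    comp (elemHom (v := fun α : Arrows V => α.1) (W := fun α => M.space α.2.1) ⟨α, p⟩ l)
        M.vertexToArrow =
      elemHom (v := fun k => k) (W := M.space) ⟨α.2.1, p.cons α.2.2⟩ l -
        elemHom (v := fun k => k) (W := M.space) ⟨α.1, p⟩ (l ∘ₗ M.map α.2.2) := by
  refine Hom.ext' fun x u => ?_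
  have h1 := LinearMap.congr_fun (congrFun (congrArg Subtype.val
    (copowerToPathRep_comp_prepend α.2.2 p l)) x) (u α.2.1)
  have h2 := LinearMap.congr_fun (congrFun (congrArg Subtype.val
    (copowerToPathRep_comp_map (M.map α.2.2) p l)) x) (u α.1)
  exact (map_sub ((copowerToPathRep p l).1 x) _ _).trans (congrArg₂ (· - ·) h1 h2)

variable [Fintype V] [DecidableEq V] [∀ x y : V, Fintype (Path x y)]

/-- The map `M_i → D Hom(⨁ₖ P_k ⊗ M_k, P_i)`. -/
noncomputable def toNakayamaAt (M : QuiverRep 𝕜 V) (i : V) :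
    M.space i →ₗ[𝕜] Module.Dual 𝕜 (M.vertexSum.Hom (pathRep 𝕜 i)) :=
  ∑ q : Σ k, Path i k, (elemCoeff (v := fun k => k) (W := M.space) q).dualMap ∘ₗ
    Module.Dual.eval 𝕜 (M.space q.1) ∘ₗ M.mapPath q.2

theorem toNakayamaAt_elemHom (M : QuiverRep 𝕜 V) {i : V} (m : M.space i) (q : Σ k, Path i k)
    (l : Module.Dual 𝕜 (M.space q.1)) :
    M.toNakayamaAt i m (elemHom (v := fun k => k) (W := M.space) q l) = l (M.mapPath q.2 m) := by
  rw [toNakayamaAt, LinearMap.sum_apply, LinearMap.sum_apply, Finset.sum_eq_single q]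
  · exact LinearMap.congr_fun (elemCoeff_elemHom_self (v := fun k => k) (W := M.space) q l) _
  · intro q' _ h
    exact LinearMap.congr_fun (elemCoeff_elemHom_of_ne (v := fun k => k) (W := M.space) h l) _
  · exact fun h => absurd (Finset.mem_univ q) h

/-- The embedding `M → ν(⨁ₖ P_k ⊗ M_k)`. -/
noncomputable def toNakayama (M : QuiverRep 𝕜 V) : M.Hom M.vertexSum.nakayama :=
  Hom.mk' (fun i => M.toNakayamaAt i) fun x y a m => by
    refine dual_hom_ext (v := fun k => k) (W := M.space) fun q l => ?_
    rw [toNakayamaAt_elemHom]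
    refine Eq.trans ?_ (congrArg (M.toNakayamaAt x m)
      (pathRepHom_comp_elemHom (v := fun k => k) (W := M.space) a q l)).symm
    rw [toNakayamaAt_elemHom, mapPath_toPath_comp]
    rfl

theorem toNakayama_injective (M : QuiverRep 𝕜 V) (i : V) :
    Function.Injective (M.toNakayama.1 i) := by
  rw [← LinearMap.ker_eq_bot, LinearMap.ker_eq_bot']
  intro m hm
  rw [← Module.forall_dual_apply_eq_zero_iff 𝕜]
  intro l
  rw [← LinearMap.id_apply (R := 𝕜) m, ← mapPath_nil M i,
    ← toNakayamaAt_elemHom M m ⟨i, .nil⟩ l]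
  exact LinearMap.congr_fun hm _

/-- By biduality a functional on Hom(⨁ P_k ⊗ M_k, P_i) is a family of vectors m_p in M_{t(p)}, over
the paths p from `i`. It is killed exactly when m_{pa} = a · m_p for all arrows a, that is, when the
value at the trivial path determines it through the action of M. -/
theorem toNakayama_exact {M : QuiverRep 𝕜 V} (hM : M.IsFinDim) [Finite (Arrows V)] (i : V) :
    Function.Exact (M.toNakayama.1 i) (nakayamaMap M.vertexToArrow i) := by
  classical
  have := Fintype.ofFinite (Arrows V)
  have (x : V) : FiniteDimensional 𝕜 (M.space x) := hM x
  intro θ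
  constructor
  · intro hθ
    have hkill : ∀ ψ, θ (comp ψ M.vertexToArrow) = 0 := LinearMap.congr_fun hθ
    have hrep : ∀ q : Σ k, Path i k, ∃ m : M.space q.1, ∀ l : Module.Dual 𝕜 (M.space q.1),
        θ (elemHom (v := fun k => k) (W := M.space) q l) = l m := by
      intro q
      obtain ⟨m, hm⟩ := (Module.evalEquiv 𝕜 (M.space q.1)).surjective
        (θ ∘ₗ elemHom (v := fun k => k) (W := M.space) q)
      exact ⟨m, fun l => (LinearMap.congr_fun hm l).symm⟩
    choose m hm using hrep
    have hcons : ∀ (x y : V) (p : Path i x) (a : x ⟶ y),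
        m ⟨y, p.cons a⟩ = M.map a (m ⟨x, p⟩) := by
      intro x y p a
      rw [← sub_eq_zero, ← Module.forall_dual_apply_eq_zero_iff 𝕜]
      intro l
      have h := hkill (elemHom (v := fun α : Arrows V => α.1) (W := fun α => M.space α.2.1)
        ⟨⟨x, y, a⟩, p⟩ l)
      rw [elemHom_comp_vertexToArrow, map_sub, hm, hm] at h
      rw [map_sub]
      exact h
    have hpath : ∀ (x : V) (p : Path i x), m ⟨x, p⟩ = M.mapPath p (m ⟨i, .nil⟩) := by
      intro x p
      induction p with
      | nil => rfl
      | cons p a ih => rw [hcons, ih, mapPath_cons, LinearMap.comp_apply]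
    refine ⟨m ⟨i, .nil⟩, dual_hom_ext (v := fun k => k) (W := M.space) fun q l => ?_⟩
    rw [hm]
    refine (toNakayamaAt_elemHom M _ q l).trans ?_
    rw [← hpath q.1 q.2]
  · rintro ⟨m, rfl⟩
    refine dual_hom_ext (v := fun α : Arrows V => α.1) (W := fun α => M.space α.2.1)
      fun q l => ?_
    change M.toNakayamaAt i m (comp _ M.vertexToArrow) = 0
    rw [elemHom_comp_vertexToArrow, map_sub, toNakayamaAt_elemHom, toNakayamaAt_elemHom, sub_eq_zero]
    rfl

end InverseTranslate

/-! ### Every noninjective indecomposable is a translate. -/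

section Existence

variable {𝕜 : Type u} [Field 𝕜] {V : Type} [Quiver.{0} V]

/-- `⨁ₖ P_k ⊗ M_k → ⨁ₐ P_{s(a)} ⊗ M_{t(a)}` is injective if `Hom(νP, M) = 0` for all
projective `P`. -/
theorem vertexToArrow_injective [Finite V] [Finite (Arrows V)] [∀ x y : V, Finite (Path x y)]
    {M : QuiverRep 𝕜 V} (hM : M.IsFinDim)
    (h : ∀ (P : QuiverRep 𝕜 V) (f : P.nakayama.Hom M), f = 0) (x : V) :
    Function.Injective (M.vertexToArrow.1 x) := by
  classical
  have := Fintype.ofFinite V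
  have (x y : V) := Fintype.ofFinite (Path x y)
  -- ν(κ) is killed by ν of `vertexToArrow`, so it factors through M and vanishes by hypothesis.
  -- Hence every morphism from ⨁ P_k ⊗ M_k to a P_y vanishes on the kernel; the elementary ones read
  -- off all coefficients, so the kernel is zero.
  let κ := kernelIncl M.vertexToArrow
  obtain ⟨g, hg⟩ := exists_factor_of_range M.toNakayama M.toNakayama_injective (nakayamaHom κ)
    fun y θ => ((toNakayama_exact hM y) _).mp (by
      refine LinearMap.ext fun ψ => ?_
      change θ (comp (comp ψ M.vertexToArrow) κ) = 0
      rw [← map_zero θ]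
      refine congrArg θ (Hom.ext' fun z v => ?_)
      exact (congrArg (ψ.1 z) v.2).trans (map_zero _))
  rw [h _ g] at hg
  have hzero : ∀ (y : V) (φ : M.vertexSum.Hom (pathRep 𝕜 y)), comp φ κ = 0 := by
    intro y φ
    have := Module.Free.of_divisionRing 𝕜 ((kernel M.vertexToArrow).Hom (pathRep 𝕜 y))
    have : Module.Projective 𝕜 ((kernel M.vertexToArrow).Hom (pathRep 𝕜 y)) :=
      Module.Projective.of_free
    refine (Module.forall_dual_apply_eq_zero_iff 𝕜 (comp φ κ)).mp fun θ => ?_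
    have h1 : nakayamaMap κ y θ = 0 :=
      (LinearMap.congr_fun (congrFun (congrArg Subtype.val hg) y) θ).symm.trans
        (map_zero (M.toNakayama.1 y))
    exact LinearMap.congr_fun h1 φ
  rw [← LinearMap.ker_eq_bot, LinearMap.ker_eq_bot']
  intro u hu
  refine funext fun k => Finsupp.ext fun p => ?_
  refine (Module.forall_dual_apply_eq_zero_iff 𝕜 (u k p)).mp fun l => ?_
  have h1 := LinearMap.congr_fun (congrFun (congrArg Subtype.val
    (hzero k (elemHom (v := fun k => k) (W := M.space) ⟨k, .nil⟩ l))) x) ⟨u, hu⟩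
  rw [← copowerToPathRep_nil_apply]
  exact DFunLike.congr_fun h1 p

theorem dimVec_copower [∀ x y : V, Finite (Path x y)] (i : V) (W : Type u) [AddCommGroup W]
    [Module 𝕜 W] [FiniteDimensional 𝕜 W] (x : V) :
    (copower (𝕜 := 𝕜) i W).dimVec x = Module.finrank 𝕜 W * (pathRep 𝕜 i).dimVec x := by
  have := Fintype.ofFinite (Path i x)
  have h1 : Module.finrank 𝕜 (Path i x →₀ W) = Fintype.card (Path i x) * Module.finrank 𝕜 W := by
    rw [(Finsupp.linearEquivFunOnFinite 𝕜 W (Path i x)).finrank_eq, Module.finrank_pi_fintype]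
    simp
  have h2 : Module.finrank 𝕜 (Path i x →₀ 𝕜) = Fintype.card (Path i x) :=
    Module.finrank_finsupp_self 𝕜
  rw [dimVec, dimVec, h1, h2]
  push_cast
  ring

theorem dimVec_pi {ι : Type} [Fintype ι] {F : ι → QuiverRep 𝕜 V} (h : ∀ k, (F k).IsFinDim) :
    (pi F).dimVec = ∑ k, (F k).dimVec := by
  funext x
  have (k : ι) : FiniteDimensional 𝕜 ((F k).space x) := h k x
  rw [Finset.sum_apply, dimVec, Module.finrank_pi_fintype, Nat.cast_sum]
  rfl

variable [Fintype V] [Fintype (Arrows V)] [∀ x y : V, Finite (x ⟶ y)] [hQ : Fact (IsAcyclicQuiver V)]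

/-- An indecomposable representation that is not injective is the translate of a representation
without nonzero morphisms to projectives. -/
theorem IsIndecomposable.exists_isARTranslate_to {M : QuiverRep 𝕜 V} (hM : M.IsIndecomposable)
    (hfd : M.IsFinDim) (hI : ¬ M.IsInjective) :
    ∃ N, N.IsARTranslate M ∧ ∀ x, homDim N (pathRep 𝕜 x) = 0 := by
  classical
  have (x y : V) := Fintype.ofFinite (Path x y)
  have (x : V) : FiniteDimensional 𝕜 (M.space x) := hfd x
  have hinj := vertexToArrow_injective hfd fun P f => hM.eq_zero_of_nakayama hQ.out hfd hI f
  have hex := cokernel_exact M.vertexToArrow hinj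
  have hP₁ : M.vertexSum.IsProjective := isProjective_pi_copower (fun k => k) M.space
  have hP₀ : M.arrowSum.IsProjective :=
    isProjective_pi_copower (fun α : Arrows V => α.1) fun α => M.space α.2.1
  have hT : (cokernel M.vertexToArrow).IsARTranslate M :=
    ⟨_, _, _, _, M.toNakayama, hP₁, hP₀, hex,
      fun x => ⟨M.toNakayama_injective x, toNakayama_exact hfd x⟩⟩
  refine ⟨_, hT, fun x => ?_⟩
  -- Exactness and ⟨P_x, M⟩ = dim M_x give -⟨N, P_x⟩ = dim M_x for the cokernel N. The translate
  -- formula says dim M_x = dim Hom(N, P_x) - ⟨N, P_x⟩, so Hom(N, P_x) has dimension zero.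
  have h1 := hT.dimVec_eq x
  have h2 : M.arrowSum.dimVec = M.vertexSum.dimVec + (cokernel M.vertexToArrow).dimVec :=
    funext (hex.dimVec_eq hP₀.1)
  have h3 : eulerForm M.vertexSum.dimVec (pathRep 𝕜 x).dimVec =
      ∑ k, (pathRep 𝕜 x).dimVec k * M.dimVec k := by
    rw [dimVec_pi fun k => isFinDim_copower, eulerForm_sum_left]
    refine Finset.sum_congr rfl fun k _ => ?_
    rw [show (copower (𝕜 := 𝕜) k (M.space k)).dimVec = M.dimVec k • (pathRep 𝕜 k).dimVec from
      funext (dimVec_copower k (M.space k)), eulerForm_smul_left, eulerForm_pathRep, mul_comm]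
  have h4 : eulerForm M.arrowSum.dimVec (pathRep 𝕜 x).dimVec =
      ∑ α : Arrows V, (pathRep 𝕜 x).dimVec α.1 * M.dimVec α.2.1 := by
    rw [dimVec_pi fun α => isFinDim_copower, eulerForm_sum_left]
    refine Finset.sum_congr rfl fun α _ => ?_
    rw [show (copower (𝕜 := 𝕜) α.1 (M.space α.2.1)).dimVec =
      M.dimVec α.2.1 • (pathRep 𝕜 α.1).dimVec from
      funext (dimVec_copower α.1 (M.space α.2.1)), eulerForm_smul_left, eulerForm_pathRep, mul_comm]
  have h5 := eulerForm_pathRep 𝕜 x M.dimVec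
  rw [eulerForm, ← h3, ← h4, h2, eulerForm_add_left] at h5
  omega

end Existence

end QuiverRep

namespace QuiverRep

/-! ### The defect, and its sign on preprojectives and postinjectives. -/

section Defect

variable {𝕜 : Type u} [Field 𝕜] {V : Type} [Quiver.{0} V]

/-- At a vertex of the support that receives no arrow from the support, any functional is a morphism
to a simple. The target has dimension vector δ, which turns Euler pairings with δ into statements on
Hom. -/
theorem homDim_pos_semisimple [Finite V] (hQ : IsAcyclicQuiver V) {M : QuiverRep 𝕜 V}
    (hfd : M.IsFinDim) (hM : ¬ M.IsZero) : 0 < homDim M (semisimpleRep 𝕜 fun _ => 1) := by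
  classical
  obtain ⟨x, ⟨v, hv⟩, hmin⟩ := hQ.wellFounded_source.has_min {x | ∃ v : M.space x, v ≠ 0}
    (exists_ne_zero_of_not_isZero hM)
  obtain ⟨l, hl⟩ : ∃ l : Module.Dual 𝕜 (M.space x), l v ≠ 0 := by
    by_contra! h
    exact hv ((Module.forall_dual_apply_eq_zero_iff 𝕜 v).mp h)
  refine homDim_pos hfd (fun x => inferInstance) (f := Hom.mk'
    (fun y => if h : y = x then LinearMap.pi fun _ => l ∘ₗ (h ▸ LinearMap.id) else 0)
    fun y z a w => ?_) ?_
  · by_cases hz : z = x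
    · subst hz
      have hw : w = 0 := by
        by_contra hw
        exact hmin y ⟨w, hw⟩ ⟨a⟩
      simp [hw]
    · simp [hz]
  · intro h
    have h1 := congrFun (LinearMap.congr_fun (congrFun (congrArg Subtype.val h) x) v) 0
    simp only [Hom.mk'] at h1
    rw [dif_pos trivial] at h1
    exact hl h1

theorem homDim_semisimple_pos [Finite V] (hQ : IsAcyclicQuiver V) {M : QuiverRep 𝕜 V}
    (hfd : M.IsFinDim) (hM : ¬ M.IsZero) : 0 < homDim (semisimpleRep 𝕜 fun _ => 1) M := by
  classical
  obtain ⟨x, ⟨v, hv⟩, hmin⟩ := hQ.wellFounded_target.has_min {x | ∃ v : M.space x, v ≠ 0}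
    (exists_ne_zero_of_not_isZero hM)
  refine homDim_pos (fun x => inferInstance) hfd (f := Hom.mk'
    (fun y => if h : y = x then
      (LinearMap.toSpanSingleton 𝕜 (M.space y) (h ▸ v)) ∘ₗ LinearMap.proj 0 else 0)
    fun y z a w => ?_) ?_
  · have hz : M.map a = 0 ∨ y ≠ x := by
      by_cases hy : y = x
      · subst hy
        refine Or.inl (LinearMap.ext fun w => ?_)
        by_contra hw
        exact hmin z ⟨_, hw⟩ ⟨a⟩
      · exact Or.inr hy
    rcases hz with hz | hz
    · simp [hz]
    · simp [hz]
  · intro h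
    have h1 := LinearMap.congr_fun (congrFun (congrArg Subtype.val h) x) (fun _ => 1)
    simp only [Hom.mk'] at h1
    rw [dif_pos trivial] at h1
    refine hv ((one_smul 𝕜 v).symm.trans h1)

theorem IsZero.dimVec_eq {M : QuiverRep 𝕜 V} (hM : M.IsZero) : M.dimVec = 0 := by
  funext x
  have := hM x
  rw [dimVec, Module.finrank_zero_of_subsingleton]
  rfl

theorem isZero_of_dimVec_eq_zero {M : QuiverRep 𝕜 V} (hfd : M.IsFinDim) (hM : M.dimVec = 0) :
    M.IsZero := fun x => (dimVec_eq_zero_iff hfd x).mp (congrFun hM x)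

theorem IsZero.homDim_left {M : QuiverRep 𝕜 V} (hM : M.IsZero) (N : QuiverRep 𝕜 V) :
    homDim M N = 0 := by
  have : Subsingleton (M.Hom N) := ⟨fun f g => Hom.ext' fun x v => by
    have := hM x
    rw [Subsingleton.elim v 0, map_zero, map_zero]⟩
  exact Module.finrank_zero_of_subsingleton

theorem IsZero.homDim_right {N : QuiverRep 𝕜 V} (hN : N.IsZero) (M : QuiverRep 𝕜 V) :
    homDim M N = 0 := by
  have : Subsingleton (M.Hom N) := ⟨fun f g => Hom.ext' fun x v => (hN x).elim _ _⟩
  exact Module.finrank_zero_of_subsingleton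

theorem dimVec_semisimple_one :
    (semisimpleRep 𝕜 (fun _ : V => 1)).dimVec = fun _ => 1 :=
  funext fun x => (dimVec_semisimpleRep _ x).trans Nat.cast_one

theorem IsIso.isZero {M N : QuiverRep 𝕜 V} (h : M.IsIso N) (hM : M.IsZero) : N.IsZero := by
  obtain ⟨f, hf⟩ := h
  intro x
  have := hM x
  exact (hf x).2.subsingleton

variable [Fintype V] [Fintype (Arrows V)]

/-- The defect of a dimension vector, with respect to the vector `(1, …, 1)`. -/
def defect (d : V → ℤ) : ℤ := eulerForm (fun _ => 1) d

/-- The vector `(1, …, 1)` is in the radical of the symmetrized Euler form. -/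
def OneRadical (V : Type) [Quiver.{0} V] [Fintype V] [Fintype (Arrows V)] : Prop :=
  ∀ d : V → ℤ, defect d = -eulerForm d fun _ => 1

theorem IsProjective.defect_neg (hQ : IsAcyclicQuiver V) (hδ : OneRadical V)
    {P : QuiverRep 𝕜 V} (hP : P.IsProjective) (h0 : ¬ P.IsZero) : defect P.dimVec < 0 := by
  have h1 := hP.homDim_eq (X := semisimpleRep 𝕜 fun _ => 1) fun x => inferInstance
  have h2 := homDim_pos_semisimple hQ hP.1 h0
  rw [dimVec_semisimple_one] at h1
  rw [hδ]
  omega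

theorem IsInjective.defect_pos (hQ : IsAcyclicQuiver V)
    {I : QuiverRep 𝕜 V} (hI : I.IsInjective) (h0 : ¬ I.IsZero) : 0 < defect I.dimVec := by
  have hfd : (semisimpleRep 𝕜 fun _ : V => 1).IsFinDim := fun x => inferInstance
  have h1 := (extVanish_iff hfd hI.1).mp (hI.extVanish hfd)
  have h2 := homDim_semisimple_pos hQ hI.1 h0
  rw [dimVec_semisimple_one] at h1
  rw [defect]
  omega

variable [∀ x y : V, Finite (x ⟶ y)]

/-- Grouping the arrows by source, the term at `x` is the dimension of Hom(M, P_x) minus that of the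
source of the injection `outMap`. -/
theorem defect_homDim_pathRep_nonneg [∀ x y : V, Finite (Path x y)] {M : QuiverRep 𝕜 V}
    (hM : M.IsFinDim) : 0 ≤ defect fun x => (homDim M (pathRep 𝕜 x) : ℤ) := by
  have (x : V) := Fintype.ofFinite (Σ y, (x ⟶ y))
  have hle : ∀ x, ∑ b : Σ y, (x ⟶ y), homDim M (pathRep 𝕜 b.1) ≤ homDim M (pathRep 𝕜 x) := by
    intro x
    have h1 (y : V) : FiniteDimensional 𝕜 (M.Hom (pathRep 𝕜 y)) :=
      finiteDimensional_hom hM (isFinDim_pathRep y)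
    have h2 := LinearMap.finrank_le_finrank_of_injective (outMap_injective M x)
    rwa [Module.finrank_pi_fintype] at h2
  rw [defect, eulerForm]
  simp only [one_mul]
  have hsum : ∑ α : Arrows V, (homDim M (pathRep 𝕜 α.2.1) : ℤ) =
      ∑ x, ∑ b : Σ y, (x ⟶ y), (homDim M (pathRep 𝕜 b.1) : ℤ) :=
    (Finset.sum_congr (Finset.ext fun _ => by simp) fun _ _ => rfl).trans
      (Fintype.sum_sigma fun α : Arrows V => (homDim M (pathRep 𝕜 α.2.1) : ℤ))
  rw [hsum, ← Finset.sum_sub_distrib]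
  refine Finset.sum_nonneg fun x _ => ?_
  have := hle x
  rw [sub_nonneg]
  exact_mod_cast this

variable [hQ : Fact (IsAcyclicQuiver V)]

/-- The defect does not decrease under `τ`. -/
theorem IsARTranslate.defect_le (hδ : OneRadical V) {M T : QuiverRep 𝕜 V}
    (h : M.IsARTranslate T) : defect M.dimVec ≤ defect T.dimVec := by
  -- Pairing with δ: the first vector contributes a nonnegative number, the second contributes -⟨M,
  -- δ⟩ = ∂(M).
  have h1 : T.dimVec = (fun x => (homDim M (pathRep 𝕜 x) : ℤ)) -
      fun x => eulerForm M.dimVec (pathRep 𝕜 x).dimVec := funext h.dimVec_eq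
  have h2 := defect_homDim_pathRep_nonneg h.isFinDim_left
  rw [h1, hδ M.dimVec]
  rw [defect] at h2 ⊢
  rw [eulerForm_sub_right, eulerForm_eulerForm_pathRep]
  omega

/-- If T = 0, the Auslander-Reiten formula for the semisimple S with dimension vector δ gives dim
Hom(M, S) = ⟨M, δ⟩ = -∂(M) ≤ 0, but Hom(M, S) is nonzero. -/
theorem IsARTranslate.not_isZero (hδ : OneRadical V) {M T : QuiverRep 𝕜 V}
    (h : M.IsARTranslate T) (h0 : ¬ M.IsZero) (hdef : 0 ≤ defect M.dimVec) : ¬ T.IsZero := by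
  intro hT
  have h1 := h.homDim_eq (X := semisimpleRep 𝕜 fun _ => 1) fun x => inferInstance
  have h2 := homDim_pos_semisimple hQ.out h.isFinDim_left h0
  rw [hT.homDim_right, dimVec_semisimple_one] at h1
  rw [hδ] at hdef
  omega

/-- Nonzero representations of nonnegative defect are not preprojective. -/
theorem not_isPreprojective (hδ : OneRadical V) {M : QuiverRep 𝕜 V} (h0 : ¬ M.IsZero)
    (hdef : 0 ≤ defect M.dimVec) : ¬ M.IsPreprojective := by
  rintro ⟨m, P, hm, hP⟩
  induction m generalizing M with
  | zero =>
    have hiso : M.IsIso P := hm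
    have := hP.defect_neg hQ.out hδ fun h => h0 (hiso.symm.isZero h)
    rw [← hiso.dimVec_eq] at this
    omega
  | succ m ih =>
    obtain ⟨L, hL, hLm⟩ := hm
    exact ih (hL.not_isZero hδ h0 hdef) (hdef.trans (hL.defect_le hδ)) hLm

/-- Nonzero postinjective representations have positive defect. -/
theorem IsPostinjective.defect_pos (hδ : OneRadical V) {M : QuiverRep 𝕜 V}
    (h : M.IsPostinjective) (h0 : ¬ M.IsZero) : 0 < defect M.dimVec := by
  obtain ⟨m, I, hI, hm⟩ := h
  -- The injective object may be zero; the alternative is stable under τ, and only its second case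
  -- can end in a nonzero M.
  have key : I.IsZero ∨ 0 < defect I.dimVec := by
    by_cases h : I.IsZero
    · exact Or.inl h
    · exact Or.inr (hI.defect_pos hQ.out h)
  clear hI
  induction m generalizing I with
  | zero =>
    have hiso : I.IsIso M := hm
    rw [← hiso.dimVec_eq]
    exact key.resolve_left fun h => h0 (hiso.isZero h)
  | succ m ih =>
    obtain ⟨L, hL, hLm⟩ := hm
    refine ih L hLm (key.imp (fun h => ?_) fun h => h.trans_le (hL.defect_le hδ))
    refine isZero_of_dimVec_eq_zero hL.isFinDim_right (funext fun x => ?_)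
    rw [hL.dimVec_eq, h.homDim_left, h.dimVec_eq, eulerForm]
    simp

end Defect

/-! ### Exceptional representations and their orbits under τ and its inverse. -/

section Sequences

variable {𝕜 : Type u} [Field 𝕜] {V : Type} [Quiver.{0} V]

theorem IsARTranslate.of_isIso {M M' T : QuiverRep 𝕜 V} (h : M.IsARTranslate T)
    (hM : M'.IsIso M) : M'.IsARTranslate T := by
  obtain ⟨g, hg⟩ := hM.symm
  obtain ⟨P₁, P₀, i, p, j, hP₁, hP₀, hip, hj⟩ := h
  refine ⟨P₁, P₀, i, comp g p, j, hP₁, hP₀, fun x => ⟨(hip x).1, fun v => ?_,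
    (hg x).2.comp (hip x).2.2⟩, hj⟩
  rw [comp_apply, ← (hip x).2.1 v, map_eq_zero_iff _ (hg x).1]

theorem IsIterARTranslate.snoc {m : ℕ} {M N T : QuiverRep 𝕜 V} (h : IsIterARTranslate m M N)
    (hN : N.IsARTranslate T) : IsIterARTranslate (m + 1) M T := by
  induction m generalizing M with
  | zero =>
    have hiso : M.IsIso N := h
    exact ⟨T, hN.of_isIso hiso, IsIso.refl T⟩
  | succ m ih =>
    obtain ⟨L, hL, hLm⟩ := h
    exact ⟨L, hL, ih hLm⟩

variable [Fintype V] [Fintype (Arrows V)]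

/-- Finite-dimensional representations with `End(M) = 𝕜` and `Ext¹(M, M) = 0`. -/
def IsExceptional (M : QuiverRep 𝕜 V) : Prop :=
  M.IsFinDim ∧ homDim M M = 1 ∧ eulerForm M.dimVec M.dimVec = 1

theorem IsExceptional.not_isZero {M : QuiverRep 𝕜 V} (hM : M.IsExceptional) : ¬ M.IsZero := by
  intro h
  have h1 := hM.2.1
  rw [h.homDim_left] at h1
  exact zero_ne_one h1

theorem IsExceptional.exists_eq_smul_id {M : QuiverRep 𝕜 V} (hM : M.IsExceptional)
    (f : M.Hom M) : ∃ c : 𝕜, f = c • M.idHom :=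
  (homDim_self_eq_one_iff hM.not_isZero).mp hM.2.1 f

theorem IsExceptional.isIndecomposable {M : QuiverRep 𝕜 V} (hM : M.IsExceptional) :
    M.IsIndecomposable :=
  isIndecomposable_of_scalar hM.not_isZero hM.exists_eq_smul_id

theorem IsExceptional.extVanish {M : QuiverRep 𝕜 V} (hM : M.IsExceptional) : M.ExtVanish M :=
  (extVanish_iff hM.1 hM.1).mpr (by rw [hM.2.1, hM.2.2, Nat.cast_one])

theorem IsIndecomposable.isExceptional [IsAlgClosed 𝕜] [CharZero 𝕜] {M : QuiverRep 𝕜 V}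
    (hM : M.IsIndecomposable) (hfd : M.IsFinDim) (hrig : M.IsRigid) : M.IsExceptional := by
  have hext := extOneVanishes_iff.mp hrig
  have h1 := (homDim_self_eq_one_iff hM.1).mpr (hM.exists_eq_smul_id hfd hext)
  refine ⟨hfd, h1, ?_⟩
  rw [← (extVanish_iff hfd hfd).mp hext, h1, Nat.cast_one]

variable [∀ x y : V, Finite (x ⟶ y)] [hQ : Fact (IsAcyclicQuiver V)]

/-- Iterating `τ` on an exceptional representation that is not preprojective. -/
theorem IsExceptional.exists_seq_of_not_isPreprojective {M : QuiverRep 𝕜 V}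
    (hM : M.IsExceptional) (hpre : ¬ M.IsPreprojective) :
    ∃ x : ℕ → V → ℤ, x 0 = M.dimVec ∧ (∀ m i, 0 ≤ x m i) ∧
      ∀ m y, eulerForm y (x (m + 1)) = -eulerForm (x m) y := by
  have step : ∀ L : {L : QuiverRep 𝕜 V // L.IsExceptional ∧ ¬ L.IsPreprojective},
      ∃ T : {L : QuiverRep 𝕜 V // L.IsExceptional ∧ ¬ L.IsPreprojective},
        ∀ y, eulerForm y T.1.dimVec = -eulerForm L.1.dimVec y := by
    rintro ⟨L, hL, hLp⟩
    have hnp : ¬ L.IsProjective := fun h => hLp ⟨0, L, IsIso.refl L, h⟩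
    have hhom := hL.isIndecomposable.homDim_pathRep_eq_zero hL.1 hnp
    obtain ⟨T, hT⟩ := exists_isARTranslate hL.1
    refine ⟨⟨T, ⟨hT.isFinDim_right, ?_, ?_⟩, fun ⟨m, P, hm, hP⟩ => hLp ⟨m + 1, P, ⟨T, hT, hm⟩, hP⟩⟩,
      hT.eulerForm_right hhom⟩
    · rw [hT.homDim_self hhom, hL.2.1]
    · rw [hT.eulerForm_self hhom, hL.2.2]
  choose next hnext using step
  let s : ℕ → {L : QuiverRep 𝕜 V // L.IsExceptional ∧ ¬ L.IsPreprojective} :=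
    fun m => next^[m] ⟨M, hM, hpre⟩
  refine ⟨fun m => (s m).1.dimVec, rfl, fun m => (s m).1.dimVec_nonneg, fun m y => ?_⟩
  change eulerForm y (next^[m + 1] _).1.dimVec = _
  rw [Function.iterate_succ_apply']
  exact hnext _ y

/-- Iterating `τ⁻` on an exceptional representation that is not postinjective. -/
theorem IsExceptional.exists_seq_of_not_isPostinjective {M : QuiverRep 𝕜 V}
    (hM : M.IsExceptional) (hpost : ¬ M.IsPostinjective) :
    ∃ x : ℕ → V → ℤ, x 0 = M.dimVec ∧ (∀ m i, 0 ≤ x m i) ∧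
      ∀ m y, eulerForm y (x m) = -eulerForm (x (m + 1)) y := by
  have step : ∀ L : {L : QuiverRep 𝕜 V // L.IsExceptional ∧ ¬ L.IsPostinjective},
      ∃ N : {L : QuiverRep 𝕜 V // L.IsExceptional ∧ ¬ L.IsPostinjective},
        ∀ y, eulerForm y L.1.dimVec = -eulerForm N.1.dimVec y := by
    rintro ⟨L, hL, hLp⟩
    have hni : ¬ L.IsInjective := fun h => hLp ⟨0, L, h, IsIso.refl L⟩
    obtain ⟨N, hN, hhom⟩ := hL.isIndecomposable.exists_isARTranslate_to hL.1 hni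
    refine ⟨⟨N, ⟨hN.isFinDim_left, ?_, ?_⟩, fun ⟨m, I, hI, hm⟩ => hLp ⟨m + 1, I, hI, hm.snoc hN⟩⟩,
      hN.eulerForm_right hhom⟩
    · rw [← hN.homDim_self hhom, hL.2.1]
    · rw [← hN.eulerForm_self hhom, hL.2.2]
  choose next hnext using step
  let s : ℕ → {L : QuiverRep 𝕜 V // L.IsExceptional ∧ ¬ L.IsPostinjective} :=
    fun m => next^[m] ⟨M, hM, hpost⟩
  refine ⟨fun m => (s m).1.dimVec, rfl, fun m => (s m).1.dimVec_nonneg, fun m y => ?_⟩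
  change _ = -eulerForm (next^[m + 1] _).1.dimVec y
  rw [Function.iterate_succ_apply']
  exact hnext _ y

end Sequences

end QuiverRep
open QuiverRep

/-! ### Cyclic intervals and integer vectors on ℤ/n. -/

section ZModCycle

variable {n : ℕ} [NeZero n]

theorem zmod_induction {P : ZMod n → Prop} (x₀ : ZMod n) (h0 : P x₀)
    (hs : ∀ i, P i → P (i + 1)) (i : ZMod n) : P i := by
  have key : ∀ t : ℕ, P (x₀ + t) := by
    intro t
    induction t with
    | zero => simpa using h0
    | succ t ih =>
      rw [Nat.cast_succ, ← add_assoc]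
      exact hs _ ih
  have := key (i - x₀).val
  rwa [ZMod.natCast_zmod_val, add_sub_cancel] at this

theorem sum_add_one (f : ZMod n → ℤ) : ∑ i, f (i + 1) = ∑ i, f i :=
  Equiv.sum_comp (Equiv.addRight (1 : ZMod n)) f

theorem left_mem_cyclicInterval {n : ℕ} (k ℓ : ZMod n) : k ∈ cyclicInterval k ℓ := by
  simp [cyclicInterval]

theorem right_mem_cyclicInterval {n : ℕ} (k ℓ : ZMod n) : ℓ ∈ cyclicInterval k ℓ :=
  show (ℓ - k).val ≤ (ℓ - k).val from le_refl _

theorem val_add_one_sub (k i : ZMod n) : (i + 1 - k).val = ((i - k).val + 1) % n := by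
  rw [add_sub_right_comm, ZMod.val_add, ZMod.val_one_eq_one_mod, Nat.add_mod_mod]

theorem cyclicInterval_eq_univ_iff (k ℓ : ZMod n) :
    cyclicInterval k ℓ = Set.univ ↔ ℓ + 1 = k := by
  have hn : 0 < n := Nat.pos_of_ne_zero (NeZero.ne n)
  have hℓ := ZMod.val_lt (ℓ - k)
  have h1 := val_add_one_sub k ℓ
  constructor
  · intro h
    have h2 : (ℓ + 1 - k).val ≤ (ℓ - k).val := by
      have : ℓ + 1 ∈ cyclicInterval k ℓ := h ▸ Set.mem_univ _
      exact this
    have h3 : (ℓ - k).val + 1 = n := by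
      by_contra hne
      rw [Nat.mod_eq_of_lt (by omega)] at h1
      omega
    rw [h3, Nat.mod_self] at h1
    exact sub_eq_zero.mp ((ZMod.val_eq_zero _).mp h1)
  · intro h
    rw [sub_eq_zero.mpr h, ZMod.val_zero] at h1
    refine Set.eq_univ_of_forall fun x => ?_
    have hx := ZMod.val_lt (x - k)
    have : (ℓ - k).val + 1 = n := by
      by_contra hne
      rw [Nat.mod_eq_of_lt (by omega)] at h1
      omega
    change (x - k).val ≤ (ℓ - k).val
    omega

theorem add_one_mem_cyclicInterval_iff (k ℓ i : ZMod n) :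
    i + 1 ∈ cyclicInterval k ℓ ↔ i + 1 = k ∨ (i ∈ cyclicInterval k ℓ ∧ i ≠ ℓ) := by
  have hi := ZMod.val_lt (i - k)
  have h1 := val_add_one_sub k i
  have hk : i + 1 = k ↔ (i + 1 - k).val = 0 := by rw [ZMod.val_eq_zero, sub_eq_zero]
  have hℓ : i = ℓ ↔ (i - k).val = (ℓ - k).val := by
    rw [(ZMod.val_injective n).eq_iff, sub_left_inj]
  change (i + 1 - k).val ≤ (ℓ - k).val ↔ i + 1 = k ∨ ((i - k).val ≤ (ℓ - k).val ∧ i ≠ ℓ)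
  rw [Ne, hk, hℓ]
  by_cases hn : (i - k).val + 1 = n
  · rw [hn, Nat.mod_self] at h1
    omega
  · rw [Nat.mod_eq_of_lt (by omega)] at h1
    omega

theorem not_mem_cyclicInterval_of_add_one_eq {k ℓ : ZMod n} (h : ℓ + 1 ≠ k) {i : ZMod n}
    (hi : i + 1 = k) : i ∉ cyclicInterval k ℓ := by
  have h1 := val_add_one_sub k i
  have h2 := ZMod.val_lt (ℓ - k)
  rw [sub_eq_zero.mpr hi, ZMod.val_zero] at h1
  have h3 : (i - k).val + 1 = n := by
    have := ZMod.val_lt (i - k)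
    by_contra hne
    rw [Nat.mod_eq_of_lt (by omega)] at h1
    omega
  intro (hmem : (i - k).val ≤ (ℓ - k).val)
  have : (i - k).val = (ℓ - k).val := by omega
  rw [(ZMod.val_injective n).eq_iff, sub_left_inj] at this
  exact h (this ▸ hi)

theorem cyclicInterval_induction {k ℓ : ZMod n} {P : ZMod n → Prop} (h0 : P k)
    (hs : ∀ i ∈ cyclicInterval k ℓ, i ≠ ℓ → P i → P (i + 1)) (i : ZMod n)
    (hi : i ∈ cyclicInterval k ℓ) : P i := by
  have : ∀ i, i ∈ cyclicInterval k ℓ → P i := by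
    refine zmod_induction k (fun _ => h0) fun i ih hi => ?_
    rcases (add_one_mem_cyclicInterval_iff k ℓ i).mp hi with rfl | ⟨h1, h2⟩
    · exact h0
    · exact hs i h1 h2 (ih h1)
  exact this i hi

open Classical in
/-- The indicator vector of a cyclic interval. -/
noncomputable def indicatorVec (k ℓ : ZMod n) (i : ZMod n) : ℤ :=
  if i ∈ cyclicInterval k ℓ then 1 else 0

/-- The discrete derivative: a step up on entering the interval at `k`, a step down on leaving it
after `ℓ`. -/
theorem indicatorVec_add_one {k ℓ : ZMod n} (h : ℓ + 1 ≠ k) (i : ZMod n) :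
    indicatorVec k ℓ (i + 1) - indicatorVec k ℓ i =
      (if i + 1 = k then 1 else 0) - if i = ℓ then 1 else 0 := by
  unfold indicatorVec
  by_cases h1 : i + 1 = k
  · have h2 := not_mem_cyclicInterval_of_add_one_eq h h1
    have h3 : i ≠ ℓ := fun e => h2 (e ▸ right_mem_cyclicInterval k ℓ)
    have h4 := (add_one_mem_cyclicInterval_iff k ℓ i).mpr (Or.inl h1)
    rw [if_pos h4, if_neg h2, if_pos h1, if_neg h3]
  · have h4 := add_one_mem_cyclicInterval_iff k ℓ i
    by_cases h3 : i = ℓ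
    · have h5 : i ∈ cyclicInterval k ℓ := h3 ▸ right_mem_cyclicInterval k ℓ
      have h6 : i + 1 ∉ cyclicInterval k ℓ := fun hm =>
        (h4.mp hm).elim h1 fun hh => hh.2 h3
      rw [if_neg h6, if_pos h5, if_neg h1, if_pos h3]
    · have h5 : i + 1 ∈ cyclicInterval k ℓ ↔ i ∈ cyclicInterval k ℓ := by tauto
      rw [if_neg h1, if_neg h3]
      by_cases h6 : i ∈ cyclicInterval k ℓ
      · rw [if_pos h6, if_pos (h5.mpr h6)]
        rfl
      · rw [if_neg h6, if_neg (mt h5.mp h6)]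

theorem sum_sq_indicatorVec {k ℓ : ZMod n} (h : ℓ + 1 ≠ k) :
    ∑ i, (indicatorVec k ℓ i - indicatorVec k ℓ (i + 1)) ^ 2 = 2 := by
  have h1 : ∀ i : ZMod n, (indicatorVec k ℓ i - indicatorVec k ℓ (i + 1)) ^ 2 =
      (if i = k - 1 then 1 else 0) + if i = ℓ then 1 else 0 := by
    intro i
    have e : i = k - 1 ↔ i + 1 = k := eq_sub_iff_add_eq
    rw [← neg_sub, indicatorVec_add_one h]
    by_cases h1 : i + 1 = k
    · have h2 : i ≠ ℓ := fun h2 => h (h2 ▸ h1)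
      rw [if_pos h1, if_pos (e.mpr h1), if_neg h2]
      norm_num
    · rw [if_neg h1, if_neg (mt e.mp h1)]
      by_cases h2 : i = ℓ <;> simp [h2]
  rw [Finset.sum_congr rfl fun i _ => h1 i, Finset.sum_add_distrib]
  simp

/-- A vector on the cycle with `∑ (d_i - d_{i+1})² = 2` is an interval plus a constant. -/
theorem exists_eq_add_indicatorVec {d : ZMod n → ℤ} (hd : ∑ i, (d i - d (i + 1)) ^ 2 = 2) :
    ∃ (k ℓ : ZMod n) (m : ℤ), ℓ + 1 ≠ k ∧ ∀ i, d i = m + indicatorVec k ℓ i := by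
  have hsum : ∑ i, (d i - d (i + 1)) = 0 := by
    rw [Finset.sum_sub_distrib, sum_add_one, sub_self]
  -- No square exceeds 2, so all differences lie in {-1, 0, 1}. Their sum is 0 and their squares sum
  -- to 2, so there is exactly one 1 and one -1.
  have hval : ∀ i, d i - d (i + 1) = -1 ∨ d i - d (i + 1) = 0 ∨ d i - d (i + 1) = 1 := by
    intro i
    have h1 : (d i - d (i + 1)) ^ 2 ≤ 2 := by
      rw [← hd]
      exact Finset.single_le_sum (f := fun i => (d i - d (i + 1)) ^ 2)
        (fun j _ => sq_nonneg _) (Finset.mem_univ i)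
    have h2 : d i - d (i + 1) < 2 := by nlinarith
    have h3 : -2 < d i - d (i + 1) := by nlinarith
    omega
  have e1 : ∑ i, (d i - d (i + 1)) ^ 2 = (Finset.univ.filter fun i => d i - d (i + 1) = 1).card +
      (Finset.univ.filter fun i => d i - d (i + 1) = -1).card := by
    rw [Finset.card_filter, Finset.card_filter]
    push_cast
    rw [← Finset.sum_add_distrib]
    refine Finset.sum_congr rfl fun i _ => ?_
    rcases hval i with h | h | h <;> simp [h]
  have e2 : ∑ i, (d i - d (i + 1)) = (Finset.univ.filter fun i => d i - d (i + 1) = 1).card -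
      ((Finset.univ.filter fun i => d i - d (i + 1) = -1).card : ℤ) := by
    rw [Finset.card_filter, Finset.card_filter]
    push_cast
    rw [← Finset.sum_sub_distrib]
    refine Finset.sum_congr rfl fun i _ => ?_
    rcases hval i with h | h | h <;> simp [h]
  obtain ⟨ℓ, hℓ⟩ := Finset.card_eq_one.mp
    (show (Finset.univ.filter fun i => d i - d (i + 1) = 1).card = 1 by omega)
  obtain ⟨p, hp⟩ := Finset.card_eq_one.mp
    (show (Finset.univ.filter fun i => d i - d (i + 1) = -1).card = 1 by omega)
  have hℓ' : ∀ i, d i - d (i + 1) = 1 ↔ i = ℓ := fun i => by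
    simpa using Finset.ext_iff.mp hℓ i
  have hp' : ∀ i, d i - d (i + 1) = -1 ↔ i = p := fun i => by
    simpa using Finset.ext_iff.mp hp i
  have hne : ℓ + 1 ≠ p + 1 := by
    intro h
    have h1 := (hℓ' ℓ).mpr rfl
    have h2 := (hp' ℓ).mpr (add_right_cancel h)
    omega
  -- The vector rises between `p` and `p + 1` and drops between `ℓ` and `ℓ + 1`, so the interval is
  -- [p + 1, ℓ].
  refine ⟨p + 1, ℓ, d 0 - indicatorVec (p + 1) ℓ 0, hne, fun i => ?_⟩
  refine zmod_induction (P := fun i => d i = d 0 - indicatorVec (p + 1) ℓ 0 +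
    indicatorVec (p + 1) ℓ i) 0 (by ring) (fun i ih => ?_) i
  have h1 := indicatorVec_add_one hne i
  simp only [add_left_inj] at h1
  have h2 := hℓ' i
  have h3 := hp' i
  rcases hval i with h | h | h
  · rw [if_pos (h3.mp h), if_neg fun e => by have := h2.mpr e; omega] at h1
    omega
  · rw [if_neg fun e => by have := h3.mpr e; omega, if_neg fun e => by have := h2.mpr e; omega] at h1
    omega
  · rw [if_pos (h2.mp h), if_neg fun e => by have := h3.mpr e; omega] at h1
    omega

/-- A sequence of nonnegative vectors with bounded differences has two members that differ by a
nonnegative constant. -/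
theorem exists_add_const {x : ℕ → ZMod n → ℤ} (hx : ∀ m i, 0 ≤ x m i) {B : ℤ}
    (hB : ∀ m i, |x m i - x m (i + 1)| ≤ B) :
    ∃ m N : ℕ, 0 < N ∧ ∃ k : ℤ, 0 ≤ k ∧ ∀ i, x (m + N) i = x m i + k := by
  let D : ℕ → ZMod n → Set.Icc (-B) B := fun m i => ⟨x m i - x m (i + 1), abs_le.mp (hB m i)⟩
  -- Bounded differences take finitely many values, so one pattern recurs infinitely often. Starting
  -- from an occurrence with minimal value at vertex 0 makes the constant nonnegative.
  obtain ⟨y, hy⟩ := Finite.exists_infinite_fiber D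
  have hinf : (D ⁻¹' {y}).Infinite := Set.infinite_coe_iff.mp hy
  obtain ⟨m, hm, hmin⟩ := WellFounded.has_min (measure fun m : ℕ => (x m 0).toNat).wf _
    hinf.nonempty
  obtain ⟨m', hm', hlt⟩ := hinf.exists_gt m
  refine ⟨m, m' - m, by omega, x m' 0 - x m 0, ?_, fun i => ?_⟩
  · have h1 : ¬ (x m' 0).toNat < (x m 0).toNat := hmin m' hm'
    have h2 := hx m 0
    have h3 := hx m' 0
    omega
  · rw [show m + (m' - m) = m' by omega]
    refine zmod_induction (P := fun i => x m' i = x m i + (x m' 0 - x m 0)) 0 (by ring)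
      (fun i ih => ?_) i
    have h1 : D m i = D m' i := by
      rw [show D m = y from hm, show D m' = y from hm']
    have h2 : x m i - x m (i + 1) = x m' i - x m' (i + 1) := congrArg Subtype.val h1
    omega

end ZModCycle

/-! ### The Euler form, defect and Coxeter orbits of the cycle. -/

section CycleQuiver

variable {n : ℕ} (o : ZMod n → Bool)

theorem cycleArrow_induction {o : ZMod n → Bool}
    {P : ∀ x y : CycleQuiver o, (x ⟶ y) → Prop}
    (h1 : ∀ (i : ZMod n) (h : o i = true), P i (i + 1 : ZMod n) (CycleArrow.clockwise i h))
    (h2 : ∀ (i : ZMod n) (h : o i = false), P (i + 1 : ZMod n) i (CycleArrow.counterclockwise i h))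
    {x y : CycleQuiver o} (a : x ⟶ y) : P x y a :=
  @CycleArrow.rec n o (fun x y a => P x y a) h1 h2 x y a

/-- The arrows of the cycle are indexed by `ℤ/n`. -/
def cycleArrowsEquiv : ZMod n ≃ Arrows (CycleQuiver o) where
  toFun i := if h : o i = true then ⟨i, (i + 1 : ZMod n), CycleArrow.clockwise i h⟩
    else ⟨(i + 1 : ZMod n), i, CycleArrow.counterclockwise i (Bool.eq_false_of_not_eq_true h)⟩
  invFun α := match α with
    | ⟨_, _, CycleArrow.clockwise i _⟩ => i
    | ⟨_, _, CycleArrow.counterclockwise i _⟩ => i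
  left_inv i := by
    by_cases h : o i = true <;> simp [h]
  right_inv α := by
    match α with
    | ⟨_, _, CycleArrow.clockwise i h⟩ => simp [h]
    | ⟨_, _, CycleArrow.counterclockwise i h⟩ => simp [h]

instance CycleQuiver.instFinite [NeZero n] (x y : CycleQuiver o) : Finite (x ⟶ y) :=
  Finite.of_injective (fun a => (cycleArrowsEquiv o).symm ⟨x, y, a⟩) fun a b h => by
    have := (cycleArrowsEquiv o).symm.injective h
    simpa using this

variable [NeZero n]

instance CycleQuiver.instFintype : Fintype (CycleQuiver o) := inferInstanceAs (Fintype (ZMod n))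

instance CycleQuiver.instFintypeArrows : Fintype (Arrows (CycleQuiver o)) :=
  Fintype.ofEquiv (ZMod n) (cycleArrowsEquiv o)

theorem sum_cycleArrows (F : ZMod n → ZMod n → ℤ) :
    ∑ α : Arrows (CycleQuiver o), F α.1 α.2.1 =
      ∑ i, if o i = true then F i (i + 1) else F (i + 1) i := by
  rw [← Equiv.sum_comp (cycleArrowsEquiv o)]
  refine Finset.sum_congr rfl fun i _ => ?_
  by_cases h : o i = true
  · rw [if_pos h, show cycleArrowsEquiv o i = _ from dif_pos h]
  · rw [if_neg h, show cycleArrowsEquiv o i = _ from dif_neg h]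

theorem eulerForm_cycle (d e : ZMod n → ℤ) :
    eulerForm (V := CycleQuiver o) d e =
      ∑ i, d i * e i - ∑ i, if o i = true then d i * e (i + 1) else d (i + 1) * e i :=
  congrArg₂ (· - ·) rfl (sum_cycleArrows o fun x y => d x * e y)

theorem two_mul_eulerForm_self (d : ZMod n → ℤ) :
    2 * eulerForm (V := CycleQuiver o) d d = ∑ i, (d i - d (i + 1)) ^ 2 := by
  have h1 : ∑ i, (if o i = true then d i * d (i + 1) else d (i + 1) * d i) =
      ∑ i, d i * d (i + 1) :=
    Finset.sum_congr rfl fun i _ => by rw [mul_comm (d (i + 1)), ite_self]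
  have h2 := sum_add_one fun i => d i * d i
  have h3 : ∑ i, (d i - d (i + 1)) ^ 2 =
      ∑ i, d i * d i + ∑ i, d (i + 1) * d (i + 1) - 2 * ∑ i, d i * d (i + 1) := by
    rw [Finset.mul_sum, ← Finset.sum_add_distrib, ← Finset.sum_sub_distrib]
    exact Finset.sum_congr rfl fun i _ => by ring
  rw [eulerForm_cycle, h1, h3, h2]
  ring

theorem defect_cycle (d : ZMod n → ℤ) :
    defect (V := CycleQuiver o) d = ∑ i, if o i = true then d i - d (i + 1) else 0 := by
  refine (eulerForm_cycle o (fun _ => 1) d).trans ?_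
  rw [← Finset.sum_sub_distrib]
  refine Finset.sum_congr rfl fun i _ => ?_
  by_cases h : o i = true <;> simp [h]

/-- In ⟨δ, d⟩ + ⟨d, δ⟩ each arrow subtracts the values at both of its ends. Every vertex is an end
of two edges, counted with multiplicity, so the sum is zero. -/
theorem oneRadical_cycle : OneRadical (CycleQuiver o) := by
  suffices h : ∀ d : ZMod n → ℤ, defect (V := CycleQuiver o) d =
      -eulerForm (V := CycleQuiver o) d fun _ => 1 from h
  intro d
  have h1 : eulerForm (V := CycleQuiver o) d (fun _ => 1) = _ := eulerForm_cycle o d fun _ => 1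
  have h2 : defect (V := CycleQuiver o) d = _ := eulerForm_cycle o (fun _ => 1) d
  have h3 : ∑ i : ZMod n, (if o i = true then (1 : ℤ) * d (i + 1) else 1 * d i) +
      ∑ i : ZMod n, (if o i = true then d i * 1 else d (i + 1) * 1) =
        ∑ i : ZMod n, d i + ∑ i : ZMod n, d (i + 1) := by
    rw [← Finset.sum_add_distrib, ← Finset.sum_add_distrib]
    refine Finset.sum_congr rfl fun i _ => ?_
    by_cases h : o i = true
    · simp only [h, if_true]
      ring
    · simp only [h, if_false, Bool.false_eq_true]
      ring
  have h4 : ∑ i : ZMod n, d (i + 1) = ∑ i : ZMod n, d i := sum_add_one d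
  simp only [one_mul, mul_one] at *
  rw [h1, h2]
  omega

theorem eq_const_of_eulerForm_nonpos {d : ZMod n → ℤ}
    (h : eulerForm (V := CycleQuiver o) d d ≤ 0) (i : ZMod n) : d i = d (i + 1) := by
  have h1 := two_mul_eulerForm_self o d
  have h2 : ∑ i, (d i - d (i + 1)) ^ 2 = 0 :=
    le_antisymm (by omega) (Finset.sum_nonneg fun i _ => sq_nonneg _)
  have h3 := (Finset.sum_eq_zero_iff_of_nonneg fun i _ => sq_nonneg _).mp h2 i (Finset.mem_univ i)
  exact sub_eq_zero.mp (pow_eq_zero_iff two_ne_zero |>.mp h3)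

theorem eulerForm_pos_of_defect_ne_zero {d : ZMod n → ℤ}
    (h : defect (V := CycleQuiver o) d ≠ 0) : 0 < eulerForm (V := CycleQuiver o) d d := by
  by_contra hle
  refine h ?_
  rw [defect_cycle]
  refine Finset.sum_eq_zero fun i _ => ?_
  rw [← eq_const_of_eulerForm_nonpos o (not_lt.mp hle) i, sub_self, ite_self]

theorem abs_sub_le_of_eulerForm_eq {d : ZMod n → ℤ} {c : ℤ}
    (h : eulerForm (V := CycleQuiver o) d d = c) (i : ZMod n) : |d i - d (i + 1)| ≤ 2 * c := by
  have h1 := two_mul_eulerForm_self o d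
  rw [h] at h1
  rw [h1]
  calc |d i - d (i + 1)| ≤ (d i - d (i + 1)) ^ 2 := by
        rw [← sq_abs]
        exact Int.le_self_sq _
    _ ≤ _ := Finset.single_le_sum (f := fun i => (d i - d (i + 1)) ^ 2)
        (fun j _ => sq_nonneg _) (Finset.mem_univ i)

theorem sum_range_succ_eq_add_const {V : Type*} {x : ℕ → V → ℤ} {m N : ℕ} {k : ℤ}
    (h : ∀ i, x (m + N) i = x m i + k) :
    ∑ j ∈ Finset.range N, x (m + (j + 1)) = ∑ j ∈ Finset.range N, x (m + j) + k • fun _ => 1 := by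
  rw [← sub_eq_iff_eq_add', ← Finset.sum_sub_distrib,
    Finset.sum_range_sub (fun j => x (m + j))]
  funext i
  simp [h]

/-- Forward Coxeter orbits of negative defect leave the positive cone. -/
theorem defect_nonneg_of_coxeter_seq {x : ℕ → CycleQuiver o → ℤ} (hx : ∀ m i, 0 ≤ x m i)
    (hc : ∀ m y, eulerForm (V := CycleQuiver o) y (x (m + 1)) =
      -eulerForm (V := CycleQuiver o) (x m) y) : 0 ≤ defect (V := CycleQuiver o) (x 0) := by
  by_contra! hneg
  have hdef : ∀ m, defect (V := CycleQuiver o) (x m) = defect (V := CycleQuiver o) (x 0) := by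
    intro m
    induction m with
    | zero => rfl
    | succ m ih => rw [← ih, oneRadical_cycle o (x m)]; exact hc m _
  have hq : ∀ m, eulerForm (V := CycleQuiver o) (x m) (x m) =
      eulerForm (V := CycleQuiver o) (x 0) (x 0) := by
    intro m
    induction m with
    | zero => rfl
    | succ m ih => rw [← ih, hc m (x (m + 1)), hc m (x m), neg_neg]
  obtain ⟨m, N, hN, k, hk, h⟩ := exists_add_const hx fun m =>
    abs_sub_le_of_eulerForm_eq o (hq m)
  -- For this sum, ⟨a, a + kδ⟩ = -⟨a, a⟩, so 2q(a) = k∂(a) ≤ 0. But ∂(a) = N∂(x₀) ≠ 0 forces q(a) >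
  -- 0.
  set a := ∑ j ∈ Finset.range N, x (m + j) with ha
  have hab := sum_range_succ_eq_add_const h
  have h1 : eulerForm (V := CycleQuiver o) a (a + k • fun _ => 1) =
      -eulerForm (V := CycleQuiver o) a a := by
    refine (congrArg (eulerForm (V := CycleQuiver o) a) hab.symm).trans ?_
    refine (eulerForm_sum_right (V := CycleQuiver o) _ _ _).trans (Eq.trans ?_
      (congrArg Neg.neg (eulerForm_sum_left (V := CycleQuiver o) (Finset.range N) (fun j => x (m + j)) a)).symm)
    rw [← Finset.sum_neg_distrib]
    exact Finset.sum_congr rfl fun j _ => hc (m + j) a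
  have h1' : eulerForm (V := CycleQuiver o) a a +
      k * eulerForm (V := CycleQuiver o) a (fun _ => 1) =
      -eulerForm (V := CycleQuiver o) a a := by
    rw [← h1]
    refine ((eulerForm_add_right (V := CycleQuiver o) a a _).trans ?_).symm
    exact congrArg _ (eulerForm_smul_right (V := CycleQuiver o) k a _)
  have h2 := oneRadical_cycle o a
  have h3 : defect (V := CycleQuiver o) a < 0 := by
    have : defect (V := CycleQuiver o) a = N * defect (V := CycleQuiver o) (x 0) := by
      refine (eulerForm_sum_right (V := CycleQuiver o) _ _ _).trans
        ((Finset.sum_congr rfl fun j _ => hdef (m + j)).trans ?_)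
      simp
    rw [this]
    exact mul_neg_of_pos_of_neg (by exact_mod_cast hN) hneg
  have h4 := eulerForm_pos_of_defect_ne_zero o h3.ne
  nlinarith

/-- Backward Coxeter orbits of positive defect leave the positive cone. -/
theorem defect_nonpos_of_inverse_coxeter_seq {x : ℕ → CycleQuiver o → ℤ} (hx : ∀ m i, 0 ≤ x m i)
    (hc : ∀ m y, eulerForm (V := CycleQuiver o) y (x m) =
      -eulerForm (V := CycleQuiver o) (x (m + 1)) y) :
    defect (V := CycleQuiver o) (x 0) ≤ 0 := by
  by_contra! hpos
  have hdef : ∀ m, defect (V := CycleQuiver o) (x m) = defect (V := CycleQuiver o) (x 0) := by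
    intro m
    induction m with
    | zero => rfl
    | succ m ih => rw [← ih, oneRadical_cycle o (x (m + 1))]; exact (hc m _).symm
  have hq : ∀ m, eulerForm (V := CycleQuiver o) (x m) (x m) =
      eulerForm (V := CycleQuiver o) (x 0) (x 0) := by
    intro m
    induction m with
    | zero => rfl
    | succ m ih => rw [← ih, hc m (x m), hc m (x (m + 1)), neg_neg]
  obtain ⟨m, N, hN, k, hk, h⟩ := exists_add_const hx fun m =>
    abs_sub_le_of_eulerForm_eq o (hq m)
  set a := ∑ j ∈ Finset.range N, x (m + j) with ha
  have hab := sum_range_succ_eq_add_const h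
  -- Here b = a + kδ and ⟨b, a⟩ = -⟨b, b⟩, so 2q(b) = -k∂(b) ≤ 0 although ∂(b) ≠ 0.
  set b := ∑ j ∈ Finset.range N, x (m + (j + 1)) with hb
  have h1 : eulerForm (V := CycleQuiver o) b a = -eulerForm (V := CycleQuiver o) b b := by
    refine (eulerForm_sum_right (V := CycleQuiver o) _ _ _).trans (Eq.trans ?_
      (congrArg Neg.neg (eulerForm_sum_left (V := CycleQuiver o) (Finset.range N) (fun j => x (m + (j + 1))) b)).symm)
    rw [← Finset.sum_neg_distrib]
    exact Finset.sum_congr rfl fun j _ => hc (m + j) b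
  have h1' : eulerForm (V := CycleQuiver o) b b = eulerForm (V := CycleQuiver o) b a +
      k * eulerForm (V := CycleQuiver o) b (fun _ => 1) := by
    refine Eq.trans ?_ ((eulerForm_add_right (V := CycleQuiver o) b a _).trans
      (congrArg _ (eulerForm_smul_right (V := CycleQuiver o) k b _)))
    exact congrArg _ hab
  have h2 := oneRadical_cycle o b
  have h3 : 0 < defect (V := CycleQuiver o) b := by
    have : defect (V := CycleQuiver o) b = N * defect (V := CycleQuiver o) (x 0) := by
      refine (eulerForm_sum_right (V := CycleQuiver o) _ _ _).trans
        ((Finset.sum_congr rfl fun j _ => hdef (m + (j + 1))).trans ?_)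
      simp
    rw [this]
    exact mul_pos (by exact_mod_cast hN) hpos
  have h4 := eulerForm_pos_of_defect_ne_zero o h3.ne'
  nlinarith

theorem isQuiverSource_iff {n : ℕ} (o : ZMod n → Bool) (x : ZMod n) :
    IsQuiverSource (V := CycleQuiver o) x ↔ o (x - 1) = false ∧ o x = true := by
  constructor
  · intro h
    constructor
    · by_contra h1
      have a : CycleArrow o (x - 1) (x - 1 + 1) :=
        CycleArrow.clockwise (x - 1) (Bool.eq_true_of_not_eq_false h1)
      rw [sub_add_cancel] at a
      exact (h (x - 1 : ZMod n)).elim a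
    · by_contra h1
      exact (h (x + 1 : ZMod n)).elim
        (CycleArrow.counterclockwise x (Bool.eq_false_of_not_eq_true h1))
  · rintro ⟨h1, h2⟩ y
    refine ⟨fun a => ?_⟩
    refine cycleArrow_induction (P := fun _ x _ => o ((show ZMod n from x) - 1) = false →
      o x = true → False) (fun i h h1 _ => ?_)
      (fun i h _ h2 => Bool.false_ne_true (h.symm.trans h2)) a h1 h2
    change o (i + 1 - 1) = false at h1
    rw [add_sub_cancel_right] at h1
    exact Bool.false_ne_true (h1.symm.trans h)

theorem isQuiverSink_iff {n : ℕ} (o : ZMod n → Bool) (x : ZMod n) :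
    IsQuiverSink (V := CycleQuiver o) x ↔ o (x - 1) = true ∧ o x = false := by
  constructor
  · intro h
    constructor
    · by_contra h1
      have a : CycleArrow o (x - 1 + 1) (x - 1) :=
        CycleArrow.counterclockwise (x - 1) (Bool.eq_false_of_not_eq_true h1)
      rw [sub_add_cancel] at a
      exact (h (x - 1 : ZMod n)).elim a
    · by_contra h1
      exact (h (x + 1 : ZMod n)).elim
        (CycleArrow.clockwise x (Bool.eq_true_of_not_eq_false h1))
  · rintro ⟨h1, h2⟩ y
    refine ⟨fun a => ?_⟩
    refine cycleArrow_induction (P := fun x _ _ => o ((show ZMod n from x) - 1) = true →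
      o x = false → False) (fun i h _ h2 => Bool.false_ne_true (h2.symm.trans h))
      (fun i h h1 _ => ?_) a h1 h2
    change o (i + 1 - 1) = true at h1
    rw [add_sub_cancel_right] at h1
    exact Bool.false_ne_true (h.symm.trans h1)

/-- The defect of an interval is the number of sources minus the number of sinks in it. -/
theorem defect_indicatorVec (k ℓ : ZMod n) :
    defect (V := CycleQuiver o) (indicatorVec k ℓ) =
      (Set.ncard {x : ZMod n | x ∈ cyclicInterval k ℓ ∧
        IsQuiverSource (V := CycleQuiver o) x} : ℤ) -
      Set.ncard {x : ZMod n | x ∈ cyclicInterval k ℓ ∧ IsQuiverSink (V := CycleQuiver o) x} := by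
  classical
  -- After this shift the value at `i` has coefficient [o i] - [o (i - 1)]: 1 at a source, -1 at a
  -- sink, 0 elsewhere.
  have h1 : ∑ i, (if o i = true then indicatorVec k ℓ (i + 1) else 0) =
      ∑ i, if o (i - 1) = true then indicatorVec k ℓ i else 0 := by
    rw [← sum_add_one fun i => if o (i - 1) = true then indicatorVec k ℓ i else 0]
    simp only [add_sub_cancel_right]
  have h2 : ∀ i, (if o i = true then indicatorVec k ℓ i - indicatorVec k ℓ (i + 1) else 0) =
      (if o i = true then indicatorVec k ℓ i else 0) -
        if o i = true then indicatorVec k ℓ (i + 1) else 0 := fun i => by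
    by_cases h : o i = true <;> simp [h]
  rw [defect_cycle, Finset.sum_congr rfl fun i _ => h2 i, Finset.sum_sub_distrib, h1,
    ← Finset.sum_sub_distrib, Set.ncard_eq_toFinset_card', Set.ncard_eq_toFinset_card',
    Set.toFinset_ofPred, Set.toFinset_ofPred, Finset.card_filter, Finset.card_filter]
  push_cast
  rw [← Finset.sum_sub_distrib]
  refine Finset.sum_congr rfl fun i _ => ?_
  rw [isQuiverSource_iff, isQuiverSink_iff, indicatorVec]
  by_cases h : i ∈ cyclicInterval k ℓ <;> cases o i <;> cases o (i - 1) <;> simp [h]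

end CycleQuiver

namespace QuiverRep

/-! ### Arrows acting on rigid representations. -/

section RigidMaps

variable {𝕜 : Type u} [Field 𝕜] {V : Type} [Quiver.{0} V]

/-- The maps of a rigid representation have maximal rank. -/
theorem ExtVanish.injective_or_surjective {M : QuiverRep 𝕜 V} (h : M.ExtVanish M) {x y : V}
    (a : x ⟶ y) : Function.Injective (M.map a) ∨ Function.Surjective (M.map a) := by
  classical
  by_contra! hcon
  obtain ⟨h1, h2⟩ := hcon
  rw [← LinearMap.ker_eq_bot, ← Ne, Submodule.ne_bot_iff] at h1
  obtain ⟨v, hv, hv0⟩ := h1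
  rw [LinearMap.mem_ker] at hv
  refine h2 fun w => ?_
  obtain ⟨φ, hφ⟩ := not_forall.mp (mt (Module.forall_dual_apply_eq_zero_iff 𝕜 v).mp hv0)
  set ψ : Module.Dual 𝕜 (M.space x) := (φ v)⁻¹ • φ
  have hψ : ψ v = 1 := inv_mul_cancel₀ hφ
  -- The cocycle is -ψ ⊗ w at `a` and zero elsewhere. Evaluating its coboundary equation at the
  -- kernel vector `v`, where ψ v = 1, gives w = M_a(f v).
  obtain ⟨f, hf⟩ := h (Pi.single (⟨x, y, a⟩ : Arrows V) (-ψ.smulRight w))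
  have h3 : f y (M.map a v) - M.map a (f x v) = _ :=
    LinearMap.congr_fun (congrFun hf ⟨x, y, a⟩) v
  rw [Pi.single_eq_same] at h3
  simp only [hv, map_zero, LinearMap.neg_apply, LinearMap.smulRight_apply, hψ,
    one_smul, zero_sub, neg_inj] at h3
  exact ⟨_, h3⟩

theorem ExtVanish.bijective_of_dimVec_eq {M : QuiverRep 𝕜 V} (h : M.ExtVanish M)
    (hfd : M.IsFinDim) {x y : V} (a : x ⟶ y) (hd : M.dimVec x = M.dimVec y) :
    Function.Bijective (M.map a) := by
  have := hfd x
  have := hfd y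
  have e := LinearMap.injective_iff_surjective_of_finrank_eq_finrank (f := M.map a)
    (Int.natCast_inj.mp hd)
  rcases h.injective_or_surjective a with h | h
  · exact ⟨h, e.mp h⟩
  · exact ⟨e.mpr h, h⟩

theorem hom_eq_zero_iff_of_bijective {A B : QuiverRep 𝕜 V} (f : A.Hom B) {x y : V} (a : x ⟶ y)
    (hA : Function.Bijective (A.map a)) (hB : Function.Bijective (B.map a)) :
    f.1 x = 0 ↔ f.1 y = 0 := by
  constructor
  · intro h
    ext v
    obtain ⟨u, rfl⟩ := hA.2 v
    rw [hom_map, h, LinearMap.zero_apply, map_zero, LinearMap.zero_apply]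
  · intro h
    ext v
    apply hB.1
    rw [← hom_map, h, LinearMap.zero_apply, LinearMap.zero_apply, map_zero]

end RigidMaps

/-! ### Interval representations and the classification. -/

section Interval

variable {𝕜 : Type u} [Field 𝕜] {n : ℕ} {o : ZMod n → Bool} {k ℓ : ZMod n}

/-- The arrows inside the interval `[k,ℓ]` act bijectively. -/
def BijectiveOnInterval (A : QuiverRep 𝕜 (CycleQuiver o)) (k ℓ : ZMod n) : Prop :=
  ∀ (x y : CycleQuiver o) (a : x ⟶ y), x ∈ cyclicInterval k ℓ → y ∈ cyclicInterval k ℓ →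
    Function.Bijective (A.map a)

theorem subsingleton_intervalRep {i : ZMod n} (hi : i ∉ cyclicInterval k ℓ) :
    Subsingleton ((intervalRep 𝕜 o k ℓ).space i) := by
  have : IsEmpty (PLift (i ∈ cyclicInterval k ℓ)) := ⟨fun h => hi h.down⟩
  exact inferInstanceAs (Subsingleton (PLift (i ∈ cyclicInterval k ℓ) → 𝕜))

theorem finrank_intervalRep {i : ZMod n} (hi : i ∈ cyclicInterval k ℓ) :
    Module.finrank 𝕜 ((intervalRep 𝕜 o k ℓ).space i) = 1 := by
  have : Unique (PLift (i ∈ cyclicInterval k ℓ)) := ⟨⟨⟨hi⟩⟩, fun _ => rfl⟩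
  change Module.finrank 𝕜 (PLift (i ∈ cyclicInterval k ℓ) → 𝕜) = 1
  rw [Module.finrank_fintype_fun_eq_card, Fintype.card_unique]

theorem isFinDim_intervalRep : (intervalRep 𝕜 o k ℓ).IsFinDim := fun x =>
  inferInstanceAs (FiniteDimensional 𝕜 (PLift (x ∈ cyclicInterval k ℓ) → 𝕜))

theorem bijectiveOnInterval_intervalRep :
    BijectiveOnInterval (intervalRep 𝕜 o k ℓ) k ℓ := by
  intro x y a hx hy
  have key : ∀ (v : PLift (x ∈ cyclicInterval k ℓ) → 𝕜),
      (intervalRep 𝕜 o k ℓ).map a v = fun _ => v ⟨hx⟩ := fun v => funext fun _ => dif_pos hx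
  refine ⟨fun v w h => ?_, fun w => ⟨fun _ => w ⟨hy⟩, key _⟩⟩
  rw [key, key] at h
  exact funext fun _ => congrFun h ⟨hy⟩

theorem dimVec_intervalRep : (intervalRep 𝕜 o k ℓ).dimVec = indicatorVec k ℓ := by
  funext i
  by_cases hi : i ∈ cyclicInterval k ℓ
  · exact (congrArg Nat.cast (finrank_intervalRep hi)).trans (if_pos hi).symm
  · have := subsingleton_intervalRep (𝕜 := 𝕜) (o := o) hi
    exact (congrArg Nat.cast Module.finrank_zero_of_subsingleton).trans (if_neg hi).symm

variable [NeZero n]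

/-- Vanishing passes along a bijective arrow in either direction, hence along the whole interval. -/
theorem BijectiveOnInterval.hom_eq_zero_iff {A B : QuiverRep 𝕜 (CycleQuiver o)}
    (hA : BijectiveOnInterval A k ℓ) (hB : BijectiveOnInterval B k ℓ) (f : A.Hom B)
    (i : ZMod n) (hi : i ∈ cyclicInterval k ℓ) : f.1 k = 0 ↔ f.1 i = 0 := by
  refine cyclicInterval_induction (P := fun i => f.1 k = 0 ↔ f.1 i = 0) Iff.rfl
    (fun i hi hne ih => ih.trans ?_) i hi
  have hi' := (add_one_mem_cyclicInterval_iff k ℓ i).mpr (Or.inr ⟨hi, hne⟩)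
  by_cases h : o i = true
  · have a : (show CycleQuiver o from i) ⟶ (i + 1 : ZMod n) := CycleArrow.clockwise i h
    exact hom_eq_zero_iff_of_bijective f a (hA _ _ a hi hi') (hB _ _ a hi hi')
  · have a : (show CycleQuiver o from (i + 1 : ZMod n)) ⟶ i :=
      CycleArrow.counterclockwise i (Bool.eq_false_of_not_eq_true h)
    exact (hom_eq_zero_iff_of_bijective f a (hA _ _ a hi' hi) (hB _ _ a hi' hi)).symm

/-- An endomorphism is a scalar at `k`; subtracting that scalar leaves one that vanishes at `k`,
hence on the interval. The two unit jumps of the indicator give q = 1. -/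
theorem isExceptional_intervalRep (h : ℓ + 1 ≠ k) : (intervalRep 𝕜 o k ℓ).IsExceptional := by
  have hk := left_mem_cyclicInterval k ℓ
  have hfk := finrank_intervalRep (𝕜 := 𝕜) (o := o) hk
  have h0 : ¬ (intervalRep 𝕜 o k ℓ).IsZero := fun h => by
    have := h k
    rw [Module.finrank_zero_of_subsingleton] at hfk
    exact zero_ne_one hfk
  refine ⟨isFinDim_intervalRep, (homDim_self_eq_one_iff h0).mpr fun f => ?_, ?_⟩
  · let e : (intervalRep 𝕜 o k ℓ).space k := fun _ => 1
    refine ⟨f.1 k e ⟨hk⟩, sub_eq_zero.mp ?_⟩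
    set g := f - f.1 k e ⟨hk⟩ • idHom _ with hg
    have hgk : g.1 k = 0 := by
      refine LinearMap.ext fun v => ?_
      have hv : v = v ⟨hk⟩ • e := funext fun _ => (mul_one _).symm
      rw [hv, map_smul]
      refine (congrArg (v ⟨hk⟩ • ·) ?_).trans (smul_zero _)
      refine funext fun _ => ?_
      change f.1 k e ⟨hk⟩ - f.1 k e ⟨hk⟩ * 1 = 0
      rw [mul_one, sub_self]
    refine Subtype.ext (funext fun i => ?_)
    by_cases hi : i ∈ cyclicInterval k ℓ
    · exact (bijectiveOnInterval_intervalRep.hom_eq_zero_iff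
        bijectiveOnInterval_intervalRep g i hi).mp hgk
    · have := subsingleton_intervalRep (𝕜 := 𝕜) (o := o) hi
      exact LinearMap.ext fun v => Subsingleton.elim _ _
  · rw [dimVec_intervalRep]
    have h1 := two_mul_eulerForm_self o (indicatorVec k ℓ)
    rw [sum_sq_indicatorVec h] at h1
    omega

theorem IsBalancedProperInterval.add_one_ne (h : IsBalancedProperInterval o k ℓ) : ℓ + 1 ≠ k :=
  fun e => h.1 ((cyclicInterval_eq_univ_iff k ℓ).mpr e)

theorem isBalancedProperInterval_iff :
    IsBalancedProperInterval o k ℓ ↔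
      ℓ + 1 ≠ k ∧ defect (V := CycleQuiver o) (indicatorVec k ℓ) = 0 := by
  rw [IsBalancedProperInterval, Ne, cyclicInterval_eq_univ_iff, defect_indicatorVec, sub_eq_zero,
    Nat.cast_inj, eq_comm (a := Set.ncard _)]

/-- A representation with nonzero maps to and from an interval representation that has only scalar
endomorphisms and is bijective on the arrows of the interval is that interval representation. -/
theorem isIso_intervalRep {M : QuiverRep 𝕜 (CycleQuiver o)}
    (hM : ∀ f : M.Hom M, ∃ c : 𝕜, f = c • M.idHom) (hbij : BijectiveOnInterval M k ℓ)
    {f : (intervalRep 𝕜 o k ℓ).Hom M} (hf : f ≠ 0) {g : M.Hom (intervalRep 𝕜 o k ℓ)}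
    (hg : g ≠ 0) : (intervalRep 𝕜 o k ℓ).IsIso M := by
  have hX := bijectiveOnInterval_intervalRep (𝕜 := 𝕜) (o := o) (k := k) (ℓ := ℓ)
  have hf' : ∀ i ∈ cyclicInterval k ℓ, f.1 i ≠ 0 := by
    intro i hi h
    refine hf (Subtype.ext (funext fun j => ?_))
    by_cases hj : j ∈ cyclicInterval k ℓ
    · exact (hX.hom_eq_zero_iff hbij f j hj).mp ((hX.hom_eq_zero_iff hbij f i hi).mpr h)
    · have := subsingleton_intervalRep (𝕜 := 𝕜) (o := o) hj
      exact LinearMap.ext fun v => by rw [Subsingleton.elim v 0, map_zero, map_zero]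
  have hg' : ∀ i ∈ cyclicInterval k ℓ, g.1 i ≠ 0 := by
    intro i hi h
    refine hg (Subtype.ext (funext fun j => ?_))
    by_cases hj : j ∈ cyclicInterval k ℓ
    · exact (hbij.hom_eq_zero_iff hX g j hj).mp ((hbij.hom_eq_zero_iff hX g i hi).mpr h)
    · have := subsingleton_intervalRep (𝕜 := 𝕜) (o := o) hj
      exact LinearMap.ext fun v => Subsingleton.elim _ _
  have hinj : ∀ i, Function.Injective (f.1 i) := by
    intro i
    by_cases hi : i ∈ cyclicInterval k ℓ
    · rw [← LinearMap.ker_eq_bot, Submodule.eq_bot_iff]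
      intro v hv
      by_contra hv0
      refine hf' i hi (LinearMap.ext fun w => ?_)
      obtain ⟨c, rfl⟩ :=
        (finrank_eq_one_iff_of_nonzero' v hv0).mp (finrank_intervalRep (𝕜 := 𝕜) (o := o) hi) w
      rw [map_smul, LinearMap.mem_ker.mp hv, smul_zero, LinearMap.zero_apply]
    · have := subsingleton_intervalRep (𝕜 := 𝕜) (o := o) hi
      exact Function.injective_of_subsingleton _
  -- Since `f` is injective and `g` is nonzero, `f ∘ g` is a nonzero scalar, so `f` is surjective
  -- too.
  obtain ⟨c, hc⟩ := hM (comp f g)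
  have hc' : ∀ i v, f.1 i (g.1 i v) = c • v := fun i v =>
    LinearMap.congr_fun (congrFun (congrArg Subtype.val hc) i) v
  have hc0 : c ≠ 0 := by
    rintro rfl
    have hk := left_mem_cyclicInterval k ℓ
    have hg0 : ∀ i, g.1 i = 0 := fun i => LinearMap.ext fun v => hinj i (by
      rw [hc', zero_smul, LinearMap.zero_apply, map_zero])
    exact hg' k hk (hg0 k)
  refine ⟨f, fun i => ⟨hinj i, fun v => ⟨c⁻¹ • g.1 i v, ?_⟩⟩⟩
  rw [map_smul, hc', inv_smul_smul₀ hc0]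

/-- The forward Coxeter orbit stays nonnegative, which excludes negative defect; the backward orbit
excludes positive defect. -/
theorem IsExceptional.defect_eq_zero_of_isRegular [Fact (IsAcyclicQuiver (CycleQuiver o))]
    {M : QuiverRep 𝕜 (CycleQuiver o)} (hM : M.IsExceptional) (hreg : M.IsRegular) :
    defect M.dimVec = 0 := by
  obtain ⟨x, hx0, hx, hc⟩ := hM.exists_seq_of_not_isPreprojective hreg.1
  obtain ⟨y, hy0, hy, hc'⟩ := hM.exists_seq_of_not_isPostinjective hreg.2
  have h1 := defect_nonneg_of_coxeter_seq o hx hc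
  have h2 := defect_nonpos_of_inverse_coxeter_seq o hy hc'
  rw [hx0] at h1
  rw [hy0] at h2
  exact le_antisymm h2 h1

theorem isRegular_intervalRep [Fact (IsAcyclicQuiver (CycleQuiver o))]
    (h : IsBalancedProperInterval o k ℓ) : (intervalRep 𝕜 o k ℓ).IsRegular := by
  obtain ⟨hne, hdef⟩ := isBalancedProperInterval_iff.mp h
  have h0 := (isExceptional_intervalRep (𝕜 := 𝕜) (o := o) hne).not_isZero
  have hd : defect (intervalRep 𝕜 o k ℓ).dimVec = 0 := by rw [dimVec_intervalRep, hdef]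
  exact ⟨not_isPreprojective (oneRadical_cycle o) h0 hd.ge,
    fun hp => (hp.defect_pos (oneRadical_cycle o) h0).ne' hd⟩

theorem IsExceptional.exists_isIso_intervalRep {M : QuiverRep 𝕜 (CycleQuiver o)}
    (hM : M.IsExceptional) (hdef : defect M.dimVec = 0) :
    ∃ k ℓ : ZMod n, IsBalancedProperInterval o k ℓ ∧ M.IsIso (intervalRep 𝕜 o k ℓ) := by
  have hsq := two_mul_eulerForm_self o M.dimVec
  rw [hM.2.2, mul_one] at hsq
  obtain ⟨k, ℓ, m, hne, hd⟩ := exists_eq_add_indicatorVec hsq.symm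
  have hdvec : M.dimVec = (m • fun _ => 1) + (intervalRep 𝕜 o k ℓ).dimVec := by
    rw [dimVec_intervalRep]
    funext i
    exact (hd i).trans (congrArg (· + _) (mul_one m).symm)
  have hX := isExceptional_intervalRep (𝕜 := 𝕜) (o := o) hne
  have hrad := oneRadical_cycle o
  have hone : eulerForm (V := CycleQuiver o) (fun _ => 1) (fun _ => 1) = 0 := by
    have := hrad fun _ => 1
    change eulerForm _ _ = _ at this
    omega
  have hdX : defect (intervalRep 𝕜 o k ℓ).dimVec = 0 := by
    rw [← hdef, hdvec, defect, defect, eulerForm_add_right, eulerForm_smul_right, hone, mul_zero,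
      zero_add]
  -- The multiple of δ in dim M pairs to zero with X on either side because ∂(X) = 0, leaving q(dim
  -- X) = 1.
  have hXM : eulerForm (intervalRep 𝕜 o k ℓ).dimVec M.dimVec = 1 := by
    have h := hrad (intervalRep 𝕜 o k ℓ).dimVec
    rw [hdX] at h
    rw [hdvec, eulerForm_add_right, eulerForm_smul_right, hX.2.2, neg_eq_zero.mp h.symm, mul_zero,
      zero_add]
  have hMX : eulerForm M.dimVec (intervalRep 𝕜 o k ℓ).dimVec = 1 := by
    rw [hdvec, eulerForm_add_left, eulerForm_smul_left, hX.2.2]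
    change m * defect _ + 1 = 1
    rw [hdX, mul_zero, zero_add]
  have hXM' := eulerForm_le_homDim hX.1 hM.1
  have hMX' := eulerForm_le_homDim hM.1 hX.1
  obtain ⟨f, hf⟩ := not_isZero_of_homDim_ne_zero (M := intervalRep 𝕜 o k ℓ) (N := M) (by omega)
  obtain ⟨g, hg⟩ := not_isZero_of_homDim_ne_zero (M := M) (N := intervalRep 𝕜 o k ℓ) (by omega)
  -- Constancy on the interval is all that is needed for bijective arrows; that m = 0 is only a
  -- consequence of the isomorphism.
  have hdJ : ∀ i ∈ cyclicInterval k ℓ, M.dimVec i = m + 1 := fun i hi =>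
    (hd i).trans (congrArg (m + ·) (if_pos hi))
  have hbij : BijectiveOnInterval M k ℓ := fun x y a hx hy =>
    hM.extVanish.bijective_of_dimVec_eq hM.1 a ((hdJ x hx).trans (hdJ y hy).symm)
  exact ⟨k, ℓ, isBalancedProperInterval_iff.mpr ⟨hne, by rw [← dimVec_intervalRep (𝕜 := 𝕜), hdX]⟩,
    (isIso_intervalRep hM.exists_eq_smul_id hbij hf hg).symm⟩

end Interval

end QuiverRep

/-- The rigid regular indecomposable representations of an acyclic orientation of the `n`-cycle. -/
theorem proposition4p1 {𝕜 : Type u} [Field 𝕜] [IsAlgClosed 𝕜] [CharZero 𝕜]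
    (n : ℕ) [NeZero n] (o : ZMod n → Bool) (hQ : IsAcyclicQuiver (CycleQuiver o)) :
    (∀ k ℓ : ZMod n, IsBalancedProperInterval o k ℓ →
      (intervalRep 𝕜 o k ℓ).IsFinDim ∧ (intervalRep 𝕜 o k ℓ).IsIndecomposable ∧
        (intervalRep 𝕜 o k ℓ).IsRigid ∧ (intervalRep 𝕜 o k ℓ).IsRegular) ∧
    (∀ M : QuiverRep 𝕜 (CycleQuiver o),
      M.IsFinDim → M.IsIndecomposable → M.IsRigid → M.IsRegular →
        ∃ k ℓ : ZMod n, IsBalancedProperInterval o k ℓ ∧ M.IsIso (intervalRep 𝕜 o k ℓ)) := by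
  have : Fact (IsAcyclicQuiver (CycleQuiver o)) := ⟨hQ⟩
  constructor
  · intro k ℓ h
    have hX := isExceptional_intervalRep (𝕜 := 𝕜) (o := o) h.add_one_ne
    exact ⟨hX.1, hX.isIndecomposable, extOneVanishes_iff.mpr hX.extVanish,
      isRegular_intervalRep h⟩
  · intro M hfd hind hrig hreg
    have hM := hind.isExceptional hfd hrig
    exact hM.exists_isIso_intervalRep (hM.defect_eq_zero_of_isRegular hreg)
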